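/- Let $\mathcal C$ be a non-empty set of finite sets. For $A,B\in\mathcal C$ let $\mathcal P_{A,B}$ be the set of all set partitions of $A\cup B'$, where $B'$ is a disjoint copy of $B$, and let $\mathcal P=\mathcal P(\mathcal C)=\bigcup_{A,B\in\mathcal C}\mathcal P_{A,B}$ be the partition category over $\mathcal C$: the product of $\alpha\in\mathcal P_{A,B}$ and $\beta\in\mathcal P_{B,C}$ is the restriction to $A\cup C'$ of the join on $A\cup B''\cup C'$ of the equivalences obtained from $\alpha$ and $\beta$ by renaming the points of $B'$, respectively $B$, as points of $B''$. The rank of $\alpha\in\mathcal P_{A,B}$ is the number of its blocks that meet both $A$ and $B'$; $\ker\alpha$ and $\operatorname{coker}\alpha$ are the equivalences that $\alpha$ induces on $A$ and on $B$; and $\widehat\alpha$ is obtained from $\alpha$ by splitting each block that meets both $A$ and $B'$ into its parts in $A$ and in $B'$. Let $\xi\in\{1,2,\dots\}\cup\{\omega\}$ be the least strict upper bound of $\{|A|:A\in\mathcal C\}$, put $D_q=\{\alpha:\operatorname{rank}\alpha=q\}$ and $I_r=\{\alpha:\operatorname{rank}\alpha\le r\}$ for $q,r<\xi$, and $I_\omega=\mathcal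 P$ if $\xi=\omega$. For a set $S$ of morphisms closed under composition, a congruence on $S$ is an equivalence relation on $S$ that relates only elements of a common hom-set and is preserved by left and right multiplication by elements of $S$; $\operatorname{Cong}(S)$ is the lattice of all congruences on $S$ under inclusion, $\Delta_S$ is the diagonal relation, and $\nabla_S$ is the relation of belonging to a common hom-set. For a set $A$, $\operatorname{Eq}(A)$ is the lattice of equivalence relations on $A$. Let $\widetilde{\mathscr L},\widetilde{\mathscr R},\widetilde{\mathscr H}$ be Green's relations of $I_0$, restricted to pairs in a common hom-set. For each $1\le q<\xi$ fix $X_q\in\mathcal C$ and $q$ distinct points $x_1,\dots,x_q$ of $X_q$; for $\pi\in S_q$ let $\pi^\natural\in\mathcal P_{X_q,X_q}$ have the blocks $\{x_i,x_{i\pi}'\}$ $(1\le i\le q)$ and all other blocks singletons, and put $N^\natural=\{\pi^\natural:\pi\in N\}$. For $r$ as above, $q<r$ and $N\trianglelefteq S_{q+1}$ let $$\nu_{N^\natural}=\{(\alpha\gamma\beta,\alpha\delta\beta):\gamma,\delta\in N^\natural,\ \alpha,\beta\in I_r^1,\ \alpha\gamma\beta,\alpha\delta\beta\in D_{q+1}\},\qquad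 R_{I_q,N^\natural}=\nabla_{I_q}\cup\nu_{N^\natural}\cup\Delta_{I_r}$$ (where $I_r^1$ is $I_r$ with identities adjoined), and for $q\in\{0,1\}$ let $\lambda_{I_q,N^\natural}$, $\rho_{I_q,N^\natural}$, $\mu_{I_q,N^\natural}$ be the relations $$\{(\alpha,\beta)\in I_q\times I_q:(\widehat\alpha,\widehat\beta)\in\tau\}\cup\nu_{N^\natural}\cup\Delta_{I_r}\qquad\text{with }\tau=\widetilde{\mathscr L},\ \widetilde{\mathscr R},\ \widetilde{\mathscr H},\text{ respectively.}$$ (i) $I_0$ is the minimum ideal of $\mathcal P$, and $\alpha\mapsto(\ker\alpha,\operatorname{coker}\alpha)$ is an isomorphism from $I_0$ onto the partial rectangular band with hom-sets $\operatorname{Eq}(A)\times\operatorname{Eq}(B)$ and multiplication $(x_1,y_1)(x_2,y_2)=(x_1,y_2)$. The congruences on $I_0$ are precisely the relations $\{(\alpha,\beta): \alpha,\beta\in I_0\cap\mathcal P_{A,B},\ A,B\in\mathcal C,\ (\ker\alpha,\ker\beta)\in\varepsilon_1^A,\ (\operatorname{coker}\alpha,\operatorname{coker}\beta)\in\varepsilon_2^B\}$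 for families $\varepsilon_1,\varepsilon_2\in\prod_{A\in\mathcal C}\operatorname{Eq}(\operatorname{Eq}(A))$, and this parametrization is a lattice isomorphism $$\operatorname{Cong}(I_0)\cong\prod_{A\in\mathcal C}\operatorname{Eq}(\operatorname{Eq}(A))\times\prod_{A\in\mathcal C}\operatorname{Eq}(\operatorname{Eq}(A)).$$ (ii) If $\xi>1$, then $I_1$ is a retractable ideal of $\mathcal P$, with retraction $I_1\to I_0$, $\alpha\mapsto\widehat\alpha$; every congruence $\tau$ on $I_0$ is liftable to $I_1$ (that is, $\tau\cup\Delta_{I_1}$ is a congruence on $I_1$); and $$\operatorname{Cong}(I_1)=\{\tau\cup\Delta_{D_1}:\tau\in\operatorname{Cong}(I_0)\}\cup\{\theta_\tau:\tau\in\operatorname{Cong}(I_0)\},\qquad \theta_\tau=\{(\alpha,\beta)\in I_1\times I_1:(\widehat\alpha,\widehat\beta)\in\tau\}.$$ In particular $\operatorname{Cong}(I_1)\cong\operatorname{Cong}(I_0)\times\mathbf 2$, where $\mathbf 2$ is the two-element chain. (iii) For $2\le r<\xi$, and also for $r=\omega$ if $\xi=\omega$, $$\operatorname{Cong}(I_r)=\{\mu_{I_q,N^\natural},\lambda_{I_q,N^\natural},\rho_{I_q,N^\natural},R_{I_q,N^\natural}:0\le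 q\le1,\ N\trianglelefteq S_{q+1}\}\cup\{R_{I_q,N^\natural}:2\le q<r,\ N\trianglelefteq S_{q+1}\}\cup\{\nabla_{I_r}\}.$$ The order is as follows. The congruences listed for $q\le1$ are twelve distinct ones and form the direct product of the three-element chain given by $(I_0,S_1)<(I_1,\{\mathrm{id}\})<(I_1,S_2)$ with the four-element diamond $\mu<\lambda,\rho<R$ ($\lambda$ and $\rho$ incomparable); all of them lie strictly below every $R_{I_q,N^\natural}$ with $q\ge2$; for $q,q'\ge 2$ one has $R_{I_q,N^\natural}\subseteq R_{I_{q'},N'^\natural}$ if and only if $q<q'$, or $q=q'$ and $N\le N'$; and $\nabla_{I_r}$ lies strictly above all the others. -/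

import Mathlib

open CategoryTheory

universe u v

/-! ### Partitions between sets

A partition from `A` to `B` is a set partition of the disjoint union of `A` (upper points,
`Sum.inl`) and `B` (lower points, `Sum.inr`), encoded as an equivalence relation. -/

namespace Partn

variable {A B C D : Type u}

/-- `A ⊔ B → A ⊔ B'' ⊔ C`, with the lower points sent to the middle row. -/
def emUp (A B C : Type u) : A ⊕ B → A ⊕ (B ⊕ C) := Sum.map id Sum.inl

/-- `B ⊔ C → A ⊔ B'' ⊔ C`, with the upper points sent to the middle row. -/
def emLow (A B C : Type u) : B ⊕ C → A ⊕ (B ⊕ C) := Sum.inr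

/-- `A ⊔ C → A ⊔ B'' ⊔ C`, the top and bottom rows. -/
def emOut (A B C : Type u) : A ⊕ C → A ⊕ (B ⊕ C) := Sum.map id Sum.inr

/-- The join of `α` and `β` on the three-row set. (`Setoid.map` is the equivalence generated by
the image, that is, the renamed relation together with the diagonal.) -/
def join (α : Setoid (A ⊕ B)) (β : Setoid (B ⊕ C)) : Setoid (A ⊕ (B ⊕ C)) :=
  α.map (emUp A B C) ⊔ β.map (emLow A B C)

/-- The product of partitions: the restriction of the join to the top and bottom rows. -/
def comp (α : Setoid (A ⊕ B)) (β : Setoid (B ⊕ C)) : Setoid (A ⊕ C) :=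
  (join α β).comap (emOut A B C)

/-- The identity partition, with blocks `{a, a'}`. -/
def one (A : Type u) : Setoid (A ⊕ A) := Setoid.ker (Sum.elim id id)

/-- The kernel, an equivalence on the upper points. -/
def ker (α : Setoid (A ⊕ B)) : Setoid A := α.comap Sum.inl

/-- The cokernel, an equivalence on the lower points. -/
def coker (α : Setoid (A ⊕ B)) : Setoid B := α.comap Sum.inr

/-- The rank: the number of transversals, i.e. of blocks that contain both upper and lower
points. -/
noncomputable def rank (α : Setoid (A ⊕ B)) : ℕ :=
  Set.ncard {c : Quotient α |
    (∃ a : A, Quotient.mk α (Sum.inl a) = c) ∧ (∃ b : B, Quotient.mk α (Sum.inr b) = c)}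

/-- The partition `α̂` obtained by splitting each transversal into its upper part and its lower
part. -/
def hat (α : Setoid (A ⊕ B)) : Setoid (A ⊕ B) where
  r x y := α x y ∧ x.isLeft = y.isLeft
  iseqv :=
    ⟨fun x => ⟨α.refl x, rfl⟩, fun h => ⟨α.symm h.1, h.2.symm⟩,
      fun h k => ⟨α.trans h.1 k.1, h.2.trans k.2⟩⟩

theorem map_le_iff {Y Z : Type*} {r : Setoid Y} {f : Y → Z} {s : Setoid Z} :
    r.map f ≤ s ↔ r ≤ s.comap f := by
  constructor
  · intro h x y hxy
    exact h (Relation.EqvGen.rel _ _ ⟨x, y, hxy, rfl, rfl⟩)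
  · intro h
    refine Setoid.eqvGen_le ?_
    rintro _ _ ⟨x, y, hxy, rfl, rfl⟩
    exact h hxy

theorem join_le_iff {α : Setoid (A ⊕ B)} {β : Setoid (B ⊕ C)} {ρ : Setoid (A ⊕ (B ⊕ C))} :
    join α β ≤ ρ ↔ α ≤ ρ.comap (emUp A B C) ∧ β ≤ ρ.comap (emLow A B C) := by
  rw [join, sup_le_iff, map_le_iff, map_le_iff]

theorem le_join_left (α : Setoid (A ⊕ B)) (β : Setoid (B ⊕ C)) :
    α ≤ (join α β).comap (emUp A B C) := (join_le_iff.1 le_rfl).1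

theorem le_join_right (α : Setoid (A ⊕ B)) (β : Setoid (B ⊕ C)) :
    β ≤ (join α β).comap (emLow A B C) := (join_le_iff.1 le_rfl).2

/-- Amalgamation: if `J` restricted to `Z` is contained in `K`, the map `Z → W/K` extends over
`Y` to a map that is constant on the classes of `J`. -/
theorem exists_amalgam {Y Z W : Type u} (J : Setoid Y) (K : Setoid W) (i : Z → Y) (j : Z → W)
    (h : J.comap i ≤ K.comap j) :
    ∃ (T : Type u) (g : Y → Quotient K ⊕ T), J ≤ Setoid.ker g ∧
      ∀ z, g (i z) = Sum.inl (Quotient.mk K (j z)) := by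
  classical
  refine ⟨Quotient J, fun y => if hy : ∃ z, J (i z) y
    then Sum.inl (Quotient.mk K (j hy.choose)) else Sum.inr (Quotient.mk J y), ?_, ?_⟩
  · intro y y' hyy
    rw [Setoid.ker_def]
    by_cases hy : ∃ z, J (i z) y
    · have hy' : ∃ z, J (i z) y' := ⟨hy.choose, J.trans hy.choose_spec hyy⟩
      simp only [dif_pos hy, dif_pos hy']
      congr 1
      apply Quotient.sound
      exact h (J.trans (J.trans hy.choose_spec hyy) (J.symm hy'.choose_spec))
    · have hy' : ¬ ∃ z, J (i z) y' := fun ⟨z, hz⟩ => hy ⟨z, J.trans hz (J.symm hyy)⟩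
      simp only [dif_neg hy, dif_neg hy']
      congr 1
      exact Quotient.sound hyy
  · intro z
    have hy : ∃ z', J (i z') (i z) := ⟨z, J.refl _⟩
    simp only [dif_pos hy]
    congr 1
    apply Quotient.sound
    exact h hy.choose_spec

/-- The join of three composable partitions on the four-row set. -/
def join₃ (α : Setoid (A ⊕ B)) (β : Setoid (B ⊕ C)) (γ : Setoid (C ⊕ D)) :
    Setoid (A ⊕ (B ⊕ (C ⊕ D))) :=
  α.map (Sum.map id Sum.inl) ⊔
    (β.map (Sum.inr ∘ Sum.map id Sum.inl) ⊔ γ.map (Sum.inr ∘ Sum.inr))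

theorem join₃_le_iff {α : Setoid (A ⊕ B)} {β : Setoid (B ⊕ C)} {γ : Setoid (C ⊕ D)}
    {ρ : Setoid (A ⊕ (B ⊕ (C ⊕ D)))} :
    join₃ α β γ ≤ ρ ↔ α ≤ ρ.comap (Sum.map id Sum.inl) ∧
      β ≤ ρ.comap (Sum.inr ∘ Sum.map id Sum.inl) ∧ γ ≤ ρ.comap (Sum.inr ∘ Sum.inr) := by
  rw [join₃, sup_le_iff, sup_le_iff, map_le_iff, map_le_iff, map_le_iff]

theorem comp_comp_left (α : Setoid (A ⊕ B)) (β : Setoid (B ⊕ C)) (γ : Setoid (C ⊕ D)) :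
    comp (comp α β) γ = (join₃ α β γ).comap (Sum.map id (Sum.inr ∘ Sum.inr)) := by
  obtain ⟨h1, h2, h3⟩ := join₃_le_iff.1 (le_refl (join₃ α β γ))
  apply le_antisymm
  · have key : join (comp α β) γ ≤ (join₃ α β γ).comap (Sum.map id Sum.inr) := by
      have h0 : join α β ≤
          (join₃ α β γ).comap (Sum.map id (Sum.map id Sum.inl)) := by
        refine join_le_iff.2 ⟨?_, ?_⟩
        · intro x y hxy
          have := h1 hxy
          rcases x with x | x <;> rcases y with y | y <;> exact this
        · intro x y hxy
          have := h2 hxy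
          rcases x with x | x <;> rcases y with y | y <;> exact this
      refine join_le_iff.2 ⟨?_, ?_⟩
      · intro x y hxy
        have := h0 hxy
        rcases x with x | x <;> rcases y with y | y <;> exact this
      · intro x y hxy
        exact h3 hxy
    intro x y hxy
    have := key hxy
    rcases x with x | x <;> rcases y with y | y <;> exact this
  · obtain ⟨T, g, hg, hgz⟩ := exists_amalgam (join α β) (join (comp α β) γ)
      (emOut A B C) (emUp A C D) (le_join_left (comp α β) γ)
    let G : A ⊕ (B ⊕ (C ⊕ D)) → Quotient (join (comp α β) γ) ⊕ T :=
      Sum.elim (fun a => Sum.inl (Quotient.mk _ (Sum.inl a)))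
        (Sum.elim (fun b => g (Sum.inr (Sum.inl b)))
          (Sum.elim (fun c => Sum.inl (Quotient.mk _ (Sum.inr (Sum.inl c))))
            (fun d => Sum.inl (Quotient.mk _ (Sum.inr (Sum.inr d))))))
    have gA : ∀ a, G (Sum.inl a) = g (Sum.inl a) := fun a => (hgz (Sum.inl a)).symm
    have gC : ∀ c, G (Sum.inr (Sum.inr (Sum.inl c))) = g (Sum.inr (Sum.inr c)) :=
      fun c => (hgz (Sum.inr c)).symm
    have key : join₃ α β γ ≤ Setoid.ker G := by
      refine join₃_le_iff.2 ⟨?_, ?_, ?_⟩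
      · intro x y hxy
        have := hg (le_join_left α β hxy)
        rw [Setoid.ker_def] at this
        rw [Setoid.comap_rel, Setoid.ker_def]
        rcases x with x | x <;> rcases y with y | y
        · exact (gA x).trans (this.trans (gA y).symm)
        · exact (gA x).trans this
        · exact this.trans (gA y).symm
        · exact this
      · intro x y hxy
        have := hg (le_join_right α β hxy)
        rw [Setoid.ker_def] at this
        rw [Setoid.comap_rel, Setoid.ker_def]
        rcases x with x | x <;> rcases y with y | y
        · exact this
        · exact this.trans (gC y).symm
        · exact (gC x).trans this
        · exact (gC x).trans (this.trans (gC y).symm)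
      · intro x y hxy
        have := le_join_right (comp α β) γ hxy
        rw [Setoid.comap_rel, Setoid.ker_def]
        rcases x with x | x <;> rcases y with y | y <;>
          exact congrArg Sum.inl (Quotient.sound this)
    have hout : ∀ z : A ⊕ D, G (Sum.map id (Sum.inr ∘ Sum.inr) z) =
        Sum.inl (Quotient.mk (join (comp α β) γ) (emOut A C D z)) := by
      rintro (z | z) <;> rfl
    intro x y hxy
    have := key hxy
    rw [Setoid.ker_def, hout, hout] at this
    change join (comp α β) γ (emOut A C D x) (emOut A C D y)
    exact Quotient.exact (Sum.inl.inj this)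

theorem comp_comp_right (α : Setoid (A ⊕ B)) (β : Setoid (B ⊕ C)) (γ : Setoid (C ⊕ D)) :
    comp α (comp β γ) = (join₃ α β γ).comap (Sum.map id (Sum.inr ∘ Sum.inr)) := by
  obtain ⟨h1, h2, h3⟩ := join₃_le_iff.1 (le_refl (join₃ α β γ))
  apply le_antisymm
  · have key : join α (comp β γ) ≤
        (join₃ α β γ).comap (Sum.map id (Sum.map id Sum.inr)) := by
      have h0 : join β γ ≤ (join₃ α β γ).comap Sum.inr := by
        refine join_le_iff.2 ⟨?_, ?_⟩
        · intro x y hxy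
          exact h2 hxy
        · intro x y hxy
          exact h3 hxy
      refine join_le_iff.2 ⟨?_, ?_⟩
      · intro x y hxy
        have := h1 hxy
        rcases x with x | x <;> rcases y with y | y <;> exact this
      · intro x y hxy
        have := h0 hxy
        rcases x with x | x <;> rcases y with y | y <;> exact this
    intro x y hxy
    have := key hxy
    rcases x with x | x <;> rcases y with y | y <;> exact this
  · obtain ⟨T, g, hg, hgz⟩ := exists_amalgam (join β γ) (join α (comp β γ))
      (emOut B C D) (emLow A B D) (le_join_right α (comp β γ))
    let G : A ⊕ (B ⊕ (C ⊕ D)) → Quotient (join α (comp β γ)) ⊕ T :=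
      Sum.elim (fun a => Sum.inl (Quotient.mk _ (Sum.inl a))) g
    have gB : ∀ b, G (Sum.inr (Sum.inl b)) = Sum.inl (Quotient.mk _ (Sum.inr (Sum.inl b))) :=
      fun b => hgz (Sum.inl b)
    have gD : ∀ d, G (Sum.inr (Sum.inr (Sum.inr d))) =
        Sum.inl (Quotient.mk _ (Sum.inr (Sum.inr d))) :=
      fun d => hgz (Sum.inr d)
    have key : join₃ α β γ ≤ Setoid.ker G := by
      refine join₃_le_iff.2 ⟨?_, ?_, ?_⟩
      · intro x y hxy
        have : (Sum.inl (Quotient.mk (join α (comp β γ)) (emUp A B D x)) : _ ⊕ T) =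
            Sum.inl (Quotient.mk (join α (comp β γ)) (emUp A B D y)) :=
          congrArg Sum.inl (Quotient.sound (le_join_left α (comp β γ) hxy))
        rw [Setoid.comap_rel, Setoid.ker_def]
        rcases x with x | x <;> rcases y with y | y
        · exact this
        · exact this.trans (gB y).symm
        · exact (gB x).trans this
        · exact (gB x).trans (this.trans (gB y).symm)
      · intro x y hxy
        exact hg (le_join_left β γ hxy)
      · intro x y hxy
        exact hg (le_join_right β γ hxy)
    have hout : ∀ z : A ⊕ D, G (Sum.map id (Sum.inr ∘ Sum.inr) z) =
        Sum.inl (Quotient.mk (join α (comp β γ)) (emOut A B D z)) := by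
      rintro (z | z)
      · rfl
      · exact gD z
    intro x y hxy
    have := key hxy
    rw [Setoid.ker_def, hout, hout] at this
    change join α (comp β γ) (emOut A B D x) (emOut A B D y)
    exact Quotient.exact (Sum.inl.inj this)

theorem comp_assoc (α : Setoid (A ⊕ B)) (β : Setoid (B ⊕ C)) (γ : Setoid (C ⊕ D)) :
    comp (comp α β) γ = comp α (comp β γ) := by
  rw [comp_comp_left, comp_comp_right]

theorem one_comp (α : Setoid (A ⊕ B)) : comp (one A) α = α := by
  apply le_antisymm
  · let F : A ⊕ (A ⊕ B) → A ⊕ B := Sum.elim Sum.inl id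
    have key : join (one A) α ≤ α.comap F := by
      refine join_le_iff.2 ⟨?_, ?_⟩
      · intro x y hxy
        have hxy : Sum.elim id id x = Sum.elim id id y := hxy
        have : F (emUp A A B x) = F (emUp A A B y) := by
          rcases x with x | x <;> rcases y with y | y <;> exact congrArg Sum.inl hxy
        rw [Setoid.comap_rel, Setoid.comap_rel, this]
      · intro x y hxy
        exact hxy
    intro x y hxy
    have := key hxy
    rcases x with x | x <;> rcases y with y | y <;> exact this
  · have key : ∀ x : A ⊕ B, join (one A) α (emOut A A B x) (emLow A A B x) := by
      rintro (x | x)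
      · exact le_join_left (one A) α (x := Sum.inl x) (y := Sum.inr x) rfl
      · exact Setoid.refl' _ _
    intro x y hxy
    exact (join (one A) α).trans (key x)
      ((join (one A) α).trans (le_join_right (one A) α hxy) ((join (one A) α).symm (key y)))

theorem comp_one (α : Setoid (A ⊕ B)) : comp α (one B) = α := by
  apply le_antisymm
  · let F : A ⊕ (B ⊕ B) → A ⊕ B := Sum.elim Sum.inl (Sum.elim Sum.inr Sum.inr)
    have key : join α (one B) ≤ α.comap F := by
      refine join_le_iff.2 ⟨?_, ?_⟩
      · intro x y hxy
        rcases x with x | x <;> rcases y with y | y <;> exact hxy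
      · intro x y hxy
        have hxy : Sum.elim id id x = Sum.elim id id y := hxy
        have : F (emLow A B B x) = F (emLow A B B y) := by
          rcases x with x | x <;> rcases y with y | y <;> exact congrArg Sum.inr hxy
        rw [Setoid.comap_rel, Setoid.comap_rel, this]
    intro x y hxy
    have := key hxy
    rcases x with x | x <;> rcases y with y | y <;> exact this
  · have key : ∀ x : A ⊕ B, join α (one B) (emOut A B B x) (emUp A B B x) := by
      rintro (x | x)
      · exact Setoid.refl' _ _
      · exact le_join_right α (one B) (x := Sum.inr x) (y := Sum.inl x) rfl
    intro x y hxy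
    exact (join α (one B)).trans (key x)
      ((join α (one B)).trans (le_join_left α (one B) hxy) ((join α (one B)).symm (key y)))

end Partn

/-! ### The partition category -/

/-- The objects of the partition category over a set `C` of finite sets. -/
def PartCat {X : Type u} (C : Set (Finset X)) : Type u := {A : Finset X // A ∈ C}

/-- The points of an object. -/
abbrev PartCat.Pt {X : Type u} {C : Set (Finset X)} (A : PartCat C) : Type u :=
  {x : X // x ∈ A.1}

/-- The partition category: the morphisms from `A` to `B` are the partitions from `A` to `B`,
composed from left to right by the product of partitions. -/
instance PartCat.category {X : Type u} (C : Set (Finset X)) : Category.{u} (PartCat C) where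
  Hom A B := Setoid (A.Pt ⊕ B.Pt)
  id A := Partn.one A.Pt
  comp α β := Partn.comp α β
  id_comp := Partn.one_comp
  comp_id := Partn.comp_one
  assoc := Partn.comp_assoc

/-! ### Partial semigroups of morphisms, their ideals, congruences and Green's relations

Throughout, `S : MorphismProperty K` is a set of morphisms of a small category `K`, thought of
as a partial semigroup with the same objects. A relation on `S` that only relates elements in a
common hom-set is a `HomRel`. -/

/-- Relations on hom-sets, ordered by inclusion. -/
instance HomRel.completeLattice (K : Type u) [Quiver.{v} K] : CompleteLattice (HomRel K) :=
  inferInstanceAs (CompleteLattice (∀ ⦃A B : K⦄, (A ⟶ B) → (A ⟶ B) → Prop))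

namespace PSem

variable {K : Type u} [Category.{v} K]

/-- `S¹`: the set `S` with all identities adjoined. -/
inductive Adj (S : MorphismProperty K) : MorphismProperty K
  | of {A B : K} (a : A ⟶ B) : S a → Adj S a
  | one (A : K) : Adj S (𝟙 A)

/-- `I` is an ideal of `S`. -/
structure IsIdeal (S I : MorphismProperty K) : Prop where
  sub : ∀ {A B : K} (x : A ⟶ B), I x → S x
  nonempty : ∃ (A B : K) (x : A ⟶ B), I x
  mul_right : ∀ {A B C : K} (x : A ⟶ B) (a : B ⟶ C), I x → S a → I (x ≫ a)
  mul_left : ∀ {A B C : K} (a : A ⟶ B) (x : B ⟶ C), S a → I x → I (a ≫ x)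

/-- `σ` is a congruence on `S`. -/
structure IsCongruence (S : MorphismProperty K) (σ : HomRel K) : Prop where
  mem : ∀ {A B : K} {x y : A ⟶ B}, σ x y → S x ∧ S y
  refl : ∀ {A B : K} {x : A ⟶ B}, S x → σ x x
  symm : ∀ {A B : K} {x y : A ⟶ B}, σ x y → σ y x
  trans : ∀ {A B : K} {x y z : A ⟶ B}, σ x y → σ y z → σ x z
  mul_left : ∀ {A B C : K} (a : A ⟶ B) {x y : B ⟶ C}, S a → σ x y → σ (a ≫ x) (a ≫ y)
  mul_right : ∀ {A B C : K} {x y : A ⟶ B} (a : B ⟶ C), S a → σ x y → σ (x ≫ a) (y ≫ a)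

/-- The set of all congruences on `S`, ordered by inclusion. -/
def Cong (S : MorphismProperty K) : Set (HomRel K) := {σ | IsCongruence S σ}

/-- The diagonal relation on `S`. -/
def diag (S : MorphismProperty K) : HomRel K := fun _ _ x y => S x ∧ x = y

/-- The universal congruence on `S`: all pairs of elements of `S` in a common hom-set. -/
def univ (S : MorphismProperty K) : HomRel K := fun _ _ x y => S x ∧ S y

/-- Green's `𝓡` relation of `S`, restricted to pairs in a common hom-set: `x S¹ = y S¹`. -/
def greenR (S : MorphismProperty K) : HomRel K := fun _ B x y =>
  S x ∧ S y ∧ (∃ a : B ⟶ B, Adj S a ∧ x = y ≫ a) ∧ (∃ b : B ⟶ B, Adj S b ∧ y = x ≫ b)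

/-- Green's `𝓛` relation of `S`, restricted to pairs in a common hom-set: `S¹ x = S¹ y`. -/
def greenL (S : MorphismProperty K) : HomRel K := fun A _ x y =>
  S x ∧ S y ∧ (∃ a : A ⟶ A, Adj S a ∧ x = a ≫ y) ∧ (∃ b : A ⟶ A, Adj S b ∧ y = b ≫ x)

/-- Green's `𝓗` relation of `S`, restricted to pairs in a common hom-set. -/
def greenH (S : MorphismProperty K) : HomRel K := greenR S ⊓ greenL S

/-- `f` restricts to a retraction of the ideal `I` onto the ideal `M`. (The values of `f` outside
`I` play no role.) -/
structure IsRetraction (I M : MorphismProperty K)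
    (f : ∀ ⦃A B : K⦄, (A ⟶ B) → (A ⟶ B)) : Prop where
  mem : ∀ {A B : K} (x : A ⟶ B), I x → M (f x)
  map_mul : ∀ {A B C : K} (x : A ⟶ B) (y : B ⟶ C), I x → I y → f (x ≫ y) = f x ≫ f y
  fix : ∀ {A B : K} (x : A ⟶ B), M x → f x = x

/-- The Rees congruence `R_I` on `S`. -/
def rees (S I : MorphismProperty K) : HomRel K := univ I ⊔ diag S

/-- The relation `θ_{I,τ}` on `S`, where `f` is the retraction defined on `I`:
`{(x, y) ∈ I × I : (x f, y f) ∈ τ} ∪ Δ_S`. -/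
def theta (S I : MorphismProperty K) (f : ∀ ⦃A B : K⦄, (A ⟶ B) → (A ⟶ B)) (τ : HomRel K) :
    HomRel K :=
  (fun _ _ x y => I x ∧ I y ∧ τ (f x) (f y)) ⊔ diag S

/-- The relation `ν_N = S¹ (N × N) S¹ ∩ (D × D)`, for a set `N` of endomorphisms of `P`. -/
def nu (S D : MorphismProperty K) {P : K} (N : Set (P ⟶ P)) : HomRel K := fun A B u v =>
  D u ∧ D v ∧ ∃ (a : A ⟶ P) (b : P ⟶ B) (x y : P ⟶ P),
    Adj S a ∧ Adj S b ∧ x ∈ N ∧ y ∈ N ∧ u = a ≫ x ≫ b ∧ v = a ≫ y ≫ b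

/-- `S` is isomorphic, via `x ↦ (p x, q x)`, to the partial rectangular band whose hom-sets are
the products `P A × Q B`, with multiplication `(x₁, y₁) (x₂, y₂) = (x₁, y₂)`. -/
structure IsRectBand (S : MorphismProperty K) {P Q : K → Type v}
    (p : ∀ ⦃A B : K⦄, (A ⟶ B) → P A) (q : ∀ ⦃A B : K⦄, (A ⟶ B) → Q B) : Prop where
  nonempty : ∀ A : K, Nonempty (P A) ∧ Nonempty (Q A)
  mul_mem : ∀ {A B C : K} (x : A ⟶ B) (y : B ⟶ C), S x → S y → S (x ≫ y)
  bij : ∀ A B : K, Set.BijOn (fun x : A ⟶ B => (p x, q x)) {x | S x} Set.univ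
  map_mul : ∀ {A B C : K} (x : A ⟶ B) (y : B ⟶ C), S x → S y →
    p (x ≫ y) = p x ∧ q (x ≫ y) = q y

/-- The relation `σ_{E₁,E₂}` on a partial rectangular band `S` (with coordinates `p`, `q`)
determined by families `E₁`, `E₂` of equivalences on the coordinate sets. -/
def rectRel (S : MorphismProperty K) {P Q : K → Type v}
    (p : ∀ ⦃A B : K⦄, (A ⟶ B) → P A) (q : ∀ ⦃A B : K⦄, (A ⟶ B) → Q B)
    (E : (∀ A : K, Setoid (P A)) × (∀ A : K, Setoid (Q A))) : HomRel K := fun A B x y =>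
  S x ∧ S y ∧ E.1 A (p x) (p y) ∧ E.2 B (q x) (q y)

end PSem

/-! ### Ideals and congruences of the partition category -/

namespace PartCat

open PSem

variable {X : Type u} {C : Set (Finset X)}

/-- The kernel of a morphism. -/
def ker ⦃A B : PartCat C⦄ (α : A ⟶ B) : Setoid A.Pt := Partn.ker α

/-- The cokernel of a morphism. -/
def coker ⦃A B : PartCat C⦄ (α : A ⟶ B) : Setoid B.Pt := Partn.coker α

/-- The rank of a morphism. -/
noncomputable def rank {A B : PartCat C} (α : A ⟶ B) : ℕ := Partn.rank α

/-- The morphism `α̂`. -/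
def hat ⦃A B : PartCat C⦄ (α : A ⟶ B) : A ⟶ B := Partn.hat α

/-- The least strict upper bound of the sizes of the members of `C`; the value `⊤` stands
for `ω`. -/
noncomputable def xi (C : Set (Finset X)) : ℕ∞ :=
  sInf {m : ℕ∞ | ∀ A ∈ C, (A.card : ℕ∞) < m}

/-- The admissible indices of ideals: all `r < ξ`, and also `r = ω` if `ξ = ω`. -/
def IsIndex (C : Set (Finset X)) (r : ℕ∞) : Prop := r < xi C ∨ (r = ⊤ ∧ xi C = ⊤)

/-- The set `D_q` of all partitions of rank `q`. -/
def D (C : Set (Finset X)) (q : ℕ) : MorphismProperty (PartCat C) := fun _ _ α => rank α = q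

/-- The set `I_r` of all partitions of rank at most `r`; in particular `I_⊤` is the whole
category. -/
def I (C : Set (Finset X)) (r : ℕ∞) : MorphismProperty (PartCat C) :=
  fun _ _ α => (rank α : ℕ∞) ≤ r

theorem IsIndex.succ_lt {r : ℕ∞} (hr : IsIndex C r) {q : ℕ} (hq : (q : ℕ∞) < r) :
    ((q + 1 : ℕ) : ℕ∞) < xi C := by
  rcases hr with h | ⟨_, h⟩
  · refine lt_of_le_of_lt ?_ h
    push_cast
    exact Order.add_one_le_of_lt hq
  · rw [h]
    exact ENat.natCast_lt_top _

/-- An object of `C` with `q` chosen distinct points. -/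
structure Frame (C : Set (Finset X)) (q : ℕ) where
  /-- the object `X_q` -/
  obj : PartCat C
  /-- the chosen points `1, …, q` -/
  pt : Fin q → obj.Pt
  inj : Function.Injective pt

/-- The partition `π^♮` of `X_q`, with transversals `{i, (i π)'}` for `i = 1, …, q`, and all other
blocks singletons. -/
def Frame.nat {q : ℕ} (F : Frame C q) (π : Equiv.Perm (Fin q)) : F.obj ⟶ F.obj :=
  show Setoid (F.obj.Pt ⊕ F.obj.Pt) from
  { r := fun x y => x = y ∨ ∃ i, (x = Sum.inl (F.pt i) ∧ y = Sum.inr (F.pt (π i))) ∨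
      (x = Sum.inr (F.pt (π i)) ∧ y = Sum.inl (F.pt i))
    iseqv := by
      refine ⟨fun x => Or.inl rfl, ?_, ?_⟩
      · rintro x y (rfl | ⟨i, h | h⟩)
        · exact Or.inl rfl
        · exact Or.inr ⟨i, Or.inr ⟨h.2, h.1⟩⟩
        · exact Or.inr ⟨i, Or.inl ⟨h.2, h.1⟩⟩
      · rintro x y z (rfl | ⟨i, ⟨rfl, rfl⟩ | ⟨rfl, rfl⟩⟩) h
        · exact h
        · rcases h with rfl | ⟨j, ⟨h, _⟩ | ⟨h, rfl⟩⟩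
          · exact Or.inr ⟨i, Or.inl ⟨rfl, rfl⟩⟩
          · exact absurd h Sum.inr_ne_inl
          · left
            rw [π.injective (F.inj (Sum.inr_injective h))]
        · rcases h with rfl | ⟨j, ⟨h, rfl⟩ | ⟨h, _⟩⟩
          · exact Or.inr ⟨i, Or.inr ⟨rfl, rfl⟩⟩
          · left
            rw [F.inj (Sum.inl_injective h)]
          · exact absurd h Sum.inl_ne_inr }

/-- The relation `ν_{N^♮}`, computed in `I_r`. -/
def nuP (r : ℕ∞) {q : ℕ} (F : Frame C q) (N : Subgroup (Equiv.Perm (Fin q))) :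
    HomRel (PartCat C) :=
  nu (I C r) (D C q) (F.nat '' {π | π ∈ N})

/-- The relation `R_{I_q,N^♮}` on `I_r`, for `N ⊴ S_{q+1}`. -/
def reesP (r : ℕ∞) {q : ℕ} (F : Frame C (q + 1)) (N : Subgroup (Equiv.Perm (Fin (q + 1)))) :
    HomRel (PartCat C) :=
  rees (I C r) (I C q) ⊔ nuP r F N

/-- The relation `θ_{I_q,N^♮,τ}` on `I_r`, for `q ≤ 1`, `N ⊴ S_{q+1}` and a relation `τ` on `I_0`.
The retraction `I_q → I_0` is `α ↦ α̂`; it is the identity map if `q = 0`. -/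
def thetaP (r : ℕ∞) {q : ℕ} (F : Frame C (q + 1)) (N : Subgroup (Equiv.Perm (Fin (q + 1))))
    (τ : HomRel (PartCat C)) : HomRel (PartCat C) :=
  theta (I C r) (I C q) hat τ ⊔ nuP r F N

/-- The relation `λ_{I_q,N^♮}` on `I_r`. -/
def lamP (r : ℕ∞) {q : ℕ} (F : Frame C (q + 1)) (N : Subgroup (Equiv.Perm (Fin (q + 1)))) :
    HomRel (PartCat C) :=
  thetaP r F N (greenL (I C 0))

/-- The relation `ρ_{I_q,N^♮}` on `I_r`. -/
def rhoP (r : ℕ∞) {q : ℕ} (F : Frame C (q + 1)) (N : Subgroup (Equiv.Perm (Fin (q + 1)))) :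
    HomRel (PartCat C) :=
  thetaP r F N (greenR (I C 0))

/-- The relation `μ_{I_q,N^♮}` on `I_r`. -/
def muP (r : ℕ∞) {q : ℕ} (F : Frame C (q + 1)) (N : Subgroup (Equiv.Perm (Fin (q + 1)))) :
    HomRel (PartCat C) :=
  thetaP r F N (greenH (I C 0))

/-- The diamond formed by `μ_{I_q,N^♮}` (bottom), `λ_{I_q,N^♮}`, `ρ_{I_q,N^♮}` and `R_{I_q,N^♮}`
(top), indexed by the four-element lattice `Bool × Bool`. -/
def diamond (r : ℕ∞) {q : ℕ} (F : Frame C (q + 1)) (N : Subgroup (Equiv.Perm (Fin (q + 1)))) :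
    Bool × Bool → HomRel (PartCat C)
  | (false, false) => muP r F N
  | (true, false) => lamP r F N
  | (false, true) => rhoP r F N
  | (true, true) => reesP r F N

/-- The lattice of normal subgroups of the symmetric group of degree `n`. -/
abbrev NormalSub (n : ℕ) : Type := {N : Subgroup (Equiv.Perm (Fin n)) // N.Normal}

/-- The lattice of congruences in the picture: at the bottom the product of a three-element chain
and a diamond; above it, one above the other for `2 ≤ q < r`, the lattices of normal subgroups of
`S_{q+1}`; and a top element. -/
abbrev Fig (r : ℕ∞) : Type :=
  WithTop ((Fin 3 × (Bool × Bool)) ⊕ₗ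
    (Σₗ q : {q : ℕ // 2 ≤ q ∧ (q : ℕ∞) < r}, NormalSub (q.1 + 1)))

/-- An element of the bottom part of `Fig r`. -/
def Fig.low {r : ℕ∞} (i : Fin 3) (t : Bool × Bool) : Fig r :=
  WithTop.some (toLex (Sum.inl (i, t)))

/-- An element of the upper part of `Fig r`. -/
def Fig.up {r : ℕ∞} (q : ℕ) (h : 2 ≤ q ∧ (q : ℕ∞) < r) (N : NormalSub (q + 1)) : Fig r :=
  WithTop.some (toLex (Sum.inr (toLex (Sigma.mk ⟨q, h⟩ N))))

end PartCat

/-!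
A partition `α` is determined by its kernel, its cokernel, and the bijection between classes of the
two that its transversals define. The product `α β` is governed by the equivalence
`mid α β = coker α ⊔ ker β` on the middle row (`comp_inl_inr`, `comp_inl_inl`, `comp_inr_inr`):
transversals of `α` are merged, and joined to transversals of `β`, exactly if `mid α β` relates
their points in the middle row. All computations with multipliers rest on this, in the normal form
`glue K L u v` for a partition with kernel `K` and cokernel `L` whose transversals have
representatives `u i`, `v i`.

Let `σ` be a congruence on `I_r`. A positive rank `k` is *collapsed* if `σ` relates a morphism of
rank `k` to one of smaller rank. Then every morphism of rank `k` is related to one of smaller rank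
(`Collapsed.exists_rank_lt`), all positive ranks below `k` are collapsed (`Collapsed.of_le`), and
for `k ≥ 2` all of `I_k` is one class in each hom-set (`Collapsed.related`). If `k` is not
collapsed, then `σ`-related morphisms of rank `k` are `𝓗`-related (`hRel_of_not_collapsed`):
otherwise some multiplier of rank at most `k` would lower the rank of one of them only
(`HRel.of_mul_rank`). If they are also distinct, hence differ by a nontrivial permutation of the
transversals, then rank `k - 1` is collapsed unless it is zero (`collapsed_of_hRel`), since
deleting a transversal that is moved by the permutation lowers the rank of one of them further.

So let `q + 1` be the least positive rank that is not collapsed, if there is any. Above rank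
`q + 1`, the congruence is trivial; on rank `q + 1` it is given by the normal subgroup of the
permutations that it identifies with the identity (`Twist`, `permSubgroup`); and below, it is
universal if `q ≥ 2`, and otherwise it is determined by its restriction to `I_0`, because
`α ↦ hat α` moves every morphism inside its class. On the rectangular band `I_0`, a congruence is a
pair of families of equivalences. If `r ≥ 2`, multipliers of rank two act on kernels so richly that
for each of kernel and cokernel only "equal" and "arbitrary" remain (`related_of_coker_eq`,
`related_of_ker_eq`); this gives the four-element diamond. For `r = 1` such multipliers are
missing, and every congruence on `I_0` extends to `I_1`.
-/

namespace Partn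

variable {A B C D : Type u} {ι κ : Type*}

/-! ### Products, computed -/

theorem eq_of_parts {α β : Setoid (A ⊕ B)} (hk : ker α = ker β) (hc : coker α = coker β)
    (ht : ∀ a b, α (Sum.inl a) (Sum.inr b) ↔ β (Sum.inl a) (Sum.inr b)) : α = β := by
  ext x y
  rcases x with x | x <;> rcases y with y | y
  · exact Setoid.ext_iff.1 hk x y
  · exact ht x y
  · exact ⟨fun h => β.symm ((ht y x).1 (α.symm h)), fun h => α.symm ((ht y x).2 (β.symm h))⟩
  · exact Setoid.ext_iff.1 hc x y

/-- The equivalence that `α` and `β` generate on the middle row of their product. -/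
def mid (α : Setoid (A ⊕ B)) (β : Setoid (B ⊕ C)) : Setoid B := coker α ⊔ ker β

theorem coker_le_mid {α : Setoid (A ⊕ B)} {β : Setoid (B ⊕ C)} {b b' : B}
    (h : α (Sum.inr b) (Sum.inr b')) : mid α β b b' :=
  (le_sup_left : coker α ≤ mid α β) h

theorem ker_le_mid {α : Setoid (A ⊕ B)} {β : Setoid (B ⊕ C)} {b b' : B}
    (h : β (Sum.inl b) (Sum.inl b')) : mid α β b b' :=
  (le_sup_right : ker β ≤ mid α β) h

theorem mid_le_join (α : Setoid (A ⊕ B)) (β : Setoid (B ⊕ C)) {b b' : B} (h : mid α β b b') :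
    join α β (Sum.inr (Sum.inl b)) (Sum.inr (Sum.inl b')) := by
  have key : mid α β ≤ (join α β).comap (fun b => Sum.inr (Sum.inl b)) :=
    sup_le (fun x y h => le_join_left α β (x := Sum.inr x) (y := Sum.inr y) h)
      (fun x y h => le_join_right α β (x := Sum.inl x) (y := Sum.inl y) h)
  exact key h

section Color
open Classical in
/-- A map on the three-row set whose kernel is the join: a point that is connected to the middle
row goes to a class of `mid α β`, and any other point to its block. -/
noncomputable def color (α : Setoid (A ⊕ B)) (β : Setoid (B ⊕ C)) :
    A ⊕ (B ⊕ C) → Quotient (mid α β) ⊕ (Quotient (ker α) ⊕ Quotient (coker β)) :=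
  Sum.elim
    (fun a => if h : ∃ b, α (Sum.inl a) (Sum.inr b) then Sum.inl (Quotient.mk _ h.choose)
      else Sum.inr (Sum.inl (Quotient.mk _ a)))
    (Sum.elim (fun b => Sum.inl (Quotient.mk _ b))
      (fun c => if h : ∃ b, β (Sum.inl b) (Sum.inr c) then Sum.inl (Quotient.mk _ h.choose)
        else Sum.inr (Sum.inr (Quotient.mk _ c))))

variable {α : Setoid (A ⊕ B)} {β : Setoid (B ⊕ C)}

theorem color_inl {a : A} {b : B} (h : α (Sum.inl a) (Sum.inr b)) :
    color α β (Sum.inl a) = Sum.inl (Quotient.mk _ b) := by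
  have hh : ∃ b, α (Sum.inl a) (Sum.inr b) := ⟨b, h⟩
  simp only [color, Sum.elim_inl, dif_pos hh]
  exact congrArg Sum.inl (Quotient.sound (coker_le_mid (α.trans (α.symm hh.choose_spec) h)))

theorem color_inl_neg {a : A} (h : ¬ ∃ b, α (Sum.inl a) (Sum.inr b)) :
    color α β (Sum.inl a) = Sum.inr (Sum.inl (Quotient.mk _ a)) := by
  simp only [color, Sum.elim_inl, dif_neg h]

theorem color_inr {c : C} {b : B} (h : β (Sum.inl b) (Sum.inr c)) :
    color α β (Sum.inr (Sum.inr c)) = Sum.inl (Quotient.mk _ b) := by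
  have hh : ∃ b, β (Sum.inl b) (Sum.inr c) := ⟨b, h⟩
  simp only [color, Sum.elim_inr, dif_pos hh]
  exact congrArg Sum.inl (Quotient.sound (ker_le_mid (β.trans hh.choose_spec (β.symm h))))

theorem color_inr_neg {c : C} (h : ¬ ∃ b, β (Sum.inl b) (Sum.inr c)) :
    color α β (Sum.inr (Sum.inr c)) = Sum.inr (Sum.inr (Quotient.mk _ c)) := by
  simp only [color, Sum.elim_inr, dif_neg h]

theorem join_le_ker_color (α : Setoid (A ⊕ B)) (β : Setoid (B ⊕ C)) :
    join α β ≤ Setoid.ker (color α β) := by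
  refine join_le_iff.2 ⟨?_, ?_⟩
  · intro x y h
    change color α β _ = color α β _
    rcases x with x | x <;> rcases y with y | y
    · by_cases hx : ∃ b, α (Sum.inl x) (Sum.inr b)
      · obtain ⟨b, hb⟩ := hx
        exact (color_inl hb).trans (color_inl (α.trans (α.symm h) hb)).symm
      · have hy : ¬ ∃ b, α (Sum.inl y) (Sum.inr b) := fun ⟨b, hb⟩ => hx ⟨b, α.trans h hb⟩
        refine (color_inl_neg hx).trans (Eq.trans ?_ (color_inl_neg hy).symm)
        exact congrArg (Sum.inr ∘ Sum.inl) (Quotient.sound h)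
    · exact color_inl h
    · exact (color_inl (α.symm h)).symm
    · exact congrArg Sum.inl (Quotient.sound (coker_le_mid h))
  · intro x y h
    change color α β _ = color α β _
    rcases x with x | x <;> rcases y with y | y
    · exact congrArg Sum.inl (Quotient.sound (ker_le_mid h))
    · exact (color_inr h).symm
    · exact color_inr (β.symm h)
    · by_cases hx : ∃ b, β (Sum.inl b) (Sum.inr x)
      · obtain ⟨b, hb⟩ := hx
        exact (color_inr hb).trans (color_inr (β.trans hb h)).symm
      · have hy : ¬ ∃ b, β (Sum.inl b) (Sum.inr y) :=
          fun ⟨b, hb⟩ => hx ⟨b, β.trans hb (β.symm h)⟩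
        refine (color_inr_neg hx).trans (Eq.trans ?_ (color_inr_neg hy).symm)
        exact congrArg (Sum.inr ∘ Sum.inr) (Quotient.sound h)

end Color

theorem comp_inl_inr {α : Setoid (A ⊕ B)} {β : Setoid (B ⊕ C)} {a : A} {c : C} :
    comp α β (Sum.inl a) (Sum.inr c) ↔ ∃ b b', α (Sum.inl a) (Sum.inr b) ∧ mid α β b b' ∧
      β (Sum.inl b') (Sum.inr c) := by
  constructor
  · intro h
    have h : color α β (Sum.inl a) = color α β (Sum.inr (Sum.inr c)) := join_le_ker_color α β h
    by_cases ha : ∃ b, α (Sum.inl a) (Sum.inr b)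
    · by_cases hc : ∃ b, β (Sum.inl b) (Sum.inr c)
      · obtain ⟨b, hb⟩ := ha
        obtain ⟨b', hb'⟩ := hc
        rw [color_inl hb, color_inr hb'] at h
        exact ⟨b, b', hb, Quotient.exact (Sum.inl.inj h), hb'⟩
      · rw [color_inl ha.choose_spec, color_inr_neg hc] at h
        cases h
    · by_cases hc : ∃ b, β (Sum.inl b) (Sum.inr c)
      · rw [color_inl_neg ha, color_inr hc.choose_spec] at h
        cases h
      · rw [color_inl_neg ha, color_inr_neg hc] at h
        cases Sum.inr.inj h
  · rintro ⟨b, b', h1, h2, h3⟩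
    have h1 := le_join_left α β h1
    have h2 := mid_le_join α β h2
    have h3 := le_join_right α β h3
    exact (join α β).trans (h1 : join α β (Sum.inl a) (Sum.inr (Sum.inl b)))
      ((join α β).trans h2 h3)

theorem comp_inl_inl {α : Setoid (A ⊕ B)} {β : Setoid (B ⊕ C)} {a a' : A} :
    comp α β (Sum.inl a) (Sum.inl a') ↔ α (Sum.inl a) (Sum.inl a') ∨
      ∃ b b', α (Sum.inl a) (Sum.inr b) ∧ mid α β b b' ∧ α (Sum.inl a') (Sum.inr b') := by
  constructor
  · intro h
    have h : color α β (Sum.inl a) = color α β (Sum.inl a') := join_le_ker_color α β h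
    by_cases ha : ∃ b, α (Sum.inl a) (Sum.inr b)
    · by_cases hc : ∃ b, α (Sum.inl a') (Sum.inr b)
      · obtain ⟨b, hb⟩ := ha
        obtain ⟨b', hb'⟩ := hc
        rw [color_inl hb, color_inl hb'] at h
        exact Or.inr ⟨b, b', hb, Quotient.exact (Sum.inl.inj h), hb'⟩
      · rw [color_inl ha.choose_spec, color_inl_neg hc] at h
        cases h
    · by_cases hc : ∃ b, α (Sum.inl a') (Sum.inr b)
      · rw [color_inl_neg ha, color_inl hc.choose_spec] at h
        cases h
      · rw [color_inl_neg ha, color_inl_neg hc] at h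
        exact Or.inl (Quotient.exact (Sum.inl.inj (Sum.inr.inj h)) : ker α a a')
  · rintro (h | ⟨b, b', h1, h2, h3⟩)
    · exact le_join_left α β h
    · have h1 := le_join_left α β h1
      have h2 := mid_le_join α β h2
      have h3 := le_join_left α β h3
      exact (join α β).trans (h1 : join α β (Sum.inl a) (Sum.inr (Sum.inl b)))
        ((join α β).trans h2 ((join α β).symm h3))

/-! ### Reflection -/

/-- The reflection of a partition, which exchanges upper and lower points. -/
def flip (α : Setoid (A ⊕ B)) : Setoid (B ⊕ A) := α.comap Sum.swap

theorem flip_flip (α : Setoid (A ⊕ B)) : flip (flip α) = α := by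
  ext x y
  rcases x with x | x <;> rcases y with y | y <;> exact Iff.rfl

theorem ker_flip (α : Setoid (A ⊕ B)) : ker (flip α) = coker α := rfl

theorem coker_flip (α : Setoid (A ⊕ B)) : coker (flip α) = ker α := rfl

theorem mid_flip (α : Setoid (A ⊕ B)) (β : Setoid (B ⊕ C)) :
    mid (flip β) (flip α) = mid α β := by
  rw [mid, mid, coker_flip, ker_flip, sup_comm]

theorem flip_comp (α : Setoid (A ⊕ B)) (β : Setoid (B ⊕ C)) :
    flip (comp α β) = comp (flip β) (flip α) := by
  apply le_antisymm
  · have key : join α β ≤ (join (flip β) (flip α)).comap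
        (Sum.elim (fun a => Sum.inr (Sum.inr a))
          (Sum.elim (fun b => Sum.inr (Sum.inl b)) Sum.inl)) := by
      refine join_le_iff.2 ⟨?_, ?_⟩
      · intro x y h
        have := le_join_right (flip β) (flip α) (x := x.swap) (y := y.swap)
          (by rcases x with x | x <;> rcases y with y | y <;> exact h)
        rcases x with x | x <;> rcases y with y | y <;> exact this
      · intro x y h
        have := le_join_left (flip β) (flip α) (x := x.swap) (y := y.swap)
          (by rcases x with x | x <;> rcases y with y | y <;> exact h)
        rcases x with x | x <;> rcases y with y | y <;> exact this
    intro x y h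
    have := key h
    rcases x with x | x <;> rcases y with y | y <;> exact this
  · have key : join (flip β) (flip α) ≤ (join α β).comap
        (Sum.elim (fun a => Sum.inr (Sum.inr a))
          (Sum.elim (fun b => Sum.inr (Sum.inl b)) Sum.inl)) := by
      refine join_le_iff.2 ⟨?_, ?_⟩
      · intro x y h
        have := le_join_right α β (x := x.swap) (y := y.swap) h
        rcases x with x | x <;> rcases y with y | y <;> exact this
      · intro x y h
        have := le_join_left α β (x := x.swap) (y := y.swap) h
        rcases x with x | x <;> rcases y with y | y <;> exact this
    intro x y h
    have := key h
    rcases x with x | x <;> rcases y with y | y <;> exact this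

theorem comp_inr_inr {α : Setoid (A ⊕ B)} {β : Setoid (B ⊕ C)} {c c' : C} :
    comp α β (Sum.inr c) (Sum.inr c') ↔ β (Sum.inr c) (Sum.inr c') ∨
      ∃ b b', β (Sum.inl b) (Sum.inr c) ∧ mid α β b b' ∧ β (Sum.inl b') (Sum.inr c') := by
  have h := comp_inl_inl (α := flip β) (β := flip α) (a := c) (a' := c')
  rw [← flip_comp, mid_flip] at h
  refine h.trans (or_congr Iff.rfl (exists_congr fun b => exists_congr fun b' =>
    and_congr ?_ (and_congr Iff.rfl ?_)))
  · exact ⟨fun h => β.symm h, fun h => β.symm h⟩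
  · exact ⟨fun h => β.symm h, fun h => β.symm h⟩

theorem ker_le_ker_comp (α : Setoid (A ⊕ B)) (β : Setoid (B ⊕ C)) : ker α ≤ ker (comp α β) :=
  fun _ _ h => comp_inl_inl.2 (Or.inl h)

theorem coker_le_coker_comp (α : Setoid (A ⊕ B)) (β : Setoid (B ⊕ C)) :
    coker β ≤ coker (comp α β) :=
  fun _ _ h => comp_inr_inr.2 (Or.inl h)

/-! ### Representatives of the transversals, and the rank -/

/-- `u i` and `v i` are an upper and a lower point of the `i`-th transversal of `α`, where `i`
runs through an index set of all transversals of `α`. -/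
structure Reps (α : Setoid (A ⊕ B)) (u : ι → A) (v : ι → B) : Prop where
  link : ∀ i, α (Sum.inl (u i)) (Sum.inr (v i))
  inj : ∀ i j, α (Sum.inl (u i)) (Sum.inl (u j)) → i = j
  exh : ∀ a b, α (Sum.inl a) (Sum.inr b) → ∃ i, α (Sum.inl a) (Sum.inl (u i))

/-- The transversals of a partition. -/
def transversals (α : Setoid (A ⊕ B)) : Set (Quotient α) :=
  {c | (∃ a : A, Quotient.mk α (Sum.inl a) = c) ∧ (∃ b : B, Quotient.mk α (Sum.inr b) = c)}

section Rank
variable {α : Setoid (A ⊕ B)} {β : Setoid (B ⊕ C)} {u : ι → A} {v : ι → B}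

theorem range_subset_transversals (h1 : ∀ i, α (Sum.inl (u i)) (Sum.inr (v i))) :
    Set.range (fun i => Quotient.mk α (Sum.inl (u i))) ⊆ transversals α := by
  rintro _ ⟨i, rfl⟩
  exact ⟨⟨u i, rfl⟩, ⟨v i, (Quotient.sound (h1 i)).symm⟩⟩

theorem ncard_range (h2 : ∀ i j, α (Sum.inl (u i)) (Sum.inl (u j)) → i = j) :
    (Set.range (fun i => Quotient.mk α (Sum.inl (u i)))).ncard = Nat.card ι := by
  rw [← Set.image_univ, Set.ncard_image_of_injective _ (fun i j h => h2 i j (Quotient.exact h)),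
    Set.ncard_univ]

theorem card_le_rank [Finite A] [Finite B] (h1 : ∀ i, α (Sum.inl (u i)) (Sum.inr (v i)))
    (h2 : ∀ i j, α (Sum.inl (u i)) (Sum.inl (u j)) → i = j) : Nat.card ι ≤ rank α := by
  rw [← ncard_range h2]
  exact Set.ncard_le_ncard (range_subset_transversals h1) (Set.toFinite _)

/-- As many representatives of distinct transversals as the rank of `α` represent all of its
transversals. -/
theorem Reps.of_rank_le [Finite A] [Finite B] (h1 : ∀ i, α (Sum.inl (u i)) (Sum.inr (v i)))
    (h2 : ∀ i j, α (Sum.inl (u i)) (Sum.inl (u j)) → i = j) (h : rank α ≤ Nat.card ι) :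
    Reps α u v := by
  refine ⟨h1, h2, fun a b hab => ?_⟩
  have := Set.eq_of_subset_of_ncard_le (range_subset_transversals h1)
    (by rw [ncard_range h2]; exact h)
    (Set.toFinite _)
  have ha : Quotient.mk α (Sum.inl a) ∈ transversals α := ⟨⟨a, rfl⟩, ⟨b, (Quotient.sound hab).symm⟩⟩
  rw [← this] at ha
  obtain ⟨i, hi⟩ := ha
  exact ⟨i, α.symm (Quotient.exact hi)⟩

theorem Reps.rank_eq (h : Reps α u v) : rank α = Nat.card ι := by
  rw [← ncard_range h.inj]
  refine congrArg Set.ncard (Set.Subset.antisymm ?_ (range_subset_transversals h.link))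
  rintro _ ⟨⟨a, rfl⟩, ⟨b, hb⟩⟩
  obtain ⟨i, hi⟩ := h.exh a b (α.symm (Quotient.exact hb))
  exact ⟨i, (Quotient.sound hi).symm⟩

theorem exists_reps [Finite A] [Finite B] (α : Setoid (A ⊕ B)) {k : ℕ} (hk : rank α = k) :
    ∃ (u : Fin k → A) (v : Fin k → B), Reps α u v := by
  subst hk
  have hc : Nat.card (transversals α) = rank α := Nat.card_coe_set_eq _
  have e := (Finite.equivFinOfCardEq hc).symm
  choose u hu using fun i => (e i).2.1
  choose v hv using fun i => (e i).2.2
  refine ⟨u, v, fun i => Quotient.exact ((hu i).trans (hv i).symm), fun i j h => ?_,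
    fun a b h => ?_⟩
  · apply e.injective
    apply Subtype.ext
    rw [← hu i, ← hu j]
    exact Quotient.sound h
  · refine ⟨e.symm ⟨Quotient.mk α (Sum.inl a), ⟨a, rfl⟩, ⟨b, (Quotient.sound h).symm⟩⟩, ?_⟩
    apply Quotient.exact
    rw [hu, Equiv.apply_symm_apply]

theorem Reps.inj_right (h : Reps α u v) (i j : ι) (hij : α (Sum.inr (v i)) (Sum.inr (v j))) :
    i = j :=
  h.inj i j (α.trans (h.link i) (α.trans hij (α.symm (h.link j))))

theorem Reps.flip (h : Reps α u v) : Reps (flip α) v u where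
  link i := α.symm (h.link i)
  inj := h.inj_right
  exh b a hab := by
    obtain ⟨i, hi⟩ := h.exh a b (α.symm hab)
    exact ⟨i, α.trans hab (α.trans hi (h.link i))⟩

theorem Reps.reindex (h : Reps α u v) (e : κ ≃ ι) : Reps α (u ∘ e) (v ∘ e) where
  link i := h.link _
  inj i j hij := e.injective (h.inj _ _ hij)
  exh a b hab := by
    obtain ⟨i, hi⟩ := h.exh a b hab
    exact ⟨e.symm i, by simpa using hi⟩

theorem Reps.inl_inr_iff (h : Reps α u v) {a : A} {b : B} : α (Sum.inl a) (Sum.inr b) ↔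
    ∃ i, α (Sum.inl a) (Sum.inl (u i)) ∧ α (Sum.inr (v i)) (Sum.inr b) := by
  constructor
  · intro hab
    obtain ⟨i, hi⟩ := h.exh a b hab
    exact ⟨i, hi, α.trans (α.symm (h.link i)) (α.trans (α.symm hi) hab)⟩
  · rintro ⟨i, h1, h2⟩
    exact α.trans h1 (α.trans (h.link i) h2)

theorem rank_flip [Finite A] [Finite B] (α : Setoid (A ⊕ B)) : rank (flip α) = rank α := by
  obtain ⟨u, v, h⟩ := exists_reps α rfl
  rw [h.rank_eq, h.flip.rank_eq]

theorem rank_comp_le_left [Finite A] [Finite B] [Finite C] (α : Setoid (A ⊕ B))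
    (β : Setoid (B ⊕ C)) : rank (comp α β) ≤ rank α := by
  obtain ⟨u, v, h⟩ := exists_reps (comp α β) rfl
  choose b b' hb _ _ using fun i => comp_inl_inr.1 (h.link i)
  have := card_le_rank hb (fun i j hij => h.inj i j (ker_le_ker_comp α β hij))
  rwa [Nat.card_fin] at this

theorem rank_comp_le_right [Finite A] [Finite B] [Finite C] (α : Setoid (A ⊕ B))
    (β : Setoid (B ⊕ C)) : rank (comp α β) ≤ rank β := by
  rw [← rank_flip, flip_comp, ← rank_flip β]
  exact rank_comp_le_left _ _

theorem rank_eq_zero_iff [Finite A] [Finite B] {α : Setoid (A ⊕ B)} :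
    rank α = 0 ↔ ∀ a b, ¬ α (Sum.inl a) (Sum.inr b) := by
  constructor
  · intro h a b hab
    obtain ⟨u, v, hr⟩ := exists_reps α h
    obtain ⟨i, _⟩ := hr.exh a b hab
    exact i.elim0
  · intro h
    have : Reps α (Fin.elim0 : Fin 0 → A) (Fin.elim0 : Fin 0 → B) :=
      ⟨fun i => i.elim0, fun i => i.elim0, fun a b hab => absurd hab (h a b)⟩
    rw [this.rank_eq, Nat.card_fin]

/-- If left multiplication by `a` does not lower the rank of `α`, then the product `comp a α`
neither merges the transversals of `α` nor cuts them off from the top row. -/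
theorem Reps.nondeg_left [Finite A] [Finite B] [Finite C] [Finite ι] {a : Setoid (A ⊕ B)}
    {α : Setoid (B ⊕ C)} {u : ι → B} {v : ι → C} (h : Reps α u v)
    (hr : Nat.card ι ≤ rank (comp a α)) :
    (∀ i, ∃ x y, a (Sum.inl x) (Sum.inr y) ∧ mid a α y (u i)) ∧
      (∀ i j, mid a α (u i) (u j) → i = j) := by
  have hr' : rank (comp a α) = Nat.card ι :=
    le_antisymm ((rank_comp_le_right a α).trans_eq h.rank_eq) hr
  obtain ⟨s, t, hst⟩ := exists_reps (comp a α) hr'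
  choose y y' hy hyy hy' using fun i => comp_inl_inr.1 (hst.link i)
  choose f hf using fun i => h.exh _ _ (hy' i)
  have hyf : ∀ i, mid a α (y i) (u (f i)) := fun i =>
    (mid a α).trans (hyy i) (ker_le_mid (hf i))
  have key : ∀ i j, mid a α (u (f i)) (u (f j)) → i = j := fun i j hij =>
    hst.inj i j (comp_inl_inl.2 (Or.inr ⟨y i, y j, hy i, (mid a α).trans (hyf i)
      ((mid a α).trans hij ((mid a α).symm (hyf j))), hy j⟩))
  -- `f i` is the transversal of `α` that the `i`-th transversal of the product runs through
  have hinj : Function.Injective f := fun i j hij => key i j (by rw [hij])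
  have hsurj : Function.Surjective f :=
    ((Nat.bijective_iff_injective_and_card f).2 ⟨hinj, by simp⟩).2
  constructor
  · intro i
    obtain ⟨l, rfl⟩ := hsurj i
    exact ⟨s l, y l, hy l, hyf l⟩
  · intro i j hij
    obtain ⟨l, rfl⟩ := hsurj i
    obtain ⟨m, rfl⟩ := hsurj j
    rw [key l m hij]

/-- The reflection of `Reps.nondeg_left`. -/
theorem Reps.nondeg_right [Finite A] [Finite B] [Finite C] [Finite ι] {α : Setoid (A ⊕ B)}
    {b : Setoid (B ⊕ C)} {u : ι → A} {v : ι → B} (h : Reps α u v)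
    (hr : Nat.card ι ≤ rank (comp α b)) :
    (∀ i, ∃ y z, mid α b (v i) y ∧ b (Sum.inl y) (Sum.inr z)) ∧
      (∀ i j, mid α b (v i) (v j) → i = j) := by
  rw [← rank_flip, flip_comp] at hr
  have := h.flip.nondeg_left hr
  rw [mid_flip] at this
  refine ⟨fun i => ?_, this.2⟩
  obtain ⟨x, y, h1, h2⟩ := this.1 i
  exact ⟨y, x, (mid α b).symm h2, b.symm h1⟩

theorem Reps.comp_left {a : Setoid (A ⊕ B)} {α : Setoid (B ⊕ C)} {u : ι → B} {v : ι → C}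
    (h : Reps α u v) {x : ι → A} {y : ι → B} (hx : ∀ i, a (Sum.inl (x i)) (Sum.inr (y i)))
    (hy : ∀ i, mid a α (y i) (u i)) (hu : ∀ i j, mid a α (u i) (u j) → i = j) :
    Reps (comp a α) x v where
  link i := comp_inl_inr.2 ⟨y i, u i, hx i, hy i, h.link i⟩
  inj i j hij := by
    apply hu
    rcases comp_inl_inl.1 hij with hij | ⟨b, b', h1, h2, h3⟩
    · exact (mid a α).trans ((mid a α).symm (hy i)) ((mid a α).trans (coker_le_mid
        (a.trans (a.symm (hx i)) (a.trans hij (hx j)))) (hy j))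
    · exact (mid a α).trans ((mid a α).symm (hy i)) ((mid a α).trans (coker_le_mid
        (a.trans (a.symm (hx i)) h1)) ((mid a α).trans h2 ((mid a α).trans (coker_le_mid
        (a.trans (a.symm h3) (hx j))) (hy j))))
  exh s t hst := by
    obtain ⟨b, b', h1, h2, h3⟩ := comp_inl_inr.1 hst
    obtain ⟨i, hi⟩ := h.exh _ _ h3
    exact ⟨i, comp_inl_inl.2 (Or.inr ⟨b, y i, h1, (mid a α).trans h2 ((mid a α).trans
      (ker_le_mid hi) ((mid a α).symm (hy i))), hx i⟩)⟩

end Rank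

/-! ### Partitions with prescribed kernel, cokernel and transversals -/

/-- The partition with kernel `K` and cokernel `L` whose transversals connect the `K`-class of
`u i` to the `L`-class of `v i`. -/
def glue (K : Setoid A) (L : Setoid B) (u : ι → A) (v : ι → B)
    (hu : ∀ i j, K (u i) (u j) → i = j) (hv : ∀ i j, L (v i) (v j) → i = j) :
    Setoid (A ⊕ B) where
  r
    | Sum.inl a, Sum.inl a' => K a a'
    | Sum.inr b, Sum.inr b' => L b b'
    | Sum.inl a, Sum.inr b => ∃ i, K a (u i) ∧ L (v i) b
    | Sum.inr b, Sum.inl a => ∃ i, K a (u i) ∧ L (v i) b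
  iseqv := by
    refine ⟨?_, ?_, ?_⟩
    · rintro (x | x)
      · exact K.refl x
      · exact L.refl x
    · rintro (x | x) (y | y) h
      · exact K.symm h
      · exact h
      · exact h
      · exact L.symm h
    · rintro (x | x) (y | y) (z | z) h h'
      · exact K.trans h h'
      · obtain ⟨i, h1, h2⟩ := h'
        exact ⟨i, K.trans h h1, h2⟩
      · obtain ⟨i, h1, h2⟩ := h
        obtain ⟨j, h3, h4⟩ := h'
        obtain rfl := hv i j (L.trans h2 (L.symm h4))
        exact K.trans h1 (K.symm h3)
      · obtain ⟨i, h1, h2⟩ := h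
        exact ⟨i, h1, L.trans h2 h'⟩
      · obtain ⟨i, h1, h2⟩ := h
        exact ⟨i, K.trans (K.symm h') h1, h2⟩
      · obtain ⟨i, h1, h2⟩ := h
        obtain ⟨j, h3, h4⟩ := h'
        obtain rfl := hu i j (K.trans (K.symm h1) h3)
        exact L.trans (L.symm h2) h4
      · obtain ⟨i, h1, h2⟩ := h'
        exact ⟨i, h1, L.trans h2 (L.symm h)⟩
      · exact L.trans h h'

section Glue
variable {K : Setoid A} {L : Setoid B} {u : ι → A} {v : ι → B}
  {hu : ∀ i j, K (u i) (u j) → i = j} {hv : ∀ i j, L (v i) (v j) → i = j}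

theorem coker_glue : coker (glue K L u v hu hv) = L := rfl

theorem glue_inl_inr {a : A} {b : B} :
    glue K L u v hu hv (Sum.inl a) (Sum.inr b) ↔ ∃ i, K a (u i) ∧ L (v i) b := Iff.rfl

theorem reps_glue : Reps (glue K L u v hu hv) u v where
  link i := ⟨i, K.refl _, L.refl _⟩
  inj := hu
  exh a b h := by
    obtain ⟨i, hi, _⟩ := h
    exact ⟨i, hi⟩

theorem rank_glue : rank (glue K L u v hu hv) = Nat.card ι := reps_glue.rank_eq

end Glue

theorem Reps.ker_inj {α : Setoid (A ⊕ B)} {u : ι → A} {v : ι → B} (h : Reps α u v) :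
    ∀ i j, ker α (u i) (u j) → i = j := h.inj

theorem Reps.coker_inj {α : Setoid (A ⊕ B)} {u : ι → A} {v : ι → B} (h : Reps α u v) :
    ∀ i j, coker α (v i) (v j) → i = j := h.inj_right

/-- A partition is determined by its kernel, its cokernel and representatives of its
transversals. -/
theorem Reps.eq_glue {α : Setoid (A ⊕ B)} {u : ι → A} {v : ι → B} (h : Reps α u v) :
    α = glue (ker α) (coker α) u v h.ker_inj h.coker_inj :=
  eq_of_parts rfl rfl fun _ _ => h.inl_inr_iff

theorem Reps.exists_eq_glue {α : Setoid (A ⊕ B)} {u : ι → A} {v : ι → B} (h : Reps α u v) :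
    ∃ (K : Setoid A) (L : Setoid B) (hu : ∀ i j, K (u i) (u j) → i = j)
      (hv : ∀ i j, L (v i) (v j) → i = j), α = glue K L u v hu hv :=
  ⟨_, _, _, _, h.eq_glue⟩

/-- The product of two partitions whose transversals are joined one by one, except that further
transversals of the second factor stay unmatched. -/
theorem comp_glue {K : Setoid A} {M M' : Setoid B} {L : Setoid C} {u : ι → A} {p : ι → B}
    {p' : κ → B} {v : κ → C} {hu : ∀ i j, K (u i) (u j) → i = j}
    {hp : ∀ i j, M (p i) (p j) → i = j} {hp' : ∀ i j, M' (p' i) (p' j) → i = j}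
    {hv : ∀ i j, L (v i) (v j) → i = j} (f : ι → κ) (hf : Function.Injective f)
    (h1 : ∀ i, (M ⊔ M') (p i) (p' (f i))) (h2 : ∀ i j, (M ⊔ M') (p' i) (p' j) → i = j) :
    comp (glue K M u p hu hp) (glue M' L p' v hp' hv) =
      glue K L u (v ∘ f) hu (fun _ _ h => hf (hv _ _ h)) := by
  have hM : mid (glue K M u p hu hp) (glue M' L p' v hp' hv) = M ⊔ M' := rfl
  have hl : M ≤ M ⊔ M' := le_sup_left
  have hr : M' ≤ M ⊔ M' := le_sup_right
  refine eq_of_parts ?_ ?_ ?_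
  · ext a a'
    refine comp_inl_inl.trans ⟨?_, fun h => Or.inl h⟩
    rintro (h | ⟨b, b', ⟨i, ha, hb⟩, h, ⟨j, ha', hb'⟩⟩)
    · exact h
    · rw [hM] at h
      have : f i = f j := h2 _ _ ((M ⊔ M').trans ((M ⊔ M').symm (h1 i)) ((M ⊔ M').trans
        (hl hb) ((M ⊔ M').trans h ((M ⊔ M').trans ((M ⊔ M').symm (hl hb')) (h1 j)))))
      obtain rfl := hf this
      exact K.trans ha (K.symm ha')
  · ext c c'
    refine comp_inr_inr.trans ⟨?_, fun h => Or.inl h⟩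
    rintro (h | ⟨b, b', ⟨i, hb, hc⟩, h, ⟨j, hb', hc'⟩⟩)
    · exact h
    · rw [hM] at h
      obtain rfl : i = j := h2 _ _ ((M ⊔ M').trans ((M ⊔ M').symm (hr hb)) ((M ⊔ M').trans h
        (hr hb')))
      exact L.trans (L.symm hc) hc'
  · intro a c
    rw [comp_inl_inr, glue_inl_inr, hM]
    constructor
    · rintro ⟨b, b', ⟨i, ha, hb⟩, h, ⟨j, hb', hc⟩⟩
      have : f i = j := h2 _ _ ((M ⊔ M').trans ((M ⊔ M').symm (h1 i)) ((M ⊔ M').trans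
        (hl hb) ((M ⊔ M').trans h (hr hb'))))
      subst this
      exact ⟨i, ha, hc⟩
    · rintro ⟨i, ha, hc⟩
      exact ⟨p i, p' (f i), ⟨i, ha, M.refl _⟩, h1 i, ⟨f i, M'.refl _, hc⟩⟩

theorem comp_glue_glue {K : Setoid A} {M M' : Setoid B} {L : Setoid C} {u : ι → A} {p : ι → B}
    {p' : ι → B} {v : ι → C} {hu : ∀ i j, K (u i) (u j) → i = j}
    {hp : ∀ i j, M (p i) (p j) → i = j} {hp' : ∀ i j, M' (p' i) (p' j) → i = j}
    {hv : ∀ i j, L (v i) (v j) → i = j}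
    (h1 : ∀ i, (M ⊔ M') (p i) (p' i)) (h2 : ∀ i j, (M ⊔ M') (p' i) (p' j) → i = j) :
    comp (glue K M u p hu hp) (glue M' L p' v hp' hv) = glue K L u v hu hv :=
  comp_glue id Function.injective_id h1 h2

/-! ### Multipliers -/

/-- Any two partitions of the same rank are multiples of each other, and the multipliers can be
chosen of that rank too. -/
theorem exists_mul_eq [Finite A] [Finite B] [Finite C] [Finite D] {γ : Setoid (A ⊕ B)}
    {ζ : Setoid (C ⊕ D)} (h : rank ζ = rank γ) :
    ∃ (a : Setoid (C ⊕ A)) (b : Setoid (B ⊕ D)), rank a = rank γ ∧ rank b = rank γ ∧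
      ker a = ker ζ ∧ coker b = coker ζ ∧ comp (comp a γ) b = ζ := by
  obtain ⟨k, hk⟩ : ∃ k, rank γ = k := ⟨_, rfl⟩
  rw [hk] at h ⊢
  obtain ⟨u, v, hγ⟩ := exists_reps γ hk
  obtain ⟨s, t, hζ⟩ := exists_reps ζ h
  obtain ⟨K, L, hu, hv, rfl⟩ := hγ.exists_eq_glue
  obtain ⟨M, N, hs, ht, rfl⟩ := hζ.exists_eq_glue
  refine ⟨glue M K s u hs hu, glue L N v t hv ht, ?_, ?_, rfl, rfl, ?_⟩
  · rw [rank_glue, Nat.card_fin]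
  · rw [rank_glue, Nat.card_fin]
  · rw [comp_glue_glue (fun i => Setoid.refl' _ _) (by rwa [sup_idem]),
      comp_glue_glue (fun i => Setoid.refl' _ _) (by rwa [sup_idem])]

/-- Only distinct transversals of `α` can be merged in a product `α β`. -/
theorem ker_comp_of_rank_le_one [Finite A] [Finite B] {α : Setoid (A ⊕ B)} (h : rank α ≤ 1)
    (β : Setoid (B ⊕ C)) : ker (comp α β) = ker α := by
  refine le_antisymm (fun a a' haa => ?_) (ker_le_ker_comp α β)
  rcases comp_inl_inl.1 haa with haa | ⟨b, b', h1, -, h2⟩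
  · exact haa
  · obtain ⟨u, v, hr⟩ := exists_reps α rfl
    obtain ⟨i, hi⟩ := hr.exh _ _ h1
    obtain ⟨j, hj⟩ := hr.exh _ _ h2
    obtain rfl : i = j := Fin.ext (by omega)
    exact α.trans hi (α.symm hj)

theorem coker_comp_of_rank_le_one [Finite B] [Finite C] {β : Setoid (B ⊕ C)} (h : rank β ≤ 1)
    (α : Setoid (A ⊕ B)) : coker (comp α β) = coker β := by
  rw [← ker_flip, flip_comp, ker_comp_of_rank_le_one (by rwa [rank_flip]), ker_flip]

theorem ker_comp_congr {α β : Setoid (B ⊕ C)} (h : ker α = ker β) (a : Setoid (A ⊕ B)) :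
    ker (comp a α) = ker (comp a β) := by
  ext s t
  have hm : mid a α = mid a β := by rw [mid, mid, h]
  change comp a α (Sum.inl s) (Sum.inl t) ↔ comp a β (Sum.inl s) (Sum.inl t)
  rw [comp_inl_inl, comp_inl_inl, hm]

/-- The partition of rank zero with kernel `K` and cokernel `L`. -/
def rect (K : Setoid A) (L : Setoid B) : Setoid (A ⊕ B) :=
  glue K L Empty.elim Empty.elim (fun i => i.elim) (fun i => i.elim)

theorem ker_rect (K : Setoid A) (L : Setoid B) : ker (rect K L) = K := rfl

theorem coker_rect (K : Setoid A) (L : Setoid B) : coker (rect K L) = L := rfl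

theorem rank_rect (K : Setoid A) (L : Setoid B) : rank (rect K L) = 0 :=
  rank_glue.trans (by simp)

theorem not_rect {K : Setoid A} {L : Setoid B} {a : A} {b : B} :
    ¬ rect K L (Sum.inl a) (Sum.inr b) := fun ⟨i, _⟩ => i.elim

theorem eq_rect [Finite A] [Finite B] {α : Setoid (A ⊕ B)} (h : rank α = 0) :
    α = rect (ker α) (coker α) :=
  eq_of_parts rfl rfl fun a b => iff_of_false (rank_eq_zero_iff.1 h a b) not_rect

theorem ext_of_rank_eq_zero [Finite A] [Finite B] {α β : Setoid (A ⊕ B)} (hα : rank α = 0)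
    (hβ : rank β = 0) (hk : ker α = ker β) (hc : coker α = coker β) : α = β := by
  rw [eq_rect hα, eq_rect hβ, hk, hc]

theorem hat_eq_rect (α : Setoid (A ⊕ B)) : hat α = rect (ker α) (coker α) := by
  refine eq_of_parts ?_ ?_ fun a b => iff_of_false (fun h => by cases h.2) not_rect
  · ext a a'
    exact ⟨fun h => h.1, fun h => ⟨h, rfl⟩⟩
  · ext a a'
    exact ⟨fun h => h.1, fun h => ⟨h, rfl⟩⟩

theorem ker_hat (α : Setoid (A ⊕ B)) : ker (hat α) = ker α := by rw [hat_eq_rect, ker_rect]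

theorem coker_hat (α : Setoid (A ⊕ B)) : coker (hat α) = coker α := by
  rw [hat_eq_rect, coker_rect]

theorem rank_hat (α : Setoid (A ⊕ B)) : rank (hat α) = 0 := by rw [hat_eq_rect, rank_rect]

theorem hat_eq_self [Finite A] [Finite B] {α : Setoid (A ⊕ B)} (h : rank α = 0) : hat α = α := by
  rw [hat_eq_rect, ← eq_rect h]

/-- The partition with transversals `{p i, (q i)'}` and all other blocks singletons. -/
def link {p : ι → A} {q : ι → B} (hp : p.Injective) (hq : q.Injective) : Setoid (A ⊕ B) :=
  glue ⊥ ⊥ p q (fun _ _ h => hp h) (fun _ _ h => hq h)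

section Link
variable {p : ι → A} {q : ι → B} {hp : p.Injective} {hq : q.Injective}

theorem rank_link : rank (link hp hq) = Nat.card ι := rank_glue

theorem reps_link : Reps (link hp hq) p q := reps_glue

theorem mid_link_left (β : Setoid (B ⊕ C)) : mid (link hp hq) β = ker β := by
  change ⊥ ⊔ ker β = _
  rw [bot_sup_eq]

theorem mid_link_right (α : Setoid (C ⊕ A)) : mid α (link hp hq) = coker α := by
  change coker α ⊔ ⊥ = _
  rw [sup_bot_eq]

theorem link_comp_inl_inr {β : Setoid (B ⊕ C)} {a : A} {c : C} :
    comp (link hp hq) β (Sum.inl a) (Sum.inr c) ↔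
      ∃ i, a = p i ∧ β (Sum.inl (q i)) (Sum.inr c) := by
  rw [comp_inl_inr, mid_link_left]
  constructor
  · rintro ⟨b, b', ⟨i, rfl, hb⟩, h, h'⟩
    obtain rfl : q i = b := hb
    exact ⟨i, rfl, β.trans h h'⟩
  · rintro ⟨i, rfl, h⟩
    exact ⟨q i, q i, ⟨i, rfl, rfl⟩, Setoid.refl' _ _, h⟩

theorem link_comp_inl_inl {β : Setoid (B ⊕ C)} {a a' : A} :
    comp (link hp hq) β (Sum.inl a) (Sum.inl a') ↔ a = a' ∨
      ∃ i j, a = p i ∧ a' = p j ∧ β (Sum.inl (q i)) (Sum.inl (q j)) := by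
  rw [comp_inl_inl, mid_link_left]
  refine or_congr Iff.rfl ?_
  constructor
  · rintro ⟨b, b', ⟨i, rfl, hb⟩, h, ⟨j, rfl, hb'⟩⟩
    obtain rfl : q i = b := hb
    obtain rfl : q j = b' := hb'
    exact ⟨i, j, rfl, rfl, h⟩
  · rintro ⟨i, j, rfl, rfl, h⟩
    exact ⟨q i, q j, ⟨i, rfl, rfl⟩, h, ⟨j, rfl, rfl⟩⟩

theorem comp_link_inl_inr {α : Setoid (C ⊕ A)} {c : C} {b : B} :
    comp α (link hp hq) (Sum.inl c) (Sum.inr b) ↔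
      ∃ i, α (Sum.inl c) (Sum.inr (p i)) ∧ q i = b := by
  rw [comp_inl_inr, mid_link_right]
  constructor
  · rintro ⟨a, a', h, h', ⟨i, ha, rfl⟩⟩
    obtain rfl : a' = p i := ha
    exact ⟨i, α.trans h h', rfl⟩
  · rintro ⟨i, h, rfl⟩
    exact ⟨p i, p i, h, Setoid.refl' _ _, ⟨i, rfl, rfl⟩⟩

theorem glue_comp_link {K : Setoid C} {L : Setoid A} {κ : Type*} {u : κ → C} {v : κ → A}
    {hu : ∀ i j, K (u i) (u j) → i = j} {hv : ∀ i j, L (v i) (v j) → i = j} (f : κ → ι)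
    (hf : f.Injective) (h : ∀ i, v i = p (f i)) (hL : ∀ i j, L (p i) (p j) → i = j) :
    comp (glue K L u v hu hv) (link hp hq) =
      glue K ⊥ u (q ∘ f) hu (fun _ _ h => (hq.comp hf) h) :=
  comp_glue f hf (fun i => by rw [h i]) (by rwa [sup_bot_eq])

theorem link_comp_glue {K : Setoid B} {L : Setoid C} {v : ι → C}
    {hu : ∀ i j, K (q i) (q j) → i = j} {hv : ∀ i j, L (v i) (v j) → i = j} :
    comp (link hp hq) (glue K L q v hu hv) = glue ⊥ L p v (fun _ _ h => hp h) hv :=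
  comp_glue_glue (fun _ => Setoid.refl' _ _) (by rwa [bot_sup_eq])

theorem link_comp_link {r : κ → B} {s : κ → C} {hr : r.Injective} {hs : s.Injective} (f : ι → κ)
    (hf : f.Injective) (h : ∀ i, q i = r (f i)) :
    comp (link hp hq) (link hr hs) = link hp (hs.comp hf) :=
  glue_comp_link f hf h (fun _ _ h => hr h)

/-- Cutting `α` down to representatives of its transversals. -/
theorem Reps.sandwich {α : Setoid (C ⊕ D)} {u : ι → C} {v : ι → D} {f : ι → ι}
    (h : Reps α u (v ∘ f)) (hf : f.Bijective) (hu : u.Injective) (hv : v.Injective) :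
    comp (comp (Partn.link hp hu) α) (Partn.link hv hq) = Partn.link hp (hq.comp hf.1) := by
  obtain ⟨K, L, hs, ht, rfl⟩ := h.exists_eq_glue
  rw [link_comp_glue]
  refine glue_comp_link f hf.1 (fun _ => rfl) fun i j hij => ?_
  obtain ⟨i, rfl⟩ := hf.2 i
  obtain ⟨j, rfl⟩ := hf.2 j
  rw [ht i j hij]

end Link

theorem Reps.injective_left {α : Setoid (A ⊕ B)} {u : ι → A} {v : ι → B} (h : Reps α u v) :
    u.Injective := fun i j hij => h.inj i j (by rw [hij])

theorem Reps.injective_right {α : Setoid (A ⊕ B)} {u : ι → A} {v : ι → B} (h : Reps α u v) :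
    v.Injective := fun i j hij => h.inj_right i j (by rw [hij])

/-- A multiplier that merges two further classes of `K` in the product with `α`, and none in the
product with `β`. -/
theorem exists_merge {α β : Setoid (A ⊕ B)} {p q : A} (hα : ker α p q) (hβ : ¬ ker β p q)
    (K : Setoid C) (hK : K ≠ ⊤) :
    ∃ x : Setoid (C ⊕ A), rank x = 2 ∧ ker (comp x β) = K ∧ K < ker (comp x α) := by
  obtain ⟨s, t, hst⟩ : ∃ s t, ¬ K s t := by
    by_contra! h
    exact hK (top_unique fun s t _ => h s t)
  have hu : ∀ i j : Fin 2, K (![s, t] i) (![s, t] j) → i = j := by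
    intro i j h
    fin_cases i <;> fin_cases j
    · rfl
    · exact absurd h hst
    · exact absurd (K.symm h) hst
    · rfl
  have hv : ∀ i j : Fin 2, ker β (![p, q] i) (![p, q] j) → i = j := by
    intro i j h
    fin_cases i <;> fin_cases j
    · rfl
    · exact absurd h hβ
    · exact absurd ((ker β).symm h) hβ
    · rfl
  have hv' : ∀ i j : Fin 2, (⊥ : Setoid A) (![p, q] i) (![p, q] j) → i = j :=
    fun i j h => hv i j ((bot_le : ⊥ ≤ ker β) h)
  refine ⟨glue K ⊥ ![s, t] ![p, q] hu hv', by rw [rank_glue, Nat.card_fin], ?_, ?_⟩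
  · refine le_antisymm ?_ (ker_le_ker_comp (glue K ⊥ ![s, t] ![p, q] hu hv') β)
    intro a a' h
    rcases comp_inl_inl.1 h with h | ⟨b, b', ⟨i, ha, hb⟩, h, ⟨j, ha', hb'⟩⟩
    · exact h
    · have h : (⊥ ⊔ ker β) b b' := h
      rw [bot_sup_eq] at h
      rw [Setoid.bot_def] at hb hb'
      rw [← hb, ← hb'] at h
      obtain rfl := hv _ _ h
      exact K.trans ha (K.symm ha')
  · refine lt_of_le_not_ge
      (ker_le_ker_comp (glue K ⊥ ![s, t] ![p, q] hu hv') α) fun h => hst (h ?_)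
    exact comp_inl_inl.2 (Or.inr ⟨p, q, ⟨0, K.refl _, rfl⟩, ker_le_mid hα, ⟨1, K.refl _, rfl⟩⟩)

section Drop
variable [Finite A] [Finite B] {δ : Setoid (A ⊕ B)} {k : ℕ} {u : Fin k → A}

/-- If `δ` has rank less than `k`, then among any `k` upper points one lies on no transversal or
two lie in the same block. -/
theorem exists_of_rank_lt (h : rank δ < k) (u : Fin k → A) :
    (∃ i, ∀ b, ¬ δ (Sum.inl (u i)) (Sum.inr b)) ∨
      ∃ i j, i ≠ j ∧ δ (Sum.inl (u i)) (Sum.inl (u j)) := by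
  by_contra! hc
  choose v hv using hc.1
  have := card_le_rank hv (fun i j hij => by by_contra hne; exact hc.2 i j hne hij)
  rw [Nat.card_fin] at this
  omega

theorem exists_injective_of_le {j : ℕ} (h2 : 2 ≤ j) (hj : j ≤ k) (i i' : Fin k) :
    ∃ J : Fin j → Fin k, J.Injective ∧ (∃ l, J l = i) ∧ ∃ l, J l = i' := by
  obtain ⟨s, hs, hcard⟩ := Finset.exists_superset_card_eq (s := {i, i'}) (n := j)
    (Finset.card_le_two.trans h2) (by rwa [Fintype.card_fin])
  have hi : i ∈ Set.range (s.orderEmbOfFin hcard) := by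
    rw [Finset.range_orderEmbOfFin]; exact hs (by simp)
  have hi' : i' ∈ Set.range (s.orderEmbOfFin hcard) := by
    rw [Finset.range_orderEmbOfFin]; exact hs (by simp)
  exact ⟨s.orderEmbOfFin hcard, (s.orderEmbOfFin hcard).injective, hi, hi'⟩

/-- A partition of rank less than `k` also has a product of rank less than `j` with the partial
identity on `j` of any `k` given points, for some choice of the `j` points. For `j = 1` this may
fail, since two given points in the same transversal are not detected by one point. -/
theorem exists_rank_lt (h : rank δ < k) (hu : u.Injective) {j : ℕ} (h2 : 2 ≤ j) (hj : j ≤ k) :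
    ∃ (J : Fin j → Fin k) (hJ : J.Injective),
      rank (comp (link (hu.comp hJ) (hu.comp hJ)) δ) < j := by
  have key : ∀ (J : Fin j → Fin k) (hJ : J.Injective),
      j ≤ rank (comp (link (hu.comp hJ) (hu.comp hJ)) δ) →
      (∀ l, ∃ b, δ (Sum.inl (u (J l))) (Sum.inr b)) ∧
        ∀ l m, δ (Sum.inl (u (J l))) (Sum.inl (u (J m))) → l = m := by
    intro J hJ hr
    have := (reps_link (hp := hu.comp hJ) (hq := hu.comp hJ)).nondeg_right
      (by rwa [Nat.card_fin])
    rw [mid_link_left] at this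
    refine ⟨fun l => ?_, fun l m => this.2 l m⟩
    obtain ⟨y, z, hy, hz⟩ := this.1 l
    exact ⟨z, δ.trans hy hz⟩
  rcases exists_of_rank_lt h u with ⟨i, hi⟩ | ⟨i, i', hne, hi⟩
  · obtain ⟨J, hJ, ⟨l, rfl⟩, -⟩ := exists_injective_of_le h2 hj i i
    refine ⟨J, hJ, lt_of_not_ge fun hr => ?_⟩
    obtain ⟨b, hb⟩ := (key J hJ hr).1 l
    exact hi b hb
  · obtain ⟨J, hJ, ⟨l, rfl⟩, ⟨m, rfl⟩⟩ := exists_injective_of_le h2 hj i i'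
    refine ⟨J, hJ, lt_of_not_ge fun hr => hne ?_⟩
    rw [(key J hJ hr).2 l m hi]

end Drop

theorem injective_const {a : A} : (fun _ : Unit => a).Injective := fun _ _ _ => rfl

theorem rank_link_const [Finite A] (a : A) :
    rank (link (injective_const (a := a)) (injective_const (a := a))) = 1 := by
  rw [rank_link]; simp

section Rank1
variable [Finite A] {δ : Setoid (A ⊕ A)} {k : ℕ} {u : Fin k → A}

/-- Multiplication by partial identities of rank one tests a pair of points for being related. -/
theorem rank_link_comp_link (α : Setoid (A ⊕ A)) (a b : A) :
    rank (comp (comp (link (injective_const (a := a)) (injective_const (a := a))) α)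
      (link (injective_const (a := b)) (injective_const (a := b)))) ≤ 1 ∧
    (1 ≤ rank (comp (comp (link (injective_const (a := a)) (injective_const (a := a))) α)
      (link (injective_const (a := b)) (injective_const (a := b)))) ↔
      α (Sum.inl a) (Sum.inr b)) := by
  refine ⟨(rank_comp_le_right _ _).trans (rank_link_const b).le, ?_⟩
  rw [Nat.one_le_iff_ne_zero, ne_eq, rank_eq_zero_iff]
  push Not
  constructor
  · rintro ⟨s, t, h⟩
    obtain ⟨_, h1, rfl⟩ := comp_link_inl_inr.1 h
    obtain ⟨_, rfl, h2⟩ := link_comp_inl_inr.1 h1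
    exact h2
  · intro h
    exact ⟨a, b, comp_link_inl_inr.2 ⟨(), link_comp_inl_inr.2 ⟨(), rfl, h⟩, rfl⟩⟩

/-- A partition of rank less than `k` does not relate the same upper and lower points as a partial
identity on `k` points. -/
theorem exists_link_ne (h : rank δ < k) (hu : u.Injective) :
    ∃ a b, ¬ (link hu hu (Sum.inl a) (Sum.inr b) ↔ δ (Sum.inl a) (Sum.inr b)) := by
  by_contra! hc
  rcases exists_of_rank_lt h u with ⟨i, hi⟩ | ⟨i, i', hne, hi⟩
  · exact hi _ ((hc (u i) (u i)).1 ⟨i, rfl, rfl⟩)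
  · have h1 : δ (Sum.inl (u i')) (Sum.inr (u i')) := (hc (u i') (u i')).1 ⟨i', rfl, rfl⟩
    obtain ⟨l, h2, h3⟩ := (hc (u i) (u i')).2 (δ.trans hi h1)
    rw [hu h2] at hne
    exact hne (hu h3)

/-- A partition of rank less than `k ≥ 2` and a partial identity on `k` points have products of rank
zero with different kernels, by a common multiplier. If two of the points are merged by `δ`, then
the multiplier without nontrivial blocks shows this; otherwise some point is on no transversal of
`δ`, and the multiplier whose upper points form a single block does. -/
theorem exists_ker_ne (h : rank δ < k) (h2 : 2 ≤ k) (hu : u.Injective) :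
    ∃ y : Setoid (A ⊕ A), rank y = 0 ∧ ker (comp (link hu hu) y) ≠ ker (comp δ y) := by
  have merged : ∀ i i', i ≠ i' → δ (Sum.inl (u i)) (Sum.inl (u i')) →
      ∃ y : Setoid (A ⊕ A), rank y = 0 ∧ ker (comp (link hu hu) y) ≠ ker (comp δ y) := by
    intro i i' hne hi
    refine ⟨rect ⊥ ⊥, rank_rect _ _, fun heq => hne ?_⟩
    have h1 : ker (comp δ (rect ⊥ ⊥)) (u i) (u i') := ker_le_ker_comp δ (rect ⊥ (⊥ : Setoid A)) hi
    rw [← heq] at h1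
    rcases link_comp_inl_inl.1 h1 with h1 | ⟨l, m, h3, h4, h5⟩
    · exact hu h1
    · rw [hu h3, hu h4]
      exact hu h5
  rcases exists_of_rank_lt h u with ⟨i, hi⟩ | ⟨i, i', hne, hi⟩
  · have : Nontrivial (Fin k) := Fin.nontrivial_iff_two_le.2 h2
    obtain ⟨i', hne⟩ := exists_ne i
    by_cases hm : δ (Sum.inl (u i)) (Sum.inl (u i'))
    · exact merged i i' hne.symm hm
    · refine ⟨rect ⊤ ⊥, rank_rect _ _, fun heq => ?_⟩
      have h1 : ker (comp (link hu hu) (rect ⊤ (⊥ : Setoid A))) (u i) (u i') :=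
        link_comp_inl_inl.2 (Or.inr ⟨i, i', rfl, rfl, trivial⟩)
      rw [heq] at h1
      rcases comp_inl_inl.1 h1 with h1 | ⟨b, _, hb, _⟩
      · exact hm h1
      · exact hi b hb
  · exact merged i i' hne hi

end Rank1

/-! ### Green's relation `𝓗`, and how multipliers detect it -/

/-- The partitions `α` and `β` are `𝓗`-related in the partition category: they have the same
kernel and cokernel, and the same upper and lower points lie on transversals. -/
structure HRel (α β : Setoid (A ⊕ B)) : Prop where
  ker_eq : ker α = ker β
  coker_eq : coker α = coker β
  dom_iff : ∀ a, (∃ b, α (Sum.inl a) (Sum.inr b)) ↔ ∃ b, β (Sum.inl a) (Sum.inr b)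
  codom_iff : ∀ b, (∃ a, α (Sum.inl a) (Sum.inr b)) ↔ ∃ a, β (Sum.inl a) (Sum.inr b)

theorem Reps.update [DecidableEq ι] {α : Setoid (A ⊕ B)} {u : ι → A} {v : ι → B}
    (h : Reps α u v) {i : ι} {a : A} (ha : α (Sum.inl a) (Sum.inl (u i))) :
    Reps α (Function.update u i a) v := by
  have key : ∀ j, α (Sum.inl (Function.update u i a j)) (Sum.inl (u j)) := by
    intro j
    by_cases hj : j = i
    · subst hj
      rwa [Function.update_self]
    · rw [Function.update_of_ne hj]
  refine ⟨fun j => α.trans (key j) (h.link j), fun j l hjl => h.inj j l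
    (α.trans (α.symm (key j)) (α.trans hjl (key l))), fun x y hxy => ?_⟩
  obtain ⟨j, hj⟩ := h.exh x y hxy
  exact ⟨j, α.trans hj (α.symm (key j))⟩

section Separation
variable [Finite A] [Finite B] {α β : Setoid (A ⊕ B)} {k : ℕ}

theorem Reps.of_mul_rank
    (h : ∀ x : Setoid (A ⊕ A), rank x ≤ k → k ≤ rank (comp x α) → k ≤ rank (comp x β))
    {u : Fin k → A} {v : Fin k → B} (hα : Reps α u v) :
    (∀ i, ∃ b, β (Sum.inl (u i)) (Sum.inr b)) ∧ ∀ i j, ker β (u i) (u j) → i = j := by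
  have hu := hα.injective_left
  have h1 : k ≤ rank (comp (Partn.link hu hu) α) := by
    obtain ⟨K, L, hs, ht, rfl⟩ := hα.exists_eq_glue
    rw [link_comp_glue, rank_glue, Nat.card_fin]
  have h2 := (reps_link (hp := hu) (hq := hu)).nondeg_right
    (b := β) ((Nat.card_fin k).le.trans (h _ (by rw [rank_link, Nat.card_fin]) h1))
  rw [mid_link_left] at h2
  refine ⟨fun i => ?_, h2.2⟩
  obtain ⟨y, z, hy, hz⟩ := h2.1 i
  exact ⟨z, β.trans hy hz⟩

/-- An upper point `a` on a transversal of `α` is one of a system of representatives, and the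
partial identity on these representatives detects that `a` is on a transversal of `β` as well. -/
theorem dom_of_mul_rank
    (h : ∀ x : Setoid (A ⊕ A), rank x ≤ k → k ≤ rank (comp x α) → k ≤ rank (comp x β))
    (hα : rank α = k) {a : A} (ha : ∃ b, α (Sum.inl a) (Sum.inr b)) :
    ∃ b, β (Sum.inl a) (Sum.inr b) := by
  obtain ⟨u, v, hr⟩ := exists_reps α hα
  obtain ⟨b, hb⟩ := ha
  obtain ⟨i, hi⟩ := hr.exh a b hb
  have := (hr.update hi).of_mul_rank h |>.1 i
  rwa [Function.update_self] at this

/-- If left multiplication by partitions of rank at most `k` lowers the ranks of `α` and of `β`,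
both of rank `k`, in the same cases, then `α` and `β` have the same kernel. On the points of
transversals this is seen by multiplying by partial identities on representatives. If `a` and
`a'` lie on no transversal and are related by `α` only, the multiplier whose lower points `a` and
`a'` lie on a transversal and in a block with a point of a transversal of `α`, respectively,
lowers the rank of `β` only. -/
theorem ker_le_of_mul_rank (hk : 1 ≤ k) (hα : rank α = k) (hβ : rank β = k)
    (h : ∀ x : Setoid (A ⊕ A), rank x ≤ k → (k ≤ rank (comp x α) ↔ k ≤ rank (comp x β))) :
    ker α ≤ ker β := by
  classical
  have hdom : ∀ a, (∃ b, β (Sum.inl a) (Sum.inr b)) → ∃ b, α (Sum.inl a) (Sum.inr b) :=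
    fun a => dom_of_mul_rank (fun x hx => (h x hx).2) hβ
  have h' : ∀ x : Setoid (A ⊕ A), rank x ≤ k → k ≤ rank (comp x α) → k ≤ rank (comp x β) :=
    fun x hx => (h x hx).1
  obtain ⟨u, v, hr⟩ := exists_reps α hα
  intro a a' haa
  by_cases hd : ∃ b, α (Sum.inl a) (Sum.inr b)
  · obtain ⟨b, hb⟩ := hd
    obtain ⟨i, hi⟩ := hr.exh a b hb
    have hr1 := hr.update hi
    obtain ⟨w, hw⟩ : ∃ w, w = Function.update u i a := ⟨_, rfl⟩
    have hwi : w i = a := by rw [hw, Function.update_self]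
    rw [← hw] at hr1
    obtain ⟨h1, h2⟩ := hr1.of_mul_rank h'
    choose z hz using h1
    have hβr : Reps β w z := Reps.of_rank_le hz h2 (by rw [hβ, Nat.card_fin])
    have ha'i : α (Sum.inl a') (Sum.inl (w i)) := by rw [hwi]; exact α.symm haa
    obtain ⟨b', hb'⟩ := dom_of_mul_rank h' hα ⟨b, α.trans (α.symm haa) hb⟩
    obtain ⟨j, hj⟩ := hβr.exh _ _ hb'
    by_cases hji : j = i
    · subst hji
      rw [hwi] at hj
      exact β.symm hj
    · have := (hr1.update ha'i).of_mul_rank h' |>.2 i j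
      rw [Function.update_self, Function.update_of_ne hji] at this
      exact absurd (this hj).symm hji
  · by_contra hne
    have hd' : ¬ ∃ b, α (Sum.inl a') (Sum.inr b) := fun ⟨b, hb⟩ => hd ⟨b, α.trans haa hb⟩
    have hu : ∀ i, ∃ b, α (Sum.inl (u i)) (Sum.inr b) := fun i => ⟨v i, hr.link i⟩
    let i₀ : Fin k := ⟨0, hk⟩
    have hua : ∀ i, u i ≠ a := fun i h => hd (h ▸ hu i)
    have hua' : ∀ i, u i ≠ a' := fun i h => hd' (h ▸ hu i)
    have haa' : a ≠ a' := fun h => hne (h ▸ Setoid.refl' _ _)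
    -- `M` relates `a'` to `u i₀`, and no other points
    let φ : A → A := Function.update id a' (u i₀)
    let M : Setoid A := Setoid.ker φ
    have hφu : ∀ i, φ (u i) = u i := fun i => Function.update_of_ne (hua' i) _ _
    have hφa : φ a = a := Function.update_of_ne haa' _ _
    have hφa' : φ a' = u i₀ := Function.update_self _ _ _
    have hφ : ∀ y, y ≠ a' → φ y = y := fun y hy => Function.update_of_ne hy _ _
    have hM : ∀ S : Setoid A, S a' (u i₀) → M ≤ S := by
      intro S hS x y hxy
      have hxy : φ x = φ y := hxy
      have key : ∀ z, S z (φ z) := by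
        intro z
        by_cases hz : z = a'
        · rw [hz, hφa']
          exact hS
        · rw [hφ z hz]
      exact S.trans (key x) (hxy ▸ S.symm (key y))
    let w : Fin k → A := Function.update u i₀ a
    have hw₀ : w i₀ = a := Function.update_self _ _ _
    have hw' : ∀ i, i ≠ i₀ → w i = u i := fun i hi => Function.update_of_ne hi _ _
    have hwφ : ∀ i, φ (w i) = w i := by
      intro i
      by_cases hi : i = i₀
      · rw [hi, hw₀, hφa]
      · rw [hw' i hi, hφu]
    have hw : ∀ i j, M (w i) (w j) → i = j := by
      intro i j hij
      have hij : φ (w i) = φ (w j) := hij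
      rw [hwφ, hwφ] at hij
      by_cases hi : i = i₀ <;> by_cases hj : j = i₀
      · rw [hi, hj]
      · rw [hi, hw₀, hw' j hj] at hij
        exact absurd hij.symm (hua j)
      · rw [hj, hw₀, hw' i hi] at hij
        exact absurd hij (hua i)
      · rw [hw' j hj, hw' i hi] at hij
        exact hr.injective_left hij
    -- the lower points of the transversals of `x` are `a` and the `u i` with `i ≠ i₀`
    let x : Setoid (A ⊕ A) := glue ⊥ M u w (fun _ _ h => hr.injective_left h) hw
    have hx : rank x = k := by rw [rank_glue, Nat.card_fin]
    -- in the product with `α`, the path from `a` over `a'` leads to `u i₀`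
    have hxα : k ≤ rank (comp x α) := by
      have hS : M ⊔ ker α ≤ Setoid.ker (fun y => if α (Sum.inl y) (Sum.inl a') then
          Quotient.mk (ker α) (u i₀) else Quotient.mk (ker α) y) := by
        refine sup_le (hM _ ?_) ?_
        · rw [Setoid.ker_def, if_pos (α.refl _), ite_self]
        · intro y z hyz
          have hyz : α (Sum.inl y) (Sum.inl z) := hyz
          rw [Setoid.ker_def]
          by_cases hy : α (Sum.inl y) (Sum.inl a')
          · rw [if_pos hy, if_pos (α.trans (α.symm hyz) hy)]
          · rw [if_neg hy, if_neg fun hz => hy (α.trans hyz hz)]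
            exact Quotient.sound hyz
      have hun : ∀ i, ¬ α (Sum.inl (u i)) (Sum.inl a') :=
        fun i hi => hd' ⟨v i, α.trans (α.symm hi) (hr.link i)⟩
      have h1 : ∀ i j, (M ⊔ ker α) (u i) (u j) → i = j := by
        intro i j hij
        have := hS hij
        rw [Setoid.ker_def, if_neg (hun i), if_neg (hun j)] at this
        exact hr.inj i j (Quotient.exact this : ker α (u i) (u j))
      have h2 : ∀ i, (M ⊔ ker α) (w i) (u i) := by
        intro i
        by_cases hi : i = i₀
        · rw [hi, hw₀]
          refine (M ⊔ ker α).trans ((le_sup_right : ker α ≤ _) haa) ?_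
          refine (le_sup_left : M ≤ _) ?_
          change φ a' = φ (u i₀)
          rw [hφa', hφu]
        · rw [hw' i hi]
      have := (hr.comp_left (a := x) (x := u) (y := w)
        (fun i => reps_glue.link i) h2 h1).rank_eq
      rw [this, Nat.card_fin]
    have hxβ := (reps_glue (K := ⊥) (L := M) (u := u) (v := w)
      (hu := fun _ _ h => hr.injective_left h) (hv := hw)).nondeg_right (b := β)
      ((Nat.card_fin k).le.trans ((h x hx.le).1 hxα))
    obtain ⟨y, z, hy, hz⟩ := hxβ.1 i₀
    -- in the product with `β`, the block of `a` is not joined to any transversal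
    have hβa : ¬ ∃ b, β (Sum.inl a) (Sum.inr b) := fun hb => hd (hdom a hb)
    have hS : M ⊔ ker β ≤ Setoid.ker (fun y => ker β a y) := by
      refine sup_le (hM _ ?_) ?_
      · rw [Setoid.ker_def]
        refine propext (iff_of_false hne fun hau => hβa ?_)
        obtain ⟨b, hb⟩ := dom_of_mul_rank h' hα (hu i₀)
        exact ⟨b, β.trans hau hb⟩
      · intro y z hyz
        rw [Setoid.ker_def]
        exact propext ⟨fun h => (ker β).trans h hyz, fun h => (ker β).trans h ((ker β).symm hyz)⟩
    have hy : (M ⊔ ker β) (w i₀) y := hy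
    have hy := hS hy
    rw [Setoid.ker_def] at hy
    rw [hw₀] at hy
    have hay : ker β a y := hy ▸ Setoid.refl' _ _
    exact hβa ⟨z, β.trans hay hz⟩

end Separation

/-- If multiplication by partitions of rank at most `k` on either side lowers the ranks of `α` and
of `β`, both of rank `k`, in the same cases, then `α` and `β` are `𝓗`-related. -/
theorem HRel.of_mul_rank [Finite A] [Finite B] {α β : Setoid (A ⊕ B)} {k : ℕ} (hk : 1 ≤ k)
    (hα : rank α = k) (hβ : rank β = k)
    (hl : ∀ x : Setoid (A ⊕ A), rank x ≤ k → (k ≤ rank (comp x α) ↔ k ≤ rank (comp x β)))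
    (hr : ∀ x : Setoid (B ⊕ B), rank x ≤ k → (k ≤ rank (comp α x) ↔ k ≤ rank (comp β x))) :
    HRel α β := by
  have hr' : ∀ x : Setoid (B ⊕ B), rank x ≤ k →
      (k ≤ rank (comp x (flip α)) ↔ k ≤ rank (comp x (flip β))) := by
    intro x hx
    have := hr (flip x) (by rwa [rank_flip])
    rwa [← rank_flip, flip_comp, flip_flip, ← rank_flip (comp β _), flip_comp, flip_flip] at this
  rw [← rank_flip] at hα hβ
  have hα' := hα
  have hβ' := hβ
  rw [rank_flip] at hα' hβ'
  refine ⟨le_antisymm (ker_le_of_mul_rank hk hα' hβ' hl)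
      (ker_le_of_mul_rank hk hβ' hα' fun x hx => (hl x hx).symm),
    le_antisymm (ker_le_of_mul_rank hk hα hβ hr')
      (ker_le_of_mul_rank hk hβ hα fun x hx => (hr' x hx).symm), fun a => ⟨?_, ?_⟩,
    fun b => ⟨?_, ?_⟩⟩
  · exact dom_of_mul_rank (fun x hx => (hl x hx).1) hα'
  · exact dom_of_mul_rank (fun x hx => (hl x hx).2) hβ'
  · rintro ⟨a, ha⟩
    obtain ⟨c, hc⟩ := dom_of_mul_rank (fun x hx => (hr' x hx).1) hα ⟨a, α.symm ha⟩
    exact ⟨c, β.symm hc⟩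
  · rintro ⟨a, ha⟩
    obtain ⟨c, hc⟩ := dom_of_mul_rank (fun x hx => (hr' x hx).2) hβ ⟨a, β.symm ha⟩
    exact ⟨c, α.symm hc⟩

/-- `𝓗`-related partitions differ by a permutation of the transversals. -/
theorem HRel.exists_perm [Finite ι] {α β : Setoid (A ⊕ B)} (h : HRel α β) {u : ι → A} {v : ι → B}
    (hr : Reps α u v) : ∃ π : Equiv.Perm ι, Reps β u (v ∘ π) := by
  choose z hz using fun i => (h.dom_iff (u i)).1 ⟨v i, hr.link i⟩
  choose y hy using fun i => (h.codom_iff (z i)).2 ⟨u i, hz i⟩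
  choose f hf using fun i => hr.flip.exh _ _ (α.symm (hy i))
  have hinj : ∀ i j, β (Sum.inl (u i)) (Sum.inl (u j)) → i = j := fun i j hij =>
    hr.inj i j ((Setoid.ext_iff.1 h.ker_eq _ _).2 hij)
  have hlink : ∀ i, β (Sum.inl (u i)) (Sum.inr (v (f i))) := fun i =>
    β.trans (hz i) ((Setoid.ext_iff.1 h.coker_eq _ _).1 (hf i))
  have hfi : Function.Injective f := fun i j hij =>
    hinj i j (β.trans (hlink i) (β.symm (hij ▸ hlink j)))
  refine ⟨Equiv.ofBijective f (Finite.injective_iff_bijective.1 hfi), hlink, hinj, ?_⟩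
  intro a b hab
  obtain ⟨b', hb'⟩ := (h.dom_iff a).2 ⟨b, hab⟩
  obtain ⟨i, hi⟩ := hr.exh a b' hb'
  exact ⟨i, (Setoid.ext_iff.1 h.ker_eq _ _).1 hi⟩

/-! ### Partitions that differ by a permutation from a normal subgroup -/

/-- The partitions `α` and `β` of rank `k` have the same kernel and cokernel, and differ by a
permutation of the transversals that belongs to `N`. -/
structure Twist {k : ℕ} (N : Subgroup (Equiv.Perm (Fin k))) (α β : Setoid (A ⊕ B)) : Prop where
  ker_eq : ker α = ker β
  coker_eq : coker α = coker β
  perm : ∃ u v, ∃ π ∈ N, Reps α u v ∧ Reps β u (v ∘ π)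

namespace Twist
variable {k : ℕ} {N : Subgroup (Equiv.Perm (Fin k))} {α β γ : Setoid (A ⊕ B)}

theorem of_rank [Finite A] [Finite B] (N : Subgroup (Equiv.Perm (Fin k))) (h : rank α = k) :
    Twist N α α := by
  obtain ⟨u, v, hr⟩ := exists_reps α h
  exact ⟨rfl, rfl, u, v, 1, N.one_mem, hr, hr⟩

theorem rank_left (h : Twist N α β) : rank α = k := by
  obtain ⟨u, v, π, _, h1, _⟩ := h.perm
  rw [h1.rank_eq, Nat.card_fin]

theorem rank_right (h : Twist N α β) : rank β = k := by
  obtain ⟨u, v, π, _, _, h1⟩ := h.perm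
  rw [h1.rank_eq, Nat.card_fin]

theorem symm (h : Twist N α β) : Twist N β α := by
  obtain ⟨u, v, π, hπ, h1, h2⟩ := h.perm
  refine ⟨h.ker_eq.symm, h.coker_eq.symm, u, v ∘ π, π⁻¹, N.inv_mem hπ, h2, ?_⟩
  have : (v ∘ π) ∘ (π⁻¹ : Equiv.Perm (Fin k)) = v := by
    ext i
    simp
  rwa [this]

/-- The permutation may be computed with respect to any representatives of the transversals,
because `N` is normal. -/
theorem exists_perm (hN : N.Normal) (h : Twist N α β) {u : Fin k → A} {v : Fin k → B}
    (hr : Reps α u v) : ∃ π ∈ N, Reps β u (v ∘ π) := by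
  obtain ⟨u₀, v₀, π, hπ, h1, h2⟩ := h.perm
  choose f hf using fun i => h1.exh _ _ (hr.link i)
  have hfi : Function.Injective f := fun i j hij =>
    hr.inj i j (α.trans (hf i) (α.symm (hij ▸ hf j)))
  obtain ⟨g, rfl⟩ : ∃ g : Equiv.Perm (Fin k), f = g :=
    ⟨Equiv.ofBijective f (Finite.injective_iff_bijective.1 hfi), rfl⟩
  have hg : ∀ i, α (Sum.inr (v₀ (g i))) (Sum.inr (v i)) := fun i =>
    α.trans (α.symm (h1.link _)) (α.trans (α.symm (hf i)) (hr.link i))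
  have hβ : ∀ i, β (Sum.inl (u i)) (Sum.inl (u₀ (g i))) := fun i =>
    (Setoid.ext_iff.1 h.ker_eq _ _).1 (hf i)
  refine ⟨g⁻¹ * π * g, ?_, fun i => ?_, fun i j hij => ?_, fun a b hab => ?_⟩
  · have := hN.conj_mem π hπ g⁻¹
    rwa [inv_inv] at this
  · refine β.trans (hβ i) (β.trans (h2.link _) ?_)
    have := (Setoid.ext_iff.1 h.coker_eq _ _).1 (hg ((g⁻¹ * π * g) i))
    rw [show g ((g⁻¹ * π * g) i) = π (g i) by simp] at this
    exact this
  · exact hr.inj i j ((Setoid.ext_iff.1 h.ker_eq _ _).2 hij)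
  · obtain ⟨i, hi⟩ := h2.exh a b hab
    have := hβ (g⁻¹ i)
    rw [show g (g⁻¹ i) = i by simp] at this
    exact ⟨g⁻¹ i, β.trans hi (β.symm this)⟩

theorem trans (hN : N.Normal) (h : Twist N α β) (h' : Twist N β γ) : Twist N α γ := by
  obtain ⟨u, v, π, hπ, h1, h2⟩ := h.perm
  obtain ⟨ρ, hρ, h3⟩ := h'.exists_perm hN h2
  exact ⟨h.ker_eq.trans h'.ker_eq, h.coker_eq.trans h'.coker_eq, u, v, π * ρ, N.mul_mem hπ hρ,
    h1, h3⟩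

theorem mono {N' : Subgroup (Equiv.Perm (Fin k))} (hN : N ≤ N') (h : Twist N α β) :
    Twist N' α β := by
  obtain ⟨u, v, π, hπ, h'⟩ := h.perm
  exact ⟨h.ker_eq, h.coker_eq, u, v, π, hN hπ, h'⟩

theorem flip (h : Twist N α β) : Twist N (flip α) (flip β) := by
  obtain ⟨u, v, π, hπ, h1, h2⟩ := h.perm
  refine ⟨h.coker_eq, h.ker_eq, v, u, π⁻¹, N.inv_mem hπ, h1.flip, ?_⟩
  have := h2.flip.reindex π⁻¹
  have hv : (v ∘ π) ∘ (π⁻¹ : Equiv.Perm (Fin k)) = v := by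
    ext i
    simp
  rwa [hv] at this

/-- Left multiples of full rank differ by the same permutation: the multiplication replaces the
upper representatives of the transversals and keeps the lower ones. -/
theorem comp_left [Finite A] [Finite B] [Finite C] (h : Twist N α β) {a : Setoid (C ⊕ A)}
    (ha : k ≤ rank (comp a α)) : Twist N (comp a α) (comp a β) := by
  obtain ⟨u, v, π, hπ, h1, h2⟩ := h.perm
  have hm : mid a α = mid a β := by rw [mid, mid, h.ker_eq]
  obtain ⟨h3, h4⟩ := h1.nondeg_left ((Nat.card_fin k).le.trans ha)
  choose x y hx hy using h3
  have coker_comp : ∀ {γ : Setoid (A ⊕ B)} {w : Fin k → B}, Reps γ u w → mid a α = mid a γ →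
      coker (comp a γ) = coker γ := by
    intro γ w hγ hm
    refine le_antisymm (fun s t hst => ?_) (coker_le_coker_comp a γ)
    rcases comp_inr_inr.1 hst with hst | ⟨b, b', hb, hbb, hb'⟩
    · exact hst
    · obtain ⟨i, hi⟩ := hγ.exh _ _ hb
      obtain ⟨j, hj⟩ := hγ.exh _ _ hb'
      have : i = j := h4 i j (by
        rw [hm]
        exact (mid a γ).trans ((mid a γ).symm (ker_le_mid hi)) ((mid a γ).trans hbb
          (ker_le_mid hj)))
      subst this
      exact γ.trans (γ.symm hb) (γ.trans hi (γ.trans (γ.symm hj) hb'))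
  refine ⟨ker_comp_congr h.ker_eq a, ?_, x, v, π, hπ, h1.comp_left hx hy h4,
    h2.comp_left hx (hm ▸ hy) (hm ▸ h4)⟩
  rw [coker_comp h1 rfl, coker_comp h2 hm, h.coker_eq]

theorem comp_right [Finite A] [Finite B] [Finite C] (h : Twist N α β) {b : Setoid (B ⊕ C)}
    (hb : k ≤ rank (comp α b)) : Twist N (comp α b) (comp β b) := by
  rw [← rank_flip, flip_comp] at hb
  have := (h.flip.comp_left hb).flip
  rwa [← flip_comp, ← flip_comp, flip_flip, flip_flip] at this

/-- If there are at most two transversals, then a permutation of them does not affect the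
cokernels of the left multiples. -/
theorem coker_comp_eq (hk : k ≤ 2) (h : Twist N α β) (a : Setoid (C ⊕ A)) :
    coker (comp a α) = coker (comp a β) := by
  have key : ∀ {α β : Setoid (A ⊕ B)}, Twist N α β → coker (comp a α) ≤ coker (comp a β) := by
    intro α β h s t hst
    have hc : ∀ {x y}, α (Sum.inr x) (Sum.inr y) → β (Sum.inr x) (Sum.inr y) :=
      fun hxy => (Setoid.ext_iff.1 h.coker_eq _ _).1 hxy
    obtain ⟨u, v, π, hπ, h1, h2⟩ := h.perm
    have hm : mid a α = mid a β := by rw [mid, mid, h.ker_eq]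
    rcases comp_inr_inr.1 hst with hst | ⟨b, b', hb, hbb, hb'⟩
    · exact comp_inr_inr.2 (Or.inl (hc hst))
    · obtain ⟨i, hi⟩ := h1.exh _ _ hb
      obtain ⟨j, hj⟩ := h1.exh _ _ hb'
      have hij : mid a β (u i) (u j) := by
        rw [← hm]
        exact (mid a α).trans ((mid a α).symm (ker_le_mid hi)) ((mid a α).trans hbb
          (ker_le_mid hj))
      have hs : β (Sum.inr (v i)) (Sum.inr s) :=
        hc (α.trans (α.symm (h1.link i)) (α.trans (α.symm hi) hb))
      have ht : β (Sum.inr (v j)) (Sum.inr t) :=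
        hc (α.trans (α.symm (h1.link j)) (α.trans (α.symm hj) hb'))
      by_cases hne : i = j
      · subst hne
        exact comp_inr_inr.2 (Or.inl (β.trans (β.symm hs) ht))
      · have hπ : (π i = i ∧ π j = j) ∨ (π i = j ∧ π j = i) := by
          have h3 : (π i : ℕ) ≠ π j := fun h => hne (π.injective (Fin.ext h))
          have h4 : (i : ℕ) ≠ j := fun h => hne (Fin.ext h)
          simp only [Fin.ext_iff]
          omega
        rcases hπ with ⟨hi, hj⟩ | ⟨hi, hj⟩
        · have hli := h2.link i
          have hlj := h2.link j
          rw [Function.comp_apply, hi] at hli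
          rw [Function.comp_apply, hj] at hlj
          exact comp_inr_inr.2 (Or.inr ⟨u i, u j, β.trans hli hs, hij, β.trans hlj ht⟩)
        · have hli := h2.link i
          have hlj := h2.link j
          rw [Function.comp_apply, hi] at hli
          rw [Function.comp_apply, hj] at hlj
          exact comp_inr_inr.2 (Or.inr ⟨u j, u i, β.trans hlj hs, (mid a β).symm hij,
            β.trans hli ht⟩)
  exact le_antisymm (key h) (key h.symm)

end Twist

theorem HRel.eq_of_reps {α β : Setoid (A ⊕ B)} (h : HRel α β) {u : ι → A} {v : ι → B}
    (hα : Reps α u v) (hβ : Reps β u v) : α = β := by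
  refine eq_of_parts h.ker_eq h.coker_eq fun a b => ?_
  rw [hα.inl_inr_iff, hβ.inl_inr_iff]
  exact exists_congr fun i => and_congr (Setoid.ext_iff.1 h.ker_eq _ _)
    (Setoid.ext_iff.1 h.coker_eq _ _)

/-- If `α` and `β` differ by a permutation of `n + 1` transversals that moves the point `m`, then
the restriction to the transversals other than `m` lowers the rank of `β` further than that
of `α`. -/
theorem exists_mul_rank_lt [Finite A] [Finite B] {n : ℕ} {α β : Setoid (A ⊕ B)}
    {u : Fin (n + 1) → A} {v : Fin (n + 1) → B} {π : Equiv.Perm (Fin (n + 1))}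
    (hα : Reps α u v) (hβ : Reps β u (v ∘ π)) (hπ : π ≠ 1) :
    ∃ (a : Setoid (A ⊕ A)) (b : Setoid (B ⊕ A)), rank a = n ∧ rank b = n ∧
      rank (comp (comp a α) b) = n ∧ rank (comp (comp a β) b) < n := by
  obtain ⟨m, hm⟩ : ∃ m, π m ≠ m := by
    by_contra! h
    exact hπ (Equiv.ext h)
  have hu := hα.injective_left
  have hv := hα.injective_right
  have hJ : m.succAbove.Injective := Fin.succAbove_right_injective
  refine ⟨Partn.link (hu.comp hJ) (hu.comp hJ), Partn.link (hv.comp hJ) (hu.comp hJ), ?_, ?_, ?_,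
    lt_of_not_ge fun hr => ?_⟩
  · rw [rank_link, Nat.card_fin]
  · rw [rank_link, Nat.card_fin]
  · obtain ⟨K, L, hs, ht, rfl⟩ := hα.exists_eq_glue
    have he : comp (Partn.link (hu.comp hJ) (hu.comp hJ)) (glue K L u v hs ht) =
        glue ⊥ L (u ∘ m.succAbove) (v ∘ m.succAbove) (fun _ _ h => (hu.comp hJ) h)
          (fun _ _ h => hJ (ht _ _ h)) :=
      comp_glue m.succAbove hJ (fun _ => Setoid.refl' _ _) (by rwa [bot_sup_eq])
    rw [he]
    refine (congrArg rank (glue_comp_link id Function.injective_id (fun _ => rfl) ?_)).trans ?_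
    · exact fun i j hij => hJ (ht _ _ hij)
    · rw [rank_glue, Nat.card_fin]
  · obtain ⟨K, L, hs, ht, rfl⟩ := hβ.exists_eq_glue
    have he : comp (Partn.link (hu.comp hJ) (hu.comp hJ)) (glue K L u (v ∘ π) hs ht) =
        glue ⊥ L (u ∘ m.succAbove) ((v ∘ π) ∘ m.succAbove) (fun _ _ h => (hu.comp hJ) h)
          (fun _ _ h => hJ (ht _ _ h)) :=
      comp_glue m.succAbove hJ (fun _ => Setoid.refl' _ _) (by rwa [bot_sup_eq])
    rw [he] at hr
    have h1 := (reps_glue.nondeg_right ((Nat.card_fin n).le.trans hr)).1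
    rw [mid_link_right, coker_glue] at h1
    have hm' : π⁻¹ m ≠ m := fun h => hm (by simpa using congrArg π h.symm)
    obtain ⟨i, hi⟩ := Fin.exists_succAbove_eq hm'
    obtain ⟨y, z, hy, l, rfl, -⟩ := h1 i
    have h2 : L ((v ∘ π) (m.succAbove i)) ((v ∘ π) (π⁻¹ (m.succAbove l))) := by
      simpa using hy
    have h3 := ht _ _ h2
    rw [hi] at h3
    exact Fin.succAbove_ne m l (π⁻¹.injective h3).symm

/-- Partitions that differ by a permutation `π` from `N` are multiples, by common multipliers, of
the partial identity on `k` given points and of the permutation `π` of these points. -/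
theorem Twist.exists_glue {k : ℕ} {N : Subgroup (Equiv.Perm (Fin k))} {α β : Setoid (A ⊕ B)}
    (h : Twist N α β) {E : Type u} {p : Fin k → E} (hp : p.Injective) :
    ∃ (a : Setoid (A ⊕ E)) (b : Setoid (E ⊕ B)), rank a = k ∧ rank b = k ∧ ∃ π ∈ N,
      α = comp a (comp (link hp hp) b) ∧
      β = comp a (comp (link hp (hp.comp π.injective)) b) := by
  obtain ⟨u, v, π, hπ, h1, h2⟩ := h.perm
  have hβ := h2.eq_glue
  have hk := h.ker_eq
  have hc := h.coker_eq
  obtain ⟨K, L, hu, hv, rfl⟩ := h1.exists_eq_glue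
  obtain ⟨K', L', hu', hv', rfl⟩ := h2.exists_eq_glue
  obtain rfl : K = K' := hk
  obtain rfl : L = L' := hc
  have hp' : ∀ i j, (⊥ : Setoid E) (p i) (p j) → i = j := fun _ _ h => hp h
  refine ⟨glue K ⊥ u p hu hp', glue ⊥ L p v hp' hv, ?_, ?_, π, hπ, ?_, ?_⟩
  · rw [rank_glue, Nat.card_fin]
  · rw [rank_glue, Nat.card_fin]
  · rw [link_comp_glue, comp_glue_glue (fun _ => Setoid.refl' _ _) (by rwa [sup_idem])]
  · have : comp (link hp (hp.comp π.injective)) (glue ⊥ L p v hp' hv) =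
        glue ⊥ L p (v ∘ π) hp' hv' :=
      comp_glue π π.injective (fun _ => Setoid.refl' _ _) (by rwa [sup_idem])
    rw [this, comp_glue_glue (fun _ => Setoid.refl' _ _) (by rwa [sup_idem])]

theorem twist_link {k : ℕ} {N : Subgroup (Equiv.Perm (Fin k))} {p : Fin k → A}
    (hp : p.Injective) {π ρ : Equiv.Perm (Fin k)} (hπ : π⁻¹ * ρ ∈ N) :
    Twist N (link hp (hp.comp π.injective)) (link hp (hp.comp ρ.injective)) := by
  refine ⟨rfl, rfl, p, p ∘ π, π⁻¹ * ρ, hπ, reps_link, ?_⟩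
  have : (p ∘ π) ∘ (π⁻¹ * ρ : Equiv.Perm (Fin k)) = p ∘ ρ := by
    ext i
    simp
  rw [this]
  exact reps_link

end Partn

namespace PartCat

open PSem

variable {X : Type u} {C : Set (Finset X)} {r : ℕ∞} {σ : HomRel (PartCat C)}

/-! ### Morphisms of the partition category -/

section Basic
variable {A B E : PartCat C}

theorem rank_comp_le_left (α : A ⟶ B) (β : B ⟶ E) : rank (α ≫ β) ≤ rank α :=
  Partn.rank_comp_le_left α β

theorem rank_comp_le_right (α : A ⟶ B) (β : B ⟶ E) : rank (α ≫ β) ≤ rank β :=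
  Partn.rank_comp_le_right α β

theorem ker_comp_of_rank_le_one {α : A ⟶ B} (h : rank α ≤ 1) (β : B ⟶ E) :
    ker (α ≫ β) = ker α := Partn.ker_comp_of_rank_le_one h β

theorem coker_comp_of_rank_le_one {β : B ⟶ E} (h : rank β ≤ 1) (α : A ⟶ B) :
    coker (α ≫ β) = coker β := Partn.coker_comp_of_rank_le_one h α

theorem ext_of_rank_eq_zero {α β : A ⟶ B} (hα : rank α = 0) (hβ : rank β = 0)
    (hk : ker α = ker β) (hc : coker α = coker β) : α = β :=
  Partn.ext_of_rank_eq_zero hα hβ hk hc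

/-- The morphism of rank zero with kernel `K` and cokernel `L`. -/
def rect (K : Setoid A.Pt) (L : Setoid B.Pt) : A ⟶ B := Partn.rect K L

theorem ker_rect (K : Setoid A.Pt) (L : Setoid B.Pt) : ker (rect K L) = K := rfl

theorem coker_rect (K : Setoid A.Pt) (L : Setoid B.Pt) : coker (rect K L) = L := rfl

theorem rank_rect (K : Setoid A.Pt) (L : Setoid B.Pt) : rank (rect K L) = 0 :=
  Partn.rank_rect K L

theorem eq_rect {α : A ⟶ B} (h : rank α = 0) : α = rect (ker α) (coker α) := Partn.eq_rect h

theorem ker_hat (α : A ⟶ B) : ker (hat α) = ker α := Partn.ker_hat α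

theorem coker_hat (α : A ⟶ B) : coker (hat α) = coker α := Partn.coker_hat α

theorem rank_hat (α : A ⟶ B) : rank (hat α) = 0 := Partn.rank_hat α

/-- The reflection of a morphism. -/
def flip (α : A ⟶ B) : B ⟶ A := Partn.flip α

theorem flip_flip (α : A ⟶ B) : flip (flip α) = α := Partn.flip_flip α

theorem flip_comp (α : A ⟶ B) (β : B ⟶ E) : flip (α ≫ β) = flip β ≫ flip α :=
  Partn.flip_comp α β

theorem rank_flip (α : A ⟶ B) : rank (flip α) = rank α := Partn.rank_flip α

theorem rank_comp_le_of_I {r : ℕ∞} {α : A ⟶ B} (h : I C r α) (β : B ⟶ E) : I C r (α ≫ β) :=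
  le_trans (by exact_mod_cast rank_comp_le_left α β) h

theorem I_comp_right {r : ℕ∞} {β : B ⟶ E} (α : A ⟶ B) (h : I C r β) : I C r (α ≫ β) :=
  le_trans (by exact_mod_cast rank_comp_le_right α β) h

theorem I_of_rank_le {r : ℕ∞} {α : A ⟶ B} {k : ℕ} (h : rank α ≤ k) (hk : (k : ℕ∞) ≤ r) :
    I C r α := le_trans (by exact_mod_cast h) hk

end Basic

/-- The image of a relation under reflection of morphisms. -/
def flipRel (σ : HomRel (PartCat C)) : HomRel (PartCat C) := fun _ _ x y => σ (flip x) (flip y)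

theorem isCongruence_flipRel (hσ : IsCongruence (I C r) σ) :
    IsCongruence (I C r) (flipRel σ) where
  mem h := by
    have := hσ.mem h
    simpa only [I, rank_flip] using this
  refl {A B x} h := hσ.refl (by simpa only [I, rank_flip] using h)
  symm h := hσ.symm h
  trans h h' := hσ.trans h h'
  mul_left {A B E} a x y ha h := by
    unfold flipRel
    rw [flip_comp, flip_comp]
    exact hσ.mul_right _ (by simpa only [I, rank_flip] using ha) h
  mul_right {A B E} x y a ha h := by
    unfold flipRel
    rw [flip_comp, flip_comp]
    exact hσ.mul_left _ (by simpa only [I, rank_flip] using ha) h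

/-! ### Collapsed ranks -/

/-- The relation `σ` relates some morphism of rank `k` to one of smaller rank. -/
def Collapsed (σ : HomRel (PartCat C)) (k : ℕ) : Prop :=
  ∃ (A B : PartCat C) (γ δ : A ⟶ B), σ γ δ ∧ rank γ = k ∧ rank δ < k

theorem Collapsed.flipRel {k : ℕ} (h : Collapsed σ k) : Collapsed (flipRel σ) k := by
  obtain ⟨A, B, γ, δ, h1, h2, h3⟩ := h
  refine ⟨B, A, flip γ, flip δ, ?_, by rwa [rank_flip], by rwa [rank_flip]⟩
  unfold PartCat.flipRel
  rwa [flip_flip, flip_flip]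

theorem mul_mul (hσ : IsCongruence (I C r) σ) {A B A' B' : PartCat C} {γ δ : A ⟶ B}
    (h : σ γ δ) (a : A' ⟶ A) (b : B ⟶ B')
    (ha : I C r a) (hb : I C r b) : σ ((a ≫ γ) ≫ b) ((a ≫ δ) ≫ b) :=
  hσ.mul_right b hb (hσ.mul_left a ha h)

theorem Collapsed.le {k : ℕ} (hk : Collapsed σ k)
    (hσ : IsCongruence (I C r) σ) : (k : ℕ∞) ≤ r := by
  obtain ⟨A, B, γ, δ, h1, rfl, -⟩ := hk
  exact (hσ.mem h1).1

/-- If rank `k` is collapsed, then every morphism of rank `k` is related to one of smaller rank; for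
`k = 1`, to the one of rank zero with the same kernel and cokernel. -/
theorem Collapsed.exists_rank_lt {k : ℕ} (hk : Collapsed σ k)
    (hσ : IsCongruence (I C r) σ) {A B : PartCat C} (ζ : A ⟶ B)
    (hζ : rank ζ = k) : ∃ ζ' : A ⟶ B, σ ζ ζ' ∧ rank ζ' < k ∧
      (k ≤ 1 → ker ζ' = ker ζ ∧ coker ζ' = coker ζ) := by
  have hkr := hk.le hσ
  obtain ⟨A', B', γ, δ, h1, h2, h3⟩ := hk
  obtain ⟨(a : A ⟶ A'), (b : B' ⟶ B), ha, hb, hka, hkb, he⟩ :=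
    Partn.exists_mul_eq (γ := γ) (ζ := ζ) (hζ.trans h2.symm)
  have ha' : rank a = k := ha.trans h2
  have hb' : rank b = k := hb.trans h2
  have he' : (a ≫ γ) ≫ b = ζ := he
  have h4 := mul_mul hσ h1 a b (I_of_rank_le ha'.le hkr) (I_of_rank_le hb'.le hkr)
  rw [he'] at h4
  have h5 : rank (a ≫ δ) < k := (rank_comp_le_right a δ).trans_lt h3
  refine ⟨_, h4, (rank_comp_le_left _ b).trans_lt h5, fun hk1 => ⟨?_, ?_⟩⟩
  · rw [ker_comp_of_rank_le_one (by omega), ker_comp_of_rank_le_one (by omega)]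
    exact hka
  · rw [coker_comp_of_rank_le_one (by omega)]
    exact hkb

/-- A morphism of rank one is related to the morphism of rank zero with the same kernel and
cokernel, if it is related to any morphism of rank zero. -/
theorem Collapsed.hat (h1 : Collapsed σ 1)
    (hσ : IsCongruence (I C r) σ) {A B : PartCat C} (ζ : A ⟶ B) (hζ : rank ζ ≤ 1) :
    σ ζ (hat ζ) := by
  have h0 : ∀ ζ' : A ⟶ B, rank ζ' = 0 → ker ζ' = ker ζ → coker ζ' = coker ζ →
      ζ' = PartCat.hat ζ := fun ζ' h hk hc =>
    ext_of_rank_eq_zero h (rank_hat ζ) (by rw [hk, ker_hat]) (by rw [hc, coker_hat])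
  rcases Nat.le_one_iff_eq_zero_or_eq_one.1 hζ with h | h
  · rw [← h0 ζ h rfl rfl]
    exact hσ.refl (I_of_rank_le h.le (by simp))
  · obtain ⟨ζ', h2, h3, h4⟩ := h1.exists_rank_lt hσ ζ h
    rwa [← h0 ζ' (by omega) (h4 le_rfl).1 (h4 le_rfl).2]

/-- On a rank that is not collapsed, a congruence is contained in Green's relation `𝓗`. -/
theorem hRel_of_not_collapsed (hσ : IsCongruence (I C r) σ) {A B : PartCat C} {α β : A ⟶ B}
    (h : σ α β) (hk : 1 ≤ rank α)
    (hle : rank β ≤ rank α) (hc : ¬ Collapsed σ (rank α)) :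
    rank β = rank α ∧ Partn.HRel α β := by
  have hr := (hσ.mem h).1
  have key : ∀ {A B : PartCat C} {γ δ : A ⟶ B}, σ γ δ → rank γ ≤ rank α → rank δ ≤ rank α →
      rank α ≤ rank γ → rank α ≤ rank δ := by
    intro A' B' γ δ hγδ h1 _ h2
    by_contra! h3
    exact hc ⟨A', B', γ, δ, hγδ, le_antisymm h1 h2, h3⟩
  have hβ : rank β = rank α := le_antisymm hle (key h le_rfl hle le_rfl)
  refine ⟨hβ, Partn.HRel.of_mul_rank hk rfl hβ ?_ ?_⟩
  · intro x hx
    have h1 : σ ((x : A ⟶ A) ≫ α) ((x : A ⟶ A) ≫ β) := hσ.mul_left (x : A ⟶ A)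
      (I_of_rank_le hx hr) h
    exact ⟨key h1 (rank_comp_le_right _ _) ((rank_comp_le_right _ _).trans hle),
      key (hσ.symm h1) ((rank_comp_le_right _ _).trans hle) (rank_comp_le_right _ _)⟩
  · intro x hx
    have h1 : σ (α ≫ (x : B ⟶ B)) (β ≫ (x : B ⟶ B)) := hσ.mul_right (x : B ⟶ B)
      (I_of_rank_le hx hr) h
    exact ⟨key h1 (rank_comp_le_left _ _) ((rank_comp_le_left _ _).trans hle),
      key (hσ.symm h1) ((rank_comp_le_left _ _).trans hle) (rank_comp_le_left _ _)⟩

/-- If a congruence relates two distinct `𝓗`-related morphisms of rank `n + 1`, then it relates a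
morphism of rank `n` to one of smaller rank. -/
theorem collapsed_of_hRel (hσ : IsCongruence (I C r) σ) {A B : PartCat C} {α β : A ⟶ B}
    (h : σ α β) (hH : Partn.HRel α β)
    (hne : α ≠ β) {n : ℕ} (hn : rank α = n + 1) : Collapsed σ n := by
  have hr := (hσ.mem h).1
  have hnr : (n : ℕ∞) ≤ r := le_trans (by rw [hn]; exact_mod_cast Nat.le_succ n) hr
  obtain ⟨u, v, hα⟩ := Partn.exists_reps α hn
  obtain ⟨π, hβ⟩ := hH.exists_perm hα
  have hπ : π ≠ 1 := by
    rintro rfl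
    exact hne (hH.eq_of_reps hα hβ)
  obtain ⟨(a : A ⟶ A), (b : B ⟶ A), ha, hb, h1, h2⟩ := Partn.exists_mul_rank_lt hα hβ hπ
  exact ⟨A, A, _, _, mul_mul hσ h a b (I_of_rank_le ha.le hnr) (I_of_rank_le hb.le hnr), h1, h2⟩

/-- If `σ` relates two morphisms of rank zero with different kernels, then it relates any two
morphisms of rank zero with the same cokernel: any kernel can be coarsened step by step, merging
two classes at a time. -/
theorem related_of_coker_eq (hσ : IsCongruence (I C r) σ) (h2 : 2 ≤ r) {A B : PartCat C}
    {α β : A ⟶ B} (h : σ α β)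
    (hα : rank α = 0) (hβ : rank β = 0) (hk : ker α ≠ ker β) {A' B' : PartCat C} {γ δ : A' ⟶ B'}
    (hγ : rank γ = 0) (hδ : rank δ = 0) (hc : coker γ = coker δ) : σ γ δ := by
  have hI : ∀ {A B : PartCat C} {x : A ⟶ B} {k : ℕ}, rank x = k → k ≤ 2 → I C r x := by
    intro A B x k hx hk
    exact I_of_rank_le (hx.le.trans hk) (by exact_mod_cast h2)
  wlog hpq : ∃ p q, ker α p q ∧ ¬ ker β p q generalizing α β
  · refine this (hσ.symm h) hβ hα hk.symm ?_
    by_contra! h3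
    push Not at hpq
    exact hk (Setoid.ext fun p q => ⟨hpq p q, h3 p q⟩)
  obtain ⟨p, q, hp, hq⟩ := hpq
  have key : ∀ (L : Setoid B'.Pt) (K : Setoid A'.Pt), σ (rect K L) (rect ⊤ L) := by
    intro L K
    have : Finite (Setoid A'.Pt) :=
      Finite.of_injective (fun s : Setoid A'.Pt => s.r) fun s t hst => Setoid.ext fun a b =>
        iff_of_eq (congrFun (congrFun hst a) b)
    induction K using WellFoundedGT.induction with
    | ind K ih =>
      by_cases hK : K = ⊤
      · rw [hK]
        exact hσ.refl (hI (rank_rect _ _) (by norm_num))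
      · obtain ⟨(x : A' ⟶ A), hx, hxβ, hxα⟩ := Partn.exists_merge hp hq K hK
        have h3 := mul_mul hσ h x (rect (⊥ : Setoid B.Pt) L) (hI hx le_rfl)
          (hI (rank_rect _ _) (by norm_num))
        have h4 : ∀ η : A ⟶ B, rank η = 0 →
            (x ≫ η) ≫ rect (⊥ : Setoid B.Pt) L = rect (ker (x ≫ η)) L := by
          intro η hη
          have h5 : rank (x ≫ η) = 0 := Nat.le_zero.1 (hη ▸ rank_comp_le_right x η)
          refine ext_of_rank_eq_zero (Nat.le_zero.1 (h5 ▸ rank_comp_le_left _ _))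
            (rank_rect _ _) ?_ ?_
          · rw [ker_comp_of_rank_le_one (by omega), ker_rect]
          · rw [coker_comp_of_rank_le_one (by rw [rank_rect]; omega), coker_rect, coker_rect]
        rw [h4 α hα, h4 β hβ] at h3
        have h5 : ker (x ≫ β) = K := hxβ
        rw [h5] at h3
        exact hσ.trans (hσ.symm h3) (ih _ hxα)
  rw [eq_rect hγ, eq_rect hδ, hc]
  exact hσ.trans (key _ _) (hσ.symm (key _ _))

theorem related_of_ker_eq (hσ : IsCongruence (I C r) σ) (h2 : 2 ≤ r) {A B : PartCat C}
    {α β : A ⟶ B} (h : σ α β)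
    (hα : rank α = 0) (hβ : rank β = 0) (hk : coker α ≠ coker β) {A' B' : PartCat C}
    {γ δ : A' ⟶ B'} (hγ : rank γ = 0) (hδ : rank δ = 0) (hc : ker γ = ker δ) : σ γ δ := by
  have := related_of_coker_eq (isCongruence_flipRel hσ) h2 (α := flip α) (β := flip β)
    (by unfold flipRel; rwa [flip_flip, flip_flip]) (by rwa [rank_flip]) (by rwa [rank_flip]) hk
    (γ := flip γ) (δ := flip δ) (by rwa [rank_flip]) (by rwa [rank_flip]) hc
  unfold flipRel at this
  rwa [flip_flip, flip_flip] at this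

/-- If rank `k` is collapsed, then some partial identity of rank `k` is related to an endomorphism
of smaller rank. -/
theorem Collapsed.exists_link {k : ℕ} (hk : Collapsed σ k)
    (hσ : IsCongruence (I C r) σ) :
    ∃ (A : PartCat C) (u : Fin k → A.Pt) (hu : u.Injective) (δ : A ⟶ A),
      σ (show A ⟶ A from Partn.link hu hu) δ ∧ rank δ < k := by
  have hkr := hk.le hσ
  obtain ⟨A, B, γ, δ, h1, h2, h3⟩ := hk
  obtain ⟨u, v, hr⟩ := Partn.exists_reps γ h2
  have hu := hr.injective_left
  have hv := hr.injective_right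
  let a : A ⟶ A := Partn.link hu hu
  let b : B ⟶ A := Partn.link hv hu
  have ha : rank a = k := Partn.rank_link.trans (Nat.card_fin k)
  have hb : rank b = k := Partn.rank_link.trans (Nat.card_fin k)
  have h4 := mul_mul hσ h1 a b (I_of_rank_le ha.le hkr) (I_of_rank_le hb.le hkr)
  have h5 : (a ≫ γ) ≫ b = (show A ⟶ A from Partn.link hu hu) :=
    Partn.Reps.sandwich (f := id) hr Function.bijective_id hu hv
  rw [h5] at h4
  exact ⟨A, u, hu, _, h4, ((rank_comp_le_left _ _).trans (rank_comp_le_right _ _)).trans_lt h3⟩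

/-- All positive ranks below a collapsed rank are collapsed. -/
theorem Collapsed.of_le {k : ℕ} (hk : Collapsed σ k)
    (hσ : IsCongruence (I C r) σ) {j : ℕ} (hj : 1 ≤ j) (hjk : j ≤ k) :
    Collapsed σ j := by
  rcases hjk.eq_or_lt with rfl | hlt
  · exact hk
  have hkr := hk.le hσ
  obtain ⟨A, u, hu, δ, h1, h3⟩ := hk.exists_link hσ
  rcases hj.eq_or_lt with rfl | h2
  · obtain ⟨a, b, hab⟩ := Partn.exists_link_ne h3 hu
    let x : A ⟶ A := Partn.link (Partn.injective_const (a := a)) (Partn.injective_const (a := a))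
    let y : A ⟶ A := Partn.link (Partn.injective_const (a := b)) (Partn.injective_const (a := b))
    have hx : rank x = 1 := Partn.rank_link_const a
    have hy : rank y = 1 := Partn.rank_link_const b
    have h4 := mul_mul hσ h1 x y (I_of_rank_le (hx.le.trans hjk) hkr)
      (I_of_rank_le (hy.le.trans hjk) hkr)
    obtain ⟨h5, h6⟩ := Partn.rank_link_comp_link (Partn.link hu hu) a b
    obtain ⟨h7, h8⟩ := Partn.rank_link_comp_link δ a b
    by_cases h : Partn.link hu hu (Sum.inl a) (Sum.inr b)
    · exact ⟨A, A, _, _, h4, le_antisymm h5 (h6.2 h),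
        Nat.lt_of_not_ge fun hh => hab (iff_of_true h (h8.1 hh))⟩
    · have h' : Setoid.r (self := (δ : Setoid (A.Pt ⊕ A.Pt))) (Sum.inl a) (Sum.inr b) := by
        by_contra hh
        exact hab (iff_of_false h hh)
      exact ⟨A, A, _, _, hσ.symm h4, le_antisymm h7 (h8.2 h'),
        Nat.lt_of_not_ge fun hh => h (h6.1 hh)⟩
  · obtain ⟨J, hJ, hlt⟩ := Partn.exists_rank_lt h3 hu h2 hjk
    let x : A ⟶ A := Partn.link (hu.comp hJ) (hu.comp hJ)
    have hx : rank x = j := Partn.rank_link.trans (Nat.card_fin j)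
    have h4 := hσ.mul_left x (I_of_rank_le (hx.le.trans hjk) hkr) h1
    refine ⟨A, A, _, _, h4, ?_, hlt⟩
    have : x ≫ (show A ⟶ A from Partn.link hu hu) = x :=
      Partn.link_comp_link J hJ (fun _ => rfl)
    rw [this, hx]

theorem Collapsed.related_of_coker_eq {k : ℕ} (hk : Collapsed σ k)
    (hσ : IsCongruence (I C r) σ) (h2 : 2 ≤ k)
    {A B : PartCat C} {γ δ : A ⟶ B} (hγ : rank γ = 0) (hδ : rank δ = 0)
    (hc : coker γ = coker δ) : σ γ δ := by
  have hkr := hk.le hσ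
  obtain ⟨A', u, hu, ε, h1, h3⟩ := hk.exists_link hσ
  obtain ⟨(y : A' ⟶ A'), hy, hne⟩ := Partn.exists_ker_ne h3 h2 hu
  have hy : rank y = 0 := hy
  have h4 := hσ.mul_right y (I_of_rank_le (hy.le.trans (Nat.zero_le k)) hkr) h1
  exact PartCat.related_of_coker_eq hσ (le_trans (by exact_mod_cast h2) hkr) h4
    (Nat.le_zero.1 (hy ▸ rank_comp_le_right _ _)) (Nat.le_zero.1 (hy ▸ rank_comp_le_right _ _))
    hne hγ hδ hc

theorem Collapsed.related_of_ker_eq {k : ℕ} (hk : Collapsed σ k)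
    (hσ : IsCongruence (I C r) σ) (h2 : 2 ≤ k)
    {A B : PartCat C} {γ δ : A ⟶ B} (hγ : rank γ = 0) (hδ : rank δ = 0)
    (hc : ker γ = ker δ) : σ γ δ := by
  have := hk.flipRel.related_of_coker_eq (isCongruence_flipRel hσ) h2 (γ := flip γ) (δ := flip δ)
    (by rwa [rank_flip]) (by rwa [rank_flip]) hc
  unfold PartCat.flipRel at this
  rwa [flip_flip, flip_flip] at this

/-- A congruence that lowers a rank `k ≥ 2` is universal on the ideal of all morphisms of rank at
most `k`. -/
theorem Collapsed.related {k : ℕ} (hk : Collapsed σ k)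
    (hσ : IsCongruence (I C r) σ) (h2 : 2 ≤ k) {A B : PartCat C}
    {γ δ : A ⟶ B} (hγ : rank γ ≤ k) (hδ : rank δ ≤ k) : σ γ δ := by
  have hkr := hk.le hσ
  have key : ∀ (n : ℕ) (ζ : A ⟶ B), rank ζ = n → n ≤ k → ∃ ζ' : A ⟶ B, rank ζ' = 0 ∧ σ ζ ζ' := by
    intro n
    induction n using Nat.strong_induction_on with
    | _ n ih =>
      intro ζ hζ hn
      rcases Nat.eq_zero_or_pos n with rfl | hpos
      · exact ⟨ζ, hζ, hσ.refl (I_of_rank_le (hζ.le.trans hn) hkr)⟩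
      · obtain ⟨ζ', h3, h4, -⟩ := (hk.of_le hσ hpos hn).exists_rank_lt hσ ζ hζ
        obtain ⟨ζ'', h5, h6⟩ := ih _ h4 ζ' rfl (by omega)
        exact ⟨ζ'', h5, hσ.trans h3 h6⟩
  obtain ⟨γ', h3, h4⟩ := key _ γ rfl hγ
  obtain ⟨δ', h5, h6⟩ := key _ δ rfl hδ
  refine hσ.trans h4 (hσ.trans ?_ (hσ.symm h6))
  exact hσ.trans (hk.related_of_ker_eq hσ h2 h3 (rank_rect (ker γ') (coker δ')) rfl)
    (hk.related_of_coker_eq hσ h2 (rank_rect (ker γ') (coker δ')) h5 rfl)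

/-! ### A normal form of the congruences -/

/-- The relation that identifies morphisms of rank at most `q` with the same kernel (unless `t.1`)
and the same cokernel (unless `t.2`), and morphisms of rank `q + 1` that differ by a permutation
from `N`. -/
def normalRel (r : ℕ∞) {q : ℕ} (N : Subgroup (Equiv.Perm (Fin (q + 1)))) (t : Bool × Bool) :
    HomRel (PartCat C) := fun _ _ x y =>
  (rank x ≤ q ∧ rank y ≤ q ∧ (t.1 = false → ker x = ker y) ∧ (t.2 = false → coker x = coker y)) ∨
    (I C r x ∧ x = y) ∨ Partn.Twist N x y

theorem Frame.nat_eq_link {q : ℕ} (F : Frame C q) (π : Equiv.Perm (Fin q)) :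
    F.nat π = Partn.link F.inj (F.inj.comp π.injective) := by
  refine Partn.eq_of_parts ?_ ?_ ?_
  · ext a b
    constructor
    · rintro (h | ⟨i, ⟨_, h⟩ | ⟨h, _⟩⟩)
      · exact Sum.inl_injective h
      · cases h
      · cases h
    · intro h
      exact Or.inl (congrArg Sum.inl h)
  · ext a b
    constructor
    · rintro (h | ⟨i, ⟨h, _⟩ | ⟨_, h⟩⟩)
      · exact Sum.inr_injective h
      · cases h
      · cases h
    · intro h
      exact Or.inl (congrArg Sum.inr h)
  · intro a b
    constructor
    · rintro (h | ⟨i, ⟨h1, h2⟩ | ⟨h, _⟩⟩)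
      · cases h
      · exact ⟨i, Sum.inl_injective h1, (Sum.inr_injective h2).symm⟩
      · cases h
    · rintro ⟨i, h1, h2⟩
      exact Or.inr ⟨i, Or.inl ⟨congrArg Sum.inl h1, congrArg Sum.inr h2.symm⟩⟩

theorem Frame.rank_nat {q : ℕ} (F : Frame C q) (π : Equiv.Perm (Fin q)) : rank (F.nat π) = q := by
  rw [F.nat_eq_link]
  exact Partn.rank_link.trans (Nat.card_fin q)

theorem Frame.nat_comp_nat {q : ℕ} (F : Frame C q) (π ρ : Equiv.Perm (Fin q)) :
    F.nat π ≫ F.nat ρ = F.nat (ρ * π) := by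
  rw [F.nat_eq_link, F.nat_eq_link, F.nat_eq_link]
  exact Partn.link_comp_link π π.injective (fun _ => rfl)

/-- The relation `ν_{N^♮}` does not depend on the choice of the points, nor on the ideal in which it
is computed. -/
theorem nuP_iff {q : ℕ} (hq : ((q + 1 : ℕ) : ℕ∞) ≤ r) (F : Frame C (q + 1))
    (N : Subgroup (Equiv.Perm (Fin (q + 1)))) {A B : PartCat C} {x y : A ⟶ B} :
    nuP r F N x y ↔ Partn.Twist N x y := by
  constructor
  · rintro ⟨hx, hy, a, b, _, _, -, -, ⟨π, hπ, rfl⟩, ⟨ρ, hρ, rfl⟩, rfl, rfl⟩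
    have h1 : Partn.Twist N (F.nat π) (F.nat ρ) := by
      rw [F.nat_eq_link, F.nat_eq_link]
      exact Partn.twist_link F.inj (N.mul_mem (N.inv_mem hπ) hρ)
    have hx : rank (a ≫ F.nat π ≫ b) = q + 1 := hx
    have h2 : q + 1 ≤ rank (F.nat π ≫ b) := hx.ge.trans (rank_comp_le_right a (F.nat π ≫ b))
    exact (h1.comp_right h2).comp_left hx.ge
  · intro h
    obtain ⟨(a : A ⟶ F.obj), (b : F.obj ⟶ B), ha, hb, π, hπ, h1, h2⟩ := h.exists_glue F.inj
    refine ⟨h.rank_left, h.rank_right, a, b, F.nat 1, F.nat π, Adj.of a ?_, Adj.of b ?_,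
      ⟨1, N.one_mem, rfl⟩, ⟨π, hπ, rfl⟩, ?_, ?_⟩
    · exact I_of_rank_le (le_of_eq ha) hq
    · exact I_of_rank_le (le_of_eq hb) hq
    · rw [F.nat_eq_link]
      exact h1
    · rw [F.nat_eq_link]
      exact h2

theorem greenR_iff {A B : PartCat C} {x y : A ⟶ B} (hx : rank x = 0) (hy : rank y = 0) :
    greenR (I C 0) x y ↔ ker x = ker y := by
  have hI : ∀ {A B : PartCat C} {x : A ⟶ B}, rank x = 0 → I C 0 x := fun h =>
    I_of_rank_le h.le (by simp)
  constructor
  · rintro ⟨-, -, ⟨a, -, rfl⟩, -⟩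
    exact ker_comp_of_rank_le_one (by omega) a
  · have key : ∀ {x y : A ⟶ B}, rank x = 0 → rank y = 0 → ker x = ker y →
        ∃ a : B ⟶ B, Adj (I C 0) a ∧ x = y ≫ a := by
      intro x y hx hy h
      refine ⟨rect ⊥ (coker x), Adj.of _ (hI (rank_rect _ _)), ext_of_rank_eq_zero hx
        (Nat.le_zero.1 (hy ▸ rank_comp_le_left _ _)) ?_ ?_⟩
      · rw [ker_comp_of_rank_le_one (by omega), h]
      · rw [coker_comp_of_rank_le_one (by rw [rank_rect]; omega), coker_rect]
    intro h
    exact ⟨hI hx, hI hy, key hx hy h, key hy hx h.symm⟩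

theorem greenL_iff {A B : PartCat C} {x y : A ⟶ B} (hx : rank x = 0) (hy : rank y = 0) :
    greenL (I C 0) x y ↔ coker x = coker y := by
  have hI : ∀ {A B : PartCat C} {x : A ⟶ B}, rank x = 0 → I C 0 x := fun h =>
    I_of_rank_le h.le (by simp)
  constructor
  · rintro ⟨-, -, ⟨a, -, rfl⟩, -⟩
    exact coker_comp_of_rank_le_one (by omega) a
  · have key : ∀ {x y : A ⟶ B}, rank x = 0 → rank y = 0 → coker x = coker y →
        ∃ a : A ⟶ A, Adj (I C 0) a ∧ x = a ≫ y := by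
      intro x y hx hy h
      refine ⟨rect (ker x) ⊥, Adj.of _ (hI (rank_rect _ _)), ext_of_rank_eq_zero hx
        (Nat.le_zero.1 (hy ▸ rank_comp_le_right _ _)) ?_ ?_⟩
      · rw [ker_comp_of_rank_le_one (by rw [rank_rect]; omega), ker_rect]
      · rw [coker_comp_of_rank_le_one (by omega), h]
    intro h
    exact ⟨hI hx, hI hy, key hx hy h, key hy hx h.symm⟩

theorem I_natCast_iff {q : ℕ} {A B : PartCat C} {x : A ⟶ B} : I C q x ↔ rank x ≤ q := by
  unfold I
  exact_mod_cast Iff.rfl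

/-- The four congruences `μ`, `λ`, `ρ`, `R` for given `q` and `N` in a uniform description. -/
theorem diamond_eq {q : ℕ} (hq : ((q + 1 : ℕ) : ℕ∞) ≤ r) (F : Frame C (q + 1))
    (N : Subgroup (Equiv.Perm (Fin (q + 1)))) (t : Bool × Bool) :
    diamond r F N t = normalRel r N t := by
  have key : ∀ {P : ∀ A B : PartCat C, (A ⟶ B) → (A ⟶ B) → Prop}
      {Q : ∀ A B : PartCat C, (A ⟶ B) → (A ⟶ B) → Prop} {A B : PartCat C} {x y : A ⟶ B},
      (P A B x y ↔ Q A B x y) →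
      (((I C q x ∧ I C q y ∧ P A B x y) ∨ (I C r x ∧ x = y)) ∨ nuP r F N x y ↔
      (rank x ≤ q ∧ rank y ≤ q ∧ Q A B x y) ∨ (I C r x ∧ x = y) ∨ Partn.Twist N x y) := by
    intro P Q A B x y h
    rw [nuP_iff hq, I_natCast_iff, I_natCast_iff, h, or_assoc]
  have h0 : ∀ {A B : PartCat C} (x : A ⟶ B), rank (hat x) = 0 := fun x => rank_hat x
  funext A B x y
  apply propext
  rcases t with ⟨_ | _, _ | _⟩
  · refine key (P := fun A B x y => greenH (I C 0) (hat x) (hat y))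
      (Q := fun A B x y => (false = false → ker x = ker y) ∧ (false = false → coker x = coker y)) ?_
    refine (and_congr (greenR_iff (h0 x) (h0 y)) (greenL_iff (h0 x) (h0 y))).trans ?_
    rw [ker_hat, ker_hat, coker_hat, coker_hat]
    simp
  · refine key (P := fun A B x y => greenR (I C 0) (hat x) (hat y))
      (Q := fun A B x y => (false = false → ker x = ker y) ∧ (true = false → coker x = coker y)) ?_
    refine (greenR_iff (h0 x) (h0 y)).trans ?_
    rw [ker_hat, ker_hat]
    simp
  · refine key (P := fun A B x y => greenL (I C 0) (hat x) (hat y))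
      (Q := fun A B x y => (true = false → ker x = ker y) ∧ (false = false → coker x = coker y)) ?_
    refine (greenL_iff (h0 x) (h0 y)).trans ?_
    rw [coker_hat, coker_hat]
    simp
  · refine Iff.trans ?_ (key (P := fun A B x y => True)
      (Q := fun A B x y => (true = false → ker x = ker y) ∧ (true = false → coker x = coker y)) ?_)
    · change ((I C q x ∧ I C q y) ∨ _) ∨ _ ↔ _
      rw [and_true]
      rfl
    · simp

theorem normalRel_flip {q : ℕ} {N : Subgroup (Equiv.Perm (Fin (q + 1)))} {t : Bool × Bool}
    {A B : PartCat C} {x y : A ⟶ B} (h : normalRel r N t x y) :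
    normalRel r N t.swap (flip x) (flip y) := by
  rcases h with ⟨h1, h2, h3, h4⟩ | ⟨h1, rfl⟩ | h
  · exact Or.inl ⟨by rwa [rank_flip], by rwa [rank_flip], h4, h3⟩
  · exact Or.inr (Or.inl ⟨by simpa only [I, rank_flip] using h1, rfl⟩)
  · exact Or.inr (Or.inr h.flip)

/-- The condition on `q` is needed because left multiplication by a morphism that merges
transversals of `x` and `y` preserves equality of cokernels only if there are at most two
transversals. -/
theorem normalRel_comp_left {q : ℕ} {N : Subgroup (Equiv.Perm (Fin (q + 1)))}
    {t : Bool × Bool} (ht : q ≤ 1 ∨ t = (true, true)) {A B E : PartCat C} {x y : A ⟶ B}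
    (h : normalRel r N t x y) (a : E ⟶ A) : normalRel r N t (a ≫ x) (a ≫ y) := by
  rcases h with ⟨h1, h2, h3, h4⟩ | ⟨h1, rfl⟩ | h
  · refine Or.inl ⟨(rank_comp_le_right a x).trans h1, (rank_comp_le_right a y).trans h2,
      fun h => Partn.ker_comp_congr (h3 h) a, fun h => ?_⟩
    rcases ht with hq | rfl
    · rw [coker_comp_of_rank_le_one (h1.trans hq), coker_comp_of_rank_le_one (h2.trans hq), h4 h]
    · cases h
  · exact Or.inr (Or.inl ⟨I_comp_right a h1, rfl⟩)
  · by_cases hx : q + 1 ≤ rank (a ≫ x)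
    · exact Or.inr (Or.inr (h.comp_left hx))
    · have hy : ¬ q + 1 ≤ rank (a ≫ y) := fun hy =>
        hx (h.symm.comp_left hy).rank_right.ge
      refine Or.inl ⟨by omega, by omega, fun _ => Partn.ker_comp_congr h.ker_eq a, fun ht' => ?_⟩
      rcases ht with hq | rfl
      · exact h.coker_comp_eq (by omega) a
      · cases ht'

theorem isCongruence_normalRel {q : ℕ} (hq : ((q + 1 : ℕ) : ℕ∞) ≤ r)
    {N : Subgroup (Equiv.Perm (Fin (q + 1)))} (hN : N.Normal) {t : Bool × Bool}
    (ht : q ≤ 1 ∨ t = (true, true)) :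
    IsCongruence (I C r) (normalRel (C := C) r N t) where
  mem := by
    have hI : ∀ {A B : PartCat C} {x : A ⟶ B}, rank x ≤ q + 1 → I C r x := fun h =>
      I_of_rank_le h hq
    rintro A B x y (⟨h1, h2, -⟩ | ⟨h, rfl⟩ | h)
    · exact ⟨hI (by omega), hI (by omega)⟩
    · exact ⟨h, h⟩
    · exact ⟨hI h.rank_left.le, hI h.rank_right.le⟩
  refl h := Or.inr (Or.inl ⟨h, rfl⟩)
  symm := by
    rintro A B x y (⟨h1, h2, h3, h4⟩ | ⟨h, rfl⟩ | h)
    · exact Or.inl ⟨h2, h1, fun h => (h3 h).symm, fun h => (h4 h).symm⟩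
    · exact Or.inr (Or.inl ⟨h, rfl⟩)
    · exact Or.inr (Or.inr h.symm)
  trans := by
    rintro A B x y z h h'
    rcases h with ⟨h1, h2, h3, h4⟩ | ⟨h, rfl⟩ | h
    · rcases h' with ⟨h1', h2', h3', h4'⟩ | ⟨h, rfl⟩ | h'
      · exact Or.inl ⟨h1, h2', fun h => (h3 h).trans (h3' h), fun h => (h4 h).trans (h4' h)⟩
      · exact Or.inl ⟨h1, h2, h3, h4⟩
      · have : rank y = q + 1 := h'.rank_left
        omega
    · exact h'
    · rcases h' with ⟨h1', h2', h3', h4'⟩ | ⟨h', rfl⟩ | h'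
      · have : rank y = q + 1 := h.rank_right
        omega
      · exact Or.inr (Or.inr h)
      · exact Or.inr (Or.inr (h.trans hN h'))
  mul_left a _ _ _ h := normalRel_comp_left ht h a
  mul_right {_ _ _ _ _} a _ h := by
    have ht' : q ≤ 1 ∨ t.swap = (true, true) := by
      rcases ht with h | rfl
      · exact Or.inl h
      · exact Or.inr rfl
    have := normalRel_flip (normalRel_comp_left ht' (normalRel_flip h) (flip a))
    rwa [← flip_comp, ← flip_comp, flip_flip, flip_flip, Prod.swap_swap] at this

theorem isCongruence_univ (r : ℕ∞) : IsCongruence (I C r) (univ (I C r)) where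
  mem h := h
  refl h := ⟨h, h⟩
  symm h := ⟨h.2, h.1⟩
  trans h h' := ⟨h.1, h'.2⟩
  mul_left _ _ _ _ h := ⟨I_comp_right _ h.1, I_comp_right _ h.2⟩
  mul_right _ _ h := ⟨rank_comp_le_of_I h.1 _, rank_comp_le_of_I h.2 _⟩

/-! ### Classification of the congruences -/

/-- The permutations that a congruence identifies with the identity. -/
def permSubgroup {k : ℕ} (F : Frame C k) (hσ : IsCongruence (I C r) σ) (hk : (k : ℕ∞) ≤ r) :
    Subgroup (Equiv.Perm (Fin k)) where
  carrier := {π | σ (F.nat 1) (F.nat π)}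
  one_mem' := hσ.refl (I_of_rank_le (F.rank_nat 1).le hk)
  mul_mem' {π ρ} hπ hρ := by
    have h := hσ.mul_right (F.nat π) (I_of_rank_le (F.rank_nat π).le hk) hρ
    rw [F.nat_comp_nat, F.nat_comp_nat, mul_one] at h
    exact hσ.trans hπ h
  inv_mem' {π} hπ := by
    have h := hσ.mul_right (F.nat π⁻¹) (I_of_rank_le (F.rank_nat π⁻¹).le hk) hπ
    rw [F.nat_comp_nat, F.nat_comp_nat, mul_one, inv_mul_cancel] at h
    exact hσ.symm h

theorem normal_permSubgroup {k : ℕ} (F : Frame C k) (hσ : IsCongruence (I C r) σ)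
    (hk : (k : ℕ∞) ≤ r) : (permSubgroup F hσ hk).Normal := by
  refine ⟨fun π hπ g => ?_⟩
  have h := mul_mul hσ hπ (F.nat g⁻¹) (F.nat g) (I_of_rank_le (F.rank_nat _).le hk)
    (I_of_rank_le (F.rank_nat g).le hk)
  rw [F.nat_comp_nat, F.nat_comp_nat, F.nat_comp_nat, F.nat_comp_nat, one_mul, mul_inv_cancel,
    ← mul_assoc] at h
  exact h

/-- Since partial identities and partial permutations of the frame generate all pairs of `Twist`, a
congruence contains the pairs that differ by a permutation from its own subgroup. -/
theorem related_of_twist {k : ℕ} (F : Frame C k) (hσ : IsCongruence (I C r) σ)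
    (hk : (k : ℕ∞) ≤ r) {A B : PartCat C} {x y : A ⟶ B}
    (h : Partn.Twist (permSubgroup F hσ hk) x y) : σ x y := by
  obtain ⟨(a : A ⟶ F.obj), (b : F.obj ⟶ B), ha, hb, π, hπ, h1, h2⟩ := h.exists_glue F.inj
  have hπ : σ (F.nat 1) (F.nat π) := hπ
  have h3 := hσ.mul_left a (I_of_rank_le (le_of_eq ha) hk)
    (hσ.mul_right b (I_of_rank_le (le_of_eq hb) hk) hπ)
  rw [F.nat_eq_link, F.nat_eq_link] at h3
  have h1' : x = a ≫ (show F.obj ⟶ F.obj from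
    Partn.link F.inj (F.inj.comp (1 : Equiv.Perm (Fin k)).injective)) ≫ b := h1
  have h2' : y = a ≫ (show F.obj ⟶ F.obj from
    Partn.link F.inj (F.inj.comp π.injective)) ≫ b := h2
  rw [h1', h2']
  exact h3

theorem twist_of_related {k : ℕ} (F : Frame C k) (hσ : IsCongruence (I C r) σ)
    (hk : (k : ℕ∞) ≤ r) {A B : PartCat C} {x y : A ⟶ B} (h : σ x y) (hx : rank x = k)
    (hH : Partn.HRel x y) : Partn.Twist (permSubgroup F hσ hk) x y := by
  obtain ⟨u, v, hr⟩ := Partn.exists_reps x hx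
  obtain ⟨π, hπ⟩ := hH.exists_perm hr
  refine ⟨hH.ker_eq, hH.coker_eq, u, v, π, ?_, hr, hπ⟩
  have hu := hr.injective_left
  have hv := hr.injective_right
  have h1 := mul_mul hσ h (show F.obj ⟶ A from Partn.link F.inj hu)
    (show B ⟶ F.obj from Partn.link hv F.inj)
    (I_of_rank_le (Partn.rank_link.trans (Nat.card_fin k)).le hk)
    (I_of_rank_le (Partn.rank_link.trans (Nat.card_fin k)).le hk)
  have h2 : ((show F.obj ⟶ A from Partn.link F.inj hu) ≫ x) ≫
      (show B ⟶ F.obj from Partn.link hv F.inj) = F.nat 1 := by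
    rw [F.nat_eq_link]
    exact Partn.Reps.sandwich (f := (1 : Equiv.Perm (Fin k))) hr (Equiv.bijective _) hu hv
  have h3 : ((show F.obj ⟶ A from Partn.link F.inj hu) ≫ y) ≫
      (show B ⟶ F.obj from Partn.link hv F.inj) = F.nat π := by
    rw [F.nat_eq_link]
    exact Partn.Reps.sandwich (f := π) hπ (Equiv.bijective _) hu hv
  rw [h2, h3] at h1
  exact h1

theorem bot_ne_top_of_frame (F : Frame C 2) : (⊥ : Setoid F.obj.Pt) ≠ ⊤ := by
  intro h
  have h1 : (⊥ : Setoid F.obj.Pt) (F.pt 0) (F.pt 1) := by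
    rw [h]
    trivial
  exact absurd (F.inj h1) (by decide)

/-- The congruences on `I_r`, for `r ≥ 2`. The parameter `q + 1` is the least positive rank that
is not collapsed. -/
theorem eq_univ_or_eq_normalRel (h2 : 2 ≤ r) (F : ∀ k : ℕ, (k : ℕ∞) ≤ r → Frame C k)
    (hσ : IsCongruence (I C r) σ) :
    σ = univ (I C r) ∨ ∃ (q : ℕ) (_ : ((q + 1 : ℕ) : ℕ∞) ≤ r)
      (N : Subgroup (Equiv.Perm (Fin (q + 1)))) (t : Bool × Bool),
      N.Normal ∧ (2 ≤ q → t = (true, true)) ∧ σ = normalRel r N t := by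
  classical
  by_cases hall : ∀ k : ℕ, 1 ≤ k → (k : ℕ∞) ≤ r → Collapsed σ k
  · left
    funext A B x y
    apply propext
    refine ⟨fun h => hσ.mem h, fun ⟨hx, hy⟩ => ?_⟩
    have hm : ((max 2 (max (rank x) (rank y)) : ℕ) : ℕ∞) ≤ r := by
      rcases max_choice 2 (max (rank x) (rank y)) with h | h <;> rw [h]
      · exact_mod_cast h2
      · rcases max_choice (rank x) (rank y) with h | h <;> rw [h]
        · exact hx
        · exact hy
    exact (hall _ (by omega) hm).related hσ (by omega) (by omega) (by omega)
  · right
    push Not at hall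
    obtain ⟨hk1, hkr, hk⟩ := Nat.find_spec hall
    have hmin : ∀ j, 1 ≤ j → j < Nat.find hall → Collapsed σ j := by
      intro j h1 hj
      have := Nat.find_min hall hj
      push Not at this
      exact this h1 ((by exact_mod_cast hj.le : (j : ℕ∞) ≤ _).trans hkr)
    obtain ⟨q, hq⟩ : ∃ q, Nat.find hall = q + 1 := ⟨Nat.find hall - 1, by omega⟩
    rw [hq] at hkr hk hmin
    have hlarge : ∀ j, q < j → ¬ Collapsed σ j := fun j hj hc => hk (hc.of_le hσ (by omega) hj)
    have hk2 : ((2 : ℕ) : ℕ∞) ≤ r := h2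
    have htop := bot_ne_top_of_frame (F 2 hk2)
    -- whether `σ` relates morphisms of rank zero with different kernels, or different cokernels
    let tk : Bool := decide (∃ (A B : PartCat C) (x y : A ⟶ B), σ x y ∧ rank x = 0 ∧ rank y = 0 ∧
      ker x ≠ ker y)
    let tc : Bool := decide (∃ (A B : PartCat C) (x y : A ⟶ B), σ x y ∧ rank x = 0 ∧ rank y = 0 ∧
      coker x ≠ coker y)
    have hker : ∀ {A B : PartCat C} {x y : A ⟶ B}, σ x y → rank x = 0 → rank y = 0 →
        tk = false → ker x = ker y := by
      intro A B x y h hx hy ht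
      by_contra hne
      exact of_decide_eq_false ht ⟨A, B, x, y, h, hx, hy, hne⟩
    have hcoker : ∀ {A B : PartCat C} {x y : A ⟶ B}, σ x y → rank x = 0 → rank y = 0 →
        tc = false → coker x = coker y := by
      intro A B x y h hx hy ht
      by_contra hne
      exact of_decide_eq_false ht ⟨A, B, x, y, h, hx, hy, hne⟩
    have hzero : ∀ {A B : PartCat C} {x y : A ⟶ B}, rank x = 0 → rank y = 0 →
        (tk = false → ker x = ker y) → (tc = false → coker x = coker y) → σ x y := by
      intro A B x y hx hy h h'
      have hz : rank (rect (ker x) (coker y) : A ⟶ B) = 0 := rank_rect _ _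
      refine hσ.trans (y := rect (ker x) (coker y)) ?_ ?_
      · by_cases ht : tc = false
        · rw [← h' ht, ← eq_rect hx]
          exact hσ.refl (I_of_rank_le (hx.le.trans (Nat.zero_le 2)) hk2)
        · obtain ⟨A', B', x', y', h1, h3, h4, h5⟩ := of_decide_eq_true (eq_true_of_ne_false ht)
          exact related_of_ker_eq hσ h2 h1 h3 h4 h5 hx hz rfl
      · by_cases ht : tk = false
        · rw [h ht, ← eq_rect hy]
          exact hσ.refl (I_of_rank_le (hy.le.trans (Nat.zero_le 2)) hk2)
        · obtain ⟨A', B', x', y', h1, h3, h4, h5⟩ := of_decide_eq_true (eq_true_of_ne_false ht)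
          exact related_of_coker_eq hσ h2 h1 h3 h4 h5 hz hy rfl
    have hhat : q ≤ 1 → ∀ {A B : PartCat C} (x : A ⟶ B), rank x ≤ q → σ x (hat x) := by
      intro hq1 A B x hx
      rcases Nat.eq_zero_or_pos (rank x) with h | h
      · have : hat x = x := Partn.hat_eq_self h
        rw [this]
        exact hσ.refl (I_of_rank_le (h.le.trans (Nat.zero_le 2)) hk2)
      · exact (hmin 1 le_rfl (by omega)).hat hσ x (by omega)
    have htt : 2 ≤ q → ((tk, tc) : Bool × Bool) = (true, true) := by
      intro h
      have hcol := hmin 2 (by omega) (by omega)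
      have h3 : ∀ K L M N : Setoid (F 2 hk2).obj.Pt, σ (rect K L) (rect M N) := by
        intro K L M N
        exact hcol.related hσ le_rfl (by rw [rank_rect]; omega) (by rw [rank_rect]; omega)
      have h4 : tk = true := decide_eq_true ⟨_, _, _, _, h3 ⊥ ⊥ ⊤ ⊤, rank_rect _ _, rank_rect _ _,
        htop⟩
      have h5 : tc = true := decide_eq_true ⟨_, _, _, _, h3 ⊥ ⊥ ⊤ ⊤, rank_rect _ _, rank_rect _ _,
        htop⟩
      rw [h4, h5]
    refine ⟨q, hkr, permSubgroup (F (q + 1) hkr) hσ hkr, (tk, tc),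
      normal_permSubgroup _ hσ hkr, htt, ?_⟩
    have hsymm : ∀ {A B : PartCat C} {x y : A ⟶ B},
        normalRel r (permSubgroup (F (q + 1) hkr) hσ hkr) (tk, tc) x y →
        normalRel r (permSubgroup (F (q + 1) hkr) hσ hkr) (tk, tc) y x := fun h =>
      (isCongruence_normalRel hkr (normal_permSubgroup _ hσ hkr)
        (by by_cases h : q ≤ 1
            · exact Or.inl h
            · exact Or.inr (htt (by omega)))).symm h
    funext A B x y
    apply propext
    constructor
    · intro h
      wlog hle : rank y ≤ rank x generalizing x y
      · exact hsymm (this y x (hσ.symm h) (by omega))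
      by_cases hx : rank x ≤ q
      · refine Or.inl ⟨hx, hle.trans hx, ?_⟩
        by_cases hq2 : 2 ≤ q
        · obtain ⟨h3, h4⟩ := Prod.mk.inj (htt hq2)
          rw [h3, h4]
          simp
        · have h3 : σ (hat x) (hat y) := hσ.trans (hσ.symm (hhat (by omega) x hx))
            (hσ.trans h (hhat (by omega) y (hle.trans hx)))
          have h4 := hker h3 (rank_hat x) (rank_hat y)
          have h5 := hcoker h3 (rank_hat x) (rank_hat y)
          rw [ker_hat, ker_hat] at h4
          rw [coker_hat, coker_hat] at h5
          exact ⟨h4, h5⟩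
      · obtain ⟨-, hH⟩ := hRel_of_not_collapsed hσ h (by omega) hle (hlarge _ (by omega))
        by_cases hxq : rank x = q + 1
        · exact Or.inr (Or.inr (twist_of_related _ hσ hkr h hxq hH))
        · refine Or.inr (Or.inl ⟨(hσ.mem h).1, ?_⟩)
          by_contra hne
          exact hlarge (rank x - 1) (by omega) (collapsed_of_hRel hσ h hH hne (by omega))
    · rintro (⟨h1, h3, h4, h5⟩ | ⟨h, rfl⟩ | h)
      · by_cases hq2 : 2 ≤ q
        · exact (hmin q (by omega) (by omega)).related hσ hq2 h1 h3
        · have h6 := hzero (rank_hat x) (rank_hat y) (by rw [ker_hat, ker_hat]; exact h4)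
            (by rw [coker_hat, coker_hat]; exact h5)
          exact hσ.trans (hhat (by omega) x h1) (hσ.trans h6 (hσ.symm (hhat (by omega) y h3)))
      · exact hσ.refl h
      · exact related_of_twist _ hσ hkr h

/-! ### The minimum ideal -/

theorem I_zero_iff {A B : PartCat C} {x : A ⟶ B} : I C 0 x ↔ rank x = 0 := by
  unfold I
  exact nonpos_iff_eq_zero.trans (by exact_mod_cast Iff.rfl)

theorem I_one_iff {A B : PartCat C} {x : A ⟶ B} : I C 1 x ↔ rank x ≤ 1 := by
  unfold I
  exact_mod_cast Iff.rfl

theorem isIdeal_I (hC : C.Nonempty) (r : ℕ∞) : IsIdeal ⊤ (I C r) where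
  sub _ _ := trivial
  nonempty := by
    obtain ⟨A, hA⟩ := hC
    exact ⟨⟨A, hA⟩, ⟨A, hA⟩, rect ⊤ ⊤, I_of_rank_le (k := 0) (rank_rect _ _).le (by simp)⟩
  mul_right _ _ h _ := rank_comp_le_of_I h _
  mul_left _ _ _ h := I_comp_right _ h

/-- Every morphism `y` of rank zero is a multiple of any given morphism `x`: multiplying `x` by rank
zero morphisms leaves only the kernel of the left and the cokernel of the right factor. -/
theorem I_zero_le {J : MorphismProperty (PartCat C)} (hJ : IsIdeal ⊤ J) : I C 0 ≤ J := by
  intro A B y hy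
  obtain ⟨A', B', x, hx⟩ := hJ.nonempty
  have hy := I_zero_iff.1 hy
  have h : y = (rect (ker y) ⊤ ≫ x) ≫ rect ⊤ (coker y) := by
    have h1 : rank (rect (ker y) ⊤ ≫ x) = 0 :=
      Nat.le_zero.1 ((rank_comp_le_left _ _).trans (rank_rect _ _).le)
    refine ext_of_rank_eq_zero hy (Nat.le_zero.1 (h1 ▸ rank_comp_le_left _ _)) ?_ ?_
    · rw [ker_comp_of_rank_le_one (by omega), ker_comp_of_rank_le_one (by rw [rank_rect]; omega),
        ker_rect]
    · rw [coker_comp_of_rank_le_one (by rw [rank_rect]; omega), coker_rect]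
  rw [h]
  exact hJ.mul_right _ _ (hJ.mul_left _ _ trivial hx) trivial

theorem rank_comp_eq_zero_left {A B E : PartCat C} {x : A ⟶ B} (hx : rank x = 0) (y : B ⟶ E) :
    rank (x ≫ y) = 0 := Nat.le_zero.1 (hx ▸ rank_comp_le_left x y)

theorem rank_comp_eq_zero_right {A B E : PartCat C} {y : B ⟶ E} (hy : rank y = 0) (x : A ⟶ B) :
    rank (x ≫ y) = 0 := Nat.le_zero.1 (hy ▸ rank_comp_le_right x y)

theorem isRectBand_I_zero : IsRectBand (I C 0) (ker (C := C)) coker where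
  nonempty _ := ⟨⟨⊤⟩, ⟨⊤⟩⟩
  mul_mem _ _ h _ := rank_comp_le_of_I h _
  bij A B := by
    refine ⟨fun _ _ => trivial, fun x hx y hy h => ?_, fun ⟨K, L⟩ _ => ?_⟩
    · exact ext_of_rank_eq_zero (I_zero_iff.1 hx) (I_zero_iff.1 hy) (congrArg Prod.fst h)
        (congrArg Prod.snd h)
    · exact ⟨rect K L, I_zero_iff.2 (rank_rect _ _), rfl⟩
  map_mul x y hx hy := ⟨ker_comp_of_rank_le_one (by rw [I_zero_iff.1 hx]; omega) y,
    coker_comp_of_rank_le_one (by rw [I_zero_iff.1 hy]; omega) x⟩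

theorem rect_comp_rect {A B B' E : PartCat C} (K : Setoid A.Pt) (L : Setoid B.Pt)
    (x : B ⟶ B') (K' : Setoid B'.Pt) (L' : Setoid E.Pt) :
    (rect K L ≫ x) ≫ rect K' L' = rect K L' := by
  refine ext_of_rank_eq_zero (rank_comp_eq_zero_right (rank_rect _ _) _) (rank_rect _ _) ?_ ?_
  · rw [Category.assoc, ker_comp_of_rank_le_one (by rw [rank_rect]; omega), ker_rect, ker_rect]
  · rw [coker_comp_of_rank_le_one (by rw [rank_rect]; omega), coker_rect, coker_rect]

theorem rect_comp_rect' {A B E : PartCat C} (K : Setoid A.Pt) (L : Setoid B.Pt)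
    (K' : Setoid B.Pt) (L' : Setoid E.Pt) :
    rect K L ≫ rect K' L' = rect K L' := by
  have := rect_comp_rect K L (𝟙 B) K' L'
  rwa [Category.comp_id] at this

/-- Pairs of equivalence relations on the sets of kernels and of cokernels. -/
abbrev BandData (C : Set (Finset X)) : Type u :=
  (∀ A : PartCat C, Setoid (Setoid A.Pt)) × (∀ A : PartCat C, Setoid (Setoid A.Pt))

theorem isCongruence_rectRel (E : BandData C) :
    IsCongruence (I C 0) (rectRel (I C 0) ker coker E) where
  mem h := ⟨h.1, h.2.1⟩
  refl h := ⟨h, h, Setoid.refl' _ _, Setoid.refl' _ _⟩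
  symm h := ⟨h.2.1, h.1, (E.1 _).symm h.2.2.1, (E.2 _).symm h.2.2.2⟩
  trans h h' := ⟨h.1, h'.2.1, (E.1 _).trans h.2.2.1 h'.2.2.1, (E.2 _).trans h.2.2.2 h'.2.2.2⟩
  mul_left a x y ha h := by
    obtain ⟨hx, hy, h1, h2⟩ := h
    refine ⟨I_comp_right a hx, I_comp_right a hy, ?_, ?_⟩
    · rw [(isRectBand_I_zero.map_mul a x ha hx).1, (isRectBand_I_zero.map_mul a y ha hy).1]
    · rwa [(isRectBand_I_zero.map_mul a x ha hx).2, (isRectBand_I_zero.map_mul a y ha hy).2]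
  mul_right {_ _ _ x y} a ha h := by
    obtain ⟨hx, hy, h1, h2⟩ := h
    refine ⟨rank_comp_le_of_I hx a, rank_comp_le_of_I hy a, ?_, ?_⟩
    · rwa [(isRectBand_I_zero.map_mul x a hx ha).1, (isRectBand_I_zero.map_mul y a hy ha).1]
    · rw [(isRectBand_I_zero.map_mul x a hx ha).2, (isRectBand_I_zero.map_mul y a hy ha).2]

theorem rectRel_le_iff {E E' : BandData C} :
    rectRel (I C 0) ker coker E ≤ rectRel (I C 0) ker coker E' ↔ E ≤ E' := by
  have hI : ∀ {A B : PartCat C} (K : Setoid A.Pt) (L : Setoid B.Pt), I C 0 (rect K L) :=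
    fun K L => I_zero_iff.2 (rank_rect K L)
  constructor
  · intro h
    refine ⟨fun A K K' hK => ?_, fun A K K' hK => ?_⟩
    · exact (h _ _ (rect K (⊥ : Setoid A.Pt)) (rect K' ⊥)
        ⟨hI _ _, hI _ _, hK, Setoid.refl' _ _⟩).2.2.1
    · exact (h _ _ (rect (⊥ : Setoid A.Pt) K) (rect ⊥ K')
        ⟨hI _ _, hI _ _, Setoid.refl' _ _, hK⟩).2.2.2
  · rintro h A B x y ⟨hx, hy, h1, h2⟩
    exact ⟨hx, hy, h.1 _ h1, h.2 _ h2⟩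

/-- The equivalence on kernels is read off from the morphisms with trivial cokernel, and dually; any
pair in `σ` is a product of such pairs with fixed factors. -/
theorem eq_rectRel {σ : HomRel (PartCat C)} (hσ : IsCongruence (I C 0) σ) :
    ∃ E : BandData C, σ = rectRel (I C 0) ker coker E := by
  have hI : ∀ {A B : PartCat C} (K : Setoid A.Pt) (L : Setoid B.Pt), I C 0 (rect K L) :=
    fun K L => I_zero_iff.2 (rank_rect K L)
  refine ⟨(fun A => ⟨fun K K' => σ (rect K (⊥ : Setoid A.Pt)) (rect K' ⊥),
    fun _ => hσ.refl (hI _ _), hσ.symm, hσ.trans⟩,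
    fun A => ⟨fun L L' => σ (rect (⊥ : Setoid A.Pt) L) (rect ⊥ L'),
    fun _ => hσ.refl (hI _ _), hσ.symm, hσ.trans⟩), ?_⟩
  funext A B x y
  apply propext
  constructor
  · intro h
    obtain ⟨hx, hy⟩ := hσ.mem h
    refine ⟨hx, hy, ?_, ?_⟩
    · have h1 := hσ.mul_right (rect (⊥ : Setoid B.Pt) (⊥ : Setoid A.Pt)) (hI _ _) h
      rw [eq_rect (I_zero_iff.1 hx), eq_rect (I_zero_iff.1 hy), rect_comp_rect',
        rect_comp_rect'] at h1
      exact h1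
    · have h1 := hσ.mul_left (rect (⊥ : Setoid B.Pt) (⊥ : Setoid A.Pt)) (hI _ _) h
      rw [eq_rect (I_zero_iff.1 hx), eq_rect (I_zero_iff.1 hy), rect_comp_rect',
        rect_comp_rect'] at h1
      exact h1
  · rintro ⟨hx, hy, h1, h2⟩
    have h3 := hσ.mul_right (rect (⊥ : Setoid A.Pt) (coker x)) (hI _ _) h1
    have h4 := hσ.mul_left (rect (ker y) (⊥ : Setoid B.Pt)) (hI _ _) h2
    rw [rect_comp_rect', rect_comp_rect'] at h3 h4
    rw [← eq_rect (I_zero_iff.1 hx)] at h3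
    rw [← eq_rect (I_zero_iff.1 hy)] at h4
    exact hσ.trans h3 h4

theorem cong_I_zero : Cong (I C 0) = Set.range (rectRel (I C 0) (ker (C := C)) coker) := by
  ext σ
  constructor
  · intro hσ
    obtain ⟨E, hE⟩ := eq_rectRel hσ
    exact ⟨E, hE.symm⟩
  · rintro ⟨E, rfl⟩
    exact isCongruence_rectRel E

/-- The lattice isomorphism between pairs of families of equivalences and congruences on the
minimum ideal. -/
noncomputable def bandIso : BandData C ≃o Cong (I C 0) :=
  RelIso.ofSurjective
    (OrderEmbedding.ofMapLEIff (fun E => (⟨_, isCongruence_rectRel E⟩ : Cong (I C 0)))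
      fun _ _ => rectRel_le_iff)
    fun ⟨σ, hσ⟩ => by
      obtain ⟨E, rfl⟩ := eq_rectRel hσ
      exact ⟨E, rfl⟩

/-! ### The ideal of morphisms of rank at most one -/

/-- Transversals are neither merged nor needed for kernel and cokernel of a product of morphisms of
rank at most one, so splitting them is multiplicative there. -/
theorem hat_comp {A B E : PartCat C} {x : A ⟶ B} {y : B ⟶ E} (hx : rank x ≤ 1)
    (hy : rank y ≤ 1) : hat (x ≫ y) = hat x ≫ hat y := by
  refine ext_of_rank_eq_zero (rank_hat _) (rank_comp_eq_zero_left (rank_hat _) _) ?_ ?_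
  · rw [ker_hat, ker_comp_of_rank_le_one hx, ker_comp_of_rank_le_one (by rw [rank_hat]; omega),
      ker_hat]
  · rw [coker_hat, coker_comp_of_rank_le_one hy,
      coker_comp_of_rank_le_one (by rw [rank_hat]; omega), coker_hat]

theorem hat_eq_self {A B : PartCat C} {x : A ⟶ B} (hx : rank x = 0) : hat x = x :=
  Partn.hat_eq_self hx

theorem hat_comp_eq {A B E : PartCat C} {x : A ⟶ B} {y : B ⟶ E} (hx : rank x ≤ 1)
    (hy : rank y = 0) : hat x ≫ y = x ≫ y := by
  rw [← hat_eq_self (rank_comp_eq_zero_right hy x), hat_comp hx (by omega), hat_eq_self hy]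

theorem comp_hat_eq {A B E : PartCat C} {x : A ⟶ B} {y : B ⟶ E} (hx : rank x = 0)
    (hy : rank y ≤ 1) : x ≫ hat y = x ≫ y := by
  rw [← hat_eq_self (rank_comp_eq_zero_left hx y), hat_comp (by omega) hy, hat_eq_self hx]

theorem isRetraction_hat : IsRetraction (I C 1) (I C 0) hat where
  mem x _ := I_zero_iff.2 (rank_hat x)
  map_mul _ _ hx hy := hat_comp (I_one_iff.1 hx) (I_one_iff.1 hy)
  fix _ hx := hat_eq_self (I_zero_iff.1 hx)

theorem I_one_of_I_zero {A B : PartCat C} {x : A ⟶ B} (h : I C 0 x) : I C 1 x :=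
  I_one_iff.2 ((I_zero_iff.1 h).le.trans (Nat.zero_le 1))

theorem isCongruence_sup_diag {τ : HomRel (PartCat C)} (hτ : IsCongruence (I C 0) τ) :
    IsCongruence (I C 1) (τ ⊔ diag (I C 1)) where
  mem := by
    rintro A B x y (h | ⟨h, rfl⟩)
    · exact ⟨I_one_of_I_zero (hτ.mem h).1, I_one_of_I_zero (hτ.mem h).2⟩
    · exact ⟨h, h⟩
  refl h := Or.inr ⟨h, rfl⟩
  symm := by
    rintro A B x y (h | ⟨h, rfl⟩)
    · exact Or.inl (hτ.symm h)
    · exact Or.inr ⟨h, rfl⟩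
  trans := by
    rintro A B x y z (h | ⟨h, rfl⟩) (h' | ⟨h', rfl⟩)
    · exact Or.inl (hτ.trans h h')
    · exact Or.inl h
    · exact Or.inl h'
    · exact Or.inr ⟨h, rfl⟩
  mul_left := by
    rintro A B E a x y ha (h | ⟨h, rfl⟩)
    · have := hτ.mul_left (hat a) (I_zero_iff.2 (rank_hat a)) h
      rw [hat_comp_eq (I_one_iff.1 ha) (I_zero_iff.1 (hτ.mem h).1),
        hat_comp_eq (I_one_iff.1 ha) (I_zero_iff.1 (hτ.mem h).2)] at this
      exact Or.inl this
    · exact Or.inr ⟨I_comp_right a h, rfl⟩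
  mul_right := by
    rintro A B E x y a ha (h | ⟨h, rfl⟩)
    · have := hτ.mul_right (hat a) (I_zero_iff.2 (rank_hat a)) h
      rw [comp_hat_eq (I_zero_iff.1 (hτ.mem h).1) (I_one_iff.1 ha),
        comp_hat_eq (I_zero_iff.1 (hτ.mem h).2) (I_one_iff.1 ha)] at this
      exact Or.inl this
    · exact Or.inr ⟨rank_comp_le_of_I h a, rfl⟩

theorem theta_iff {τ : HomRel (PartCat C)} (hτ : IsCongruence (I C 0) τ) {A B : PartCat C}
    {x y : A ⟶ B} : theta (I C 1) (I C 1) hat τ x y ↔ I C 1 x ∧ I C 1 y ∧ τ (hat x) (hat y) := by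
  constructor
  · rintro (h | ⟨h, rfl⟩)
    · exact h
    · exact ⟨h, h, hτ.refl (I_zero_iff.2 (rank_hat x))⟩
  · exact Or.inl

theorem isCongruence_theta {τ : HomRel (PartCat C)} (hτ : IsCongruence (I C 0) τ) :
    IsCongruence (I C 1) (theta (I C 1) (I C 1) hat τ) where
  mem h := ⟨((theta_iff hτ).1 h).1, ((theta_iff hτ).1 h).2.1⟩
  refl h := Or.inr ⟨h, rfl⟩
  symm h := by
    rw [theta_iff hτ] at h ⊢
    exact ⟨h.2.1, h.1, hτ.symm h.2.2⟩
  trans h h' := by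
    rw [theta_iff hτ] at h h' ⊢
    exact ⟨h.1, h'.2.1, hτ.trans h.2.2 h'.2.2⟩
  mul_left a x y ha h := by
    rw [theta_iff hτ] at h ⊢
    refine ⟨I_comp_right a h.1, I_comp_right a h.2.1, ?_⟩
    rw [hat_comp (I_one_iff.1 ha) (I_one_iff.1 h.1), hat_comp (I_one_iff.1 ha) (I_one_iff.1 h.2.1)]
    exact hτ.mul_left _ (I_zero_iff.2 (rank_hat a)) h.2.2
  mul_right {_ _ _ x y} a ha h := by
    rw [theta_iff hτ] at h ⊢
    refine ⟨rank_comp_le_of_I h.1 a, rank_comp_le_of_I h.2.1 a, ?_⟩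
    rw [hat_comp (I_one_iff.1 h.1) (I_one_iff.1 ha), hat_comp (I_one_iff.1 h.2.1) (I_one_iff.1 ha)]
    exact hτ.mul_right _ (I_zero_iff.2 (rank_hat a)) h.2.2

theorem sup_diag_D {τ : HomRel (PartCat C)} (hτ : IsCongruence (I C 0) τ) :
    τ ⊔ diag (D C 1) = τ ⊔ diag (I C 1) := by
  funext A B x y
  apply propext
  constructor
  · rintro (h | ⟨h, rfl⟩)
    · exact Or.inl h
    · exact Or.inr ⟨I_one_iff.2 (le_of_eq h), rfl⟩
  · rintro (h | ⟨h, rfl⟩)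
    · exact Or.inl h
    · rcases Nat.le_one_iff_eq_zero_or_eq_one.1 (I_one_iff.1 h) with h | h
      · exact Or.inl (hτ.refl (I_zero_iff.2 h))
      · exact Or.inr ⟨h, rfl⟩

/-- The congruences on the ideal of morphisms of rank at most one: either rank one is not
collapsed and the congruence is trivial there, or it is collapsed and the congruence contains the
kernel of the retraction `hat`. -/
theorem eq_sup_diag_or_eq_theta {σ : HomRel (PartCat C)} (hσ : IsCongruence (I C 1) σ) :
    ∃ τ ∈ Cong (I C 0), σ = τ ⊔ diag (I C 1) ∨ σ = theta (I C 1) (I C 1) hat τ := by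
  have hτ : IsCongruence (I C 0) (σ ⊓ univ (I C 0)) := by
    refine ⟨fun h => h.2, fun h => ⟨hσ.refl (I_one_of_I_zero h), h, h⟩,
      fun h => ⟨hσ.symm h.1, h.2.2, h.2.1⟩, fun h h' => ⟨hσ.trans h.1 h'.1, h.2.1, h'.2.2⟩,
      fun a _ _ ha h => ⟨hσ.mul_left a (I_one_of_I_zero ha) h.1, I_comp_right a h.2.1,
        I_comp_right a h.2.2⟩,
      fun a ha h => ⟨hσ.mul_right a (I_one_of_I_zero ha) h.1, rank_comp_le_of_I h.2.1 a,
        rank_comp_le_of_I h.2.2 a⟩⟩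
  refine ⟨_, hτ, ?_⟩
  by_cases h1 : Collapsed σ 1
  · right
    funext A B x y
    apply propext
    rw [theta_iff hτ]
    constructor
    · intro h
      have hx := (hσ.mem h).1
      have hy := (hσ.mem h).2
      exact ⟨hx, hy, hσ.trans (hσ.symm (h1.hat hσ x (I_one_iff.1 hx)))
        (hσ.trans h (h1.hat hσ y (I_one_iff.1 hy))), I_zero_iff.2 (rank_hat x),
        I_zero_iff.2 (rank_hat y)⟩
    · rintro ⟨hx, hy, h, -⟩
      exact hσ.trans (h1.hat hσ x (I_one_iff.1 hx))
        (hσ.trans h (hσ.symm (h1.hat hσ y (I_one_iff.1 hy))))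
  · left
    have key : ∀ {A B : PartCat C} {x y : A ⟶ B}, σ x y → rank y ≤ rank x → rank x = 1 →
        x = y := by
      intro A B x y h hle hx
      obtain ⟨-, hH⟩ := hRel_of_not_collapsed hσ h hx.ge hle (by rwa [hx])
      obtain ⟨u, v, hr⟩ := Partn.exists_reps x hx
      obtain ⟨π, hπ⟩ := hH.exists_perm hr
      rw [Subsingleton.elim π 1] at hπ
      exact hH.eq_of_reps hr hπ
    funext A B x y
    apply propext
    constructor
    · intro h
      have hx := I_one_iff.1 (hσ.mem h).1
      have hy := I_one_iff.1 (hσ.mem h).2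
      by_cases hxy : rank x = 0 ∧ rank y = 0
      · exact Or.inl ⟨h, I_zero_iff.2 hxy.1, I_zero_iff.2 hxy.2⟩
      · refine Or.inr ⟨(hσ.mem h).1, ?_⟩
        rcases le_total (rank y) (rank x) with hle | hle
        · exact key h hle (by omega)
        · exact (key (hσ.symm h) hle (by omega)).symm
    · rintro (⟨h, -⟩ | ⟨h, rfl⟩)
      · exact h
      · exact hσ.refl h

/-- The congruence on the ideal of rank at most one that corresponds to a congruence on the
minimum ideal and an element of the two-element chain. -/
def rankOneCong (p : Cong (I C 0) × Fin 2) : Cong (I C 1) :=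
  if p.2 = 0 then ⟨_, isCongruence_sup_diag p.1.2⟩ else ⟨_, isCongruence_theta p.1.2⟩

theorem rankOneCong_le_iff (F : Frame C 1) (p p' : Cong (I C 0) × Fin 2) :
    rankOneCong p ≤ rankOneCong p' ↔ p ≤ p' := by
  obtain ⟨⟨τ, hτ⟩, i⟩ := p
  obtain ⟨⟨τ', hτ'⟩, i'⟩ := p'
  have h0 : ∀ {A B : PartCat C} {x y : A ⟶ B}, τ x y →
      I C 1 x ∧ I C 1 y ∧ hat x = x ∧ hat y = y := fun h =>
    ⟨I_one_of_I_zero (hτ.mem h).1, I_one_of_I_zero (hτ.mem h).2,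
      hat_eq_self (I_zero_iff.1 (hτ.mem h).1), hat_eq_self (I_zero_iff.1 (hτ.mem h).2)⟩
  have hd : ∀ {A B : PartCat C} {x y : A ⟶ B}, τ x y → (τ' ⊔ diag (I C 1)) x y → τ' x y := by
    rintro A B x y h (h' | ⟨-, rfl⟩)
    · exact h'
    · exact hτ'.refl (hτ.mem h).1
  have ht : ∀ {A B : PartCat C} {x y : A ⟶ B}, τ x y → theta (I C 1) (I C 1) hat τ' x y →
      τ' x y := by
    intro A B x y h h'
    obtain ⟨-, -, h1⟩ := (theta_iff hτ').1 h'
    rwa [(h0 h).2.2.1, (h0 h).2.2.2] at h1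
  have hth : ∀ {A B : PartCat C} {x y : A ⟶ B}, τ x y → theta (I C 1) (I C 1) hat τ x y := by
    intro A B x y h
    refine (theta_iff hτ).2 ⟨(h0 h).1, (h0 h).2.1, ?_⟩
    rwa [(h0 h).2.2.1, (h0 h).2.2.2]
  have hle : (⟨⟨τ, hτ⟩, i⟩ : Cong (I C 0) × Fin 2) ≤ ⟨⟨τ', hτ'⟩, i'⟩ ↔ τ ≤ τ' ∧ i ≤ i' := Iff.rfl
  rw [hle]
  fin_cases i <;> fin_cases i'
  · change τ ⊔ diag (I C 1) ≤ τ' ⊔ diag (I C 1) ↔ _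
    refine ⟨fun h => ⟨fun A B x y hxy => hd hxy (h _ _ _ _ (Or.inl hxy)), le_rfl⟩, fun h => ?_⟩
    exact sup_le_sup_right h.1 _
  · change τ ⊔ diag (I C 1) ≤ theta (I C 1) (I C 1) hat τ' ↔ _
    refine ⟨fun h => ⟨fun A B x y hxy => ht hxy (h _ _ _ _ (Or.inl hxy)), by decide⟩, fun h => ?_⟩
    rintro A B x y (hxy | hxy)
    · refine (theta_iff hτ').2 ⟨(h0 hxy).1, (h0 hxy).2.1, ?_⟩
      rw [(h0 hxy).2.2.1, (h0 hxy).2.2.2]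
      exact h.1 _ _ _ _ hxy
    · exact Or.inr hxy
  · change theta (I C 1) (I C 1) hat τ ≤ τ' ⊔ diag (I C 1) ↔ _
    refine ⟨fun h => ?_, fun h => absurd h.2 (by decide)⟩
    -- a morphism of rank one is related to its image under the retraction
    have hx : rank (F.nat 1) = 1 := F.rank_nat 1
    have h1 : theta (I C 1) (I C 1) hat τ (F.nat 1) (hat (F.nat 1)) := by
      refine (theta_iff hτ).2 ⟨I_one_iff.2 hx.le, I_one_iff.2 (by rw [rank_hat]; omega), ?_⟩
      rw [hat_eq_self (rank_hat _)]
      exact hτ.refl (I_zero_iff.2 (rank_hat _))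
    rcases h _ _ _ _ h1 with h2 | ⟨-, h2⟩
    · have := I_zero_iff.1 (hτ'.mem h2).1
      omega
    · have := rank_hat (F.nat 1)
      rw [← h2] at this
      omega
  · change theta (I C 1) (I C 1) hat τ ≤ theta (I C 1) (I C 1) hat τ' ↔ _
    refine ⟨fun h => ⟨fun A B x y hxy => ht hxy (h _ _ _ _ (hth hxy)), le_rfl⟩, fun h => ?_⟩
    intro A B x y hxy
    rw [theta_iff hτ']
    rw [theta_iff hτ] at hxy
    exact ⟨hxy.1, hxy.2.1, h.1 _ _ _ _ hxy.2.2⟩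

theorem rankOneCong_surjective : Function.Surjective (rankOneCong (C := C)) := by
  rintro ⟨σ, hσ⟩
  obtain ⟨τ, hτ, rfl | rfl⟩ := eq_sup_diag_or_eq_theta hσ
  · exact ⟨(⟨τ, hτ⟩, 0), rfl⟩
  · exact ⟨(⟨τ, hτ⟩, 1), rfl⟩

/-- The congruences on the ideal of rank at most one form the direct product of the lattice of
congruences on the minimum ideal with a two-element chain. -/
noncomputable def rankOneIso (F : Frame C 1) : Cong (I C 0) × Fin 2 ≃o Cong (I C 1) :=
  RelIso.ofSurjective (OrderEmbedding.ofMapLEIff rankOneCong (rankOneCong_le_iff F))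
    rankOneCong_surjective

theorem cong_I_one : Cong (I C 1) =
    {σ | ∃ τ ∈ Cong (I C 0), σ = τ ⊔ diag (D C 1)} ∪
      {σ | ∃ τ ∈ Cong (I C 0), σ = theta (I C 1) (I C 1) hat τ} := by
  ext σ
  constructor
  · intro hσ
    obtain ⟨τ, hτ, h | h⟩ := eq_sup_diag_or_eq_theta hσ
    · exact Or.inl ⟨τ, hτ, h.trans (sup_diag_D hτ).symm⟩
    · exact Or.inr ⟨τ, hτ, h⟩
  · rintro (⟨τ, hτ, rfl⟩ | ⟨τ, hτ, rfl⟩)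
    · rw [sup_diag_D hτ]
      exact isCongruence_sup_diag hτ
    · exact isCongruence_theta hτ

/-! ### The order of the congruences -/

section Order
variable {q q' : ℕ} {N : Subgroup (Equiv.Perm (Fin (q + 1)))}
  {N' : Subgroup (Equiv.Perm (Fin (q' + 1)))} {t t' : Bool × Bool}

theorem normalRel_imp (ht : t ≤ t') {A B : PartCat C} {x y : A ⟶ B}
    (h : (t.1 = false → ker x = ker y) ∧ (t.2 = false → coker x = coker y)) :
    (t'.1 = false → ker x = ker y) ∧ (t'.2 = false → coker x = coker y) := by
  refine ⟨fun h' => h.1 ?_, fun h' => h.2 ?_⟩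
  · exact Bool.eq_false_of_le_false (h' ▸ ht.1)
  · exact Bool.eq_false_of_le_false (h' ▸ ht.2)

theorem normalRel_le_of_lt (ht : t ≤ t') (hq : q < q') :
    normalRel (C := C) r N t ≤ normalRel r N' t' := by
  rintro A B x y (⟨h1, h2, h3⟩ | h | h)
  · exact Or.inl ⟨by omega, by omega, normalRel_imp ht h3⟩
  · exact Or.inr (Or.inl h)
  · have hx : rank x = q + 1 := h.rank_left
    have hy : rank y = q + 1 := h.rank_right
    exact Or.inl ⟨by omega, by omega, fun _ => h.ker_eq, fun _ => h.coker_eq⟩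

theorem normalRel_mono {N' : Subgroup (Equiv.Perm (Fin (q + 1)))} (ht : t ≤ t') (hN : N ≤ N') :
    normalRel (C := C) r N t ≤ normalRel r N' t' := by
  rintro A B x y (⟨h1, h2, h3⟩ | h | h)
  · exact Or.inl ⟨h1, h2, normalRel_imp ht h3⟩
  · exact Or.inr (Or.inl h)
  · exact Or.inr (Or.inr (h.mono hN))

theorem not_normalRel_hat {A B : PartCat C} {x : A ⟶ B} (hq : q < rank x) :
    ¬ normalRel r N t x (hat x) := by
  have h0 := rank_hat x
  rintro (⟨h1, -⟩ | ⟨-, h⟩ | h)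
  · omega
  · rw [← h] at h0
    omega
  · have : rank (hat x) = q + 1 := h.rank_right
    omega

theorem normalRel_hat {A B : PartCat C} {x : A ⟶ B} (hq : rank x ≤ q) :
    normalRel r N t x (hat x) :=
  Or.inl ⟨hq, (rank_hat x).le.trans (Nat.zero_le q), fun _ => (ker_hat x).symm,
    fun _ => (coker_hat x).symm⟩

theorem le_of_normalRel_le (F : Frame C q) (h : normalRel (C := C) r N t ≤ normalRel r N' t') :
    q ≤ q' := by
  by_contra! hq
  have hr := F.rank_nat 1
  exact not_normalRel_hat (by rw [hr]; exact hq) (h _ _ _ _ (normalRel_hat hr.le))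

/-- The subgroup `N` is recovered from `normalRel r N t` as the set of permutations of the frame
that are related to the identity. -/
theorem subgroup_le_of_normalRel_le {N' : Subgroup (Equiv.Perm (Fin (q + 1)))}
    (F : Frame C (q + 1)) (hN' : N'.Normal) (h : normalRel (C := C) r N t ≤ normalRel r N' t') :
    N ≤ N' := by
  intro π hπ
  have h1 : Partn.Twist N (F.nat 1) (F.nat π) := by
    rw [F.nat_eq_link, F.nat_eq_link]
    exact Partn.twist_link F.inj (by simpa using hπ)
  have h2 : Partn.Twist N' (F.nat 1) (F.nat π) := by
    rcases h _ _ _ _ (Or.inr (Or.inr h1)) with ⟨h2, -⟩ | ⟨-, h2⟩ | h2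
    · have := F.rank_nat 1
      omega
    · rw [← h2]
      exact Partn.Twist.of_rank N' (F.rank_nat 1)
    · exact h2
  rw [F.nat_eq_link, F.nat_eq_link] at h2
  obtain ⟨ρ, hρ, h3⟩ := h2.exists_perm hN' (u := F.pt) (v := F.pt) Partn.reps_link
  have : π = ρ := by
    ext i
    obtain ⟨j, hj, hj'⟩ := h3.link i
    obtain rfl := F.inj hj
    exact congrArg Fin.val (F.inj hj')
  rwa [this]

theorem bool_le_of_normalRel_le (F : Frame C 2)
    (h : normalRel (C := C) r N t ≤ normalRel r N' t') : t ≤ t' := by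
  have key : ∀ K L K' L' : Setoid F.obj.Pt,
      (t.1 = false → K = K') → (t.2 = false → L = L') →
      (t'.1 = false → K = K') ∧ (t'.2 = false → L = L') := by
    intro K L K' L' h1 h2
    have h0 : ∀ K L : Setoid F.obj.Pt, rank (rect K L : F.obj ⟶ F.obj) = 0 := rank_rect
    have h3 : normalRel r N t (rect K L : F.obj ⟶ F.obj) (rect K' L') :=
      Or.inl ⟨by rw [h0]; omega, by rw [h0]; omega, h1, h2⟩
    rcases h _ _ _ _ h3 with ⟨-, -, h4⟩ | ⟨-, h4⟩ | h4
    · exact h4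
    · exact ⟨fun _ => congrArg (fun x => ker x) h4, fun _ => congrArg (fun x => coker x) h4⟩
    · exact ⟨fun _ => h4.ker_eq, fun _ => h4.coker_eq⟩
  have hne := bot_ne_top_of_frame F
  constructor
  · intro h1
    by_contra h2
    exact hne ((key ⊥ ⊥ ⊤ ⊥ (fun h => by rw [h1] at h; cases h) (fun _ => rfl)).1
      (Bool.eq_false_of_not_eq_true h2))
  · intro h1
    by_contra h2
    exact hne ((key ⊥ ⊥ ⊥ ⊤ (fun _ => rfl) (fun h => by rw [h1] at h; cases h)).2
      (Bool.eq_false_of_not_eq_true h2))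

theorem normalRel_le_univ (hq : ((q + 1 : ℕ) : ℕ∞) ≤ r) :
    normalRel (C := C) r N t ≤ univ (I C r) := by
  rintro A B x y (⟨h1, h2, -⟩ | ⟨h, rfl⟩ | h)
  · exact ⟨I_of_rank_le (by omega) hq, I_of_rank_le (by omega) hq⟩
  · exact ⟨h, h⟩
  · exact ⟨I_of_rank_le h.rank_left.le hq, I_of_rank_le h.rank_right.le hq⟩

theorem not_univ_le_normalRel (F : Frame C (q + 1)) (hq : ((q + 1 : ℕ) : ℕ∞) ≤ r) :
    ¬ univ (I C r) ≤ normalRel r N t := by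
  intro h
  have hr := F.rank_nat 1
  refine not_normalRel_hat (N := N) (t := t) (x := F.nat 1) (by omega) (h _ _ _ _ ⟨?_, ?_⟩)
  · exact I_of_rank_le hr.le hq
  · exact I_of_rank_le ((rank_hat _).le.trans (Nat.zero_le _)) hq

end Order

/-! ### The lattice of congruences -/

theorem Fig.cases (x : Fig r) : x = ⊤ ∨ (∃ i t, x = Fig.low i t) ∨
    ∃ q h N, x = Fig.up q h N := by
  rcases x with _ | (⟨i, t⟩ | ⟨⟨q, h⟩, N⟩)
  · exact Or.inl rfl
  · exact Or.inr (Or.inl ⟨i, t, rfl⟩)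
  · exact Or.inr (Or.inr ⟨q, h, N, rfl⟩)

theorem Fig.low_le_low {i i' : Fin 3} {t t' : Bool × Bool} :
    (Fig.low i t : Fig r) ≤ Fig.low i' t' ↔ i ≤ i' ∧ t ≤ t' :=
  WithTop.coe_le_coe.trans Sum.Lex.inl_le_inl_iff

theorem Fig.low_le_up {i : Fin 3} {t : Bool × Bool} {q : ℕ} {h : 2 ≤ q ∧ (q : ℕ∞) < r}
    {N : NormalSub (q + 1)} : Fig.low i t ≤ Fig.up q h N :=
  WithTop.coe_le_coe.2 (Sum.Lex.inl_le_inr _ _)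

theorem Fig.not_up_le_low {i : Fin 3} {t : Bool × Bool} {q : ℕ} {h : 2 ≤ q ∧ (q : ℕ∞) < r}
    {N : NormalSub (q + 1)} : ¬ Fig.up q h N ≤ Fig.low i t :=
  fun hle => Sum.Lex.not_inr_le_inl (WithTop.coe_le_coe.1 hle)

theorem Fig.up_le_up {q q' : ℕ} {h : 2 ≤ q ∧ (q : ℕ∞) < r} {h' : 2 ≤ q' ∧ (q' : ℕ∞) < r}
    {N : NormalSub (q + 1)} {N' : NormalSub (q' + 1)} : Fig.up q h N ≤ Fig.up q' h' N' ↔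
      q < q' ∨ ∃ e : q = q', e ▸ N ≤ N' := by
  refine WithTop.coe_le_coe.trans (Sum.Lex.inr_le_inr_iff.trans (Sigma.Lex.le_def.trans
    (or_congr Iff.rfl ?_)))
  constructor
  · rintro ⟨e, he⟩
    obtain rfl : q = q' := congrArg Subtype.val e
    exact ⟨rfl, he⟩
  · rintro ⟨rfl, he⟩
    exact ⟨rfl, he⟩

/-- The congruence that corresponds to an element of the bottom part of the lattice. -/
def lowRel (r : ℕ∞) (i : Fin 3) (t : Bool × Bool) : HomRel (PartCat C) :=
  match i with
  | 0 => normalRel r (q := 0) ⊤ t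
  | 1 => normalRel r (q := 1) ⊥ t
  | 2 => normalRel r (q := 1) ⊤ t

/-- The congruence that corresponds to an element of the lattice. -/
def figRel : Fig r → HomRel (PartCat C) :=
  WithTop.recTopCoe (univ (I C r)) fun y =>
    Sum.elim (fun p => lowRel r p.1 p.2)
      (fun s => normalRel r (ofLex s).2.1 (true, true)) (ofLex y)

theorem lowRel_eq (i : Fin 3) : ∃ (q : ℕ) (N : Subgroup (Equiv.Perm (Fin (q + 1)))),
    q ≤ 1 ∧ N.Normal ∧ ∀ t, lowRel (C := C) r i t = normalRel r N t := by
  fin_cases i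
  · exact ⟨0, ⊤, Nat.zero_le 1, inferInstance, fun _ => rfl⟩
  · exact ⟨1, ⊥, le_rfl, inferInstance, fun _ => rfl⟩
  · exact ⟨1, ⊤, le_rfl, inferInstance, fun _ => rfl⟩

theorem natCast_le_of_le_two (h2 : 2 ≤ r) {k : ℕ} (hk : k ≤ 2) : (k : ℕ∞) ≤ r :=
  le_trans (by exact_mod_cast hk) h2

theorem lowRel_le_iff (h2 : 2 ≤ r) (F : ∀ k : ℕ, (k : ℕ∞) ≤ r → Frame C k) (i i' : Fin 3)
    (t t' : Bool × Bool) :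
    lowRel (C := C) r i t ≤ lowRel r i' t' ↔ i ≤ i' ∧ t ≤ t' := by
  have F1 := F 1 (natCast_le_of_le_two h2 (by omega))
  have F2 := F 2 (natCast_le_of_le_two h2 le_rfl)
  have hne : ¬ (⊤ : Subgroup (Equiv.Perm (Fin 2))) ≤ ⊥ := fun h =>
    absurd (Subgroup.mem_bot.1 (h (Subgroup.mem_top (Equiv.swap 0 1)))) (by decide)
  constructor
  · intro h
    have ht : t ≤ t' := by
      obtain ⟨q, N, -, -, hN⟩ := lowRel_eq (C := C) (r := r) i
      obtain ⟨q', N', -, -, hN'⟩ := lowRel_eq (C := C) (r := r) i'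
      rw [hN, hN'] at h
      exact bool_le_of_normalRel_le F2 h
    refine ⟨?_, ht⟩
    fin_cases i <;> fin_cases i' <;> try decide
    · exact absurd (le_of_normalRel_le F1 h) (by omega)
    · exact absurd (le_of_normalRel_le F1 h) (by omega)
    · exact absurd (subgroup_le_of_normalRel_le F2 inferInstance h) hne
  · rintro ⟨hi, ht⟩
    fin_cases i <;> fin_cases i' <;> try exact absurd hi (by decide)
    · exact normalRel_mono ht le_rfl
    · exact normalRel_le_of_lt ht Nat.zero_lt_one
    · exact normalRel_le_of_lt ht Nat.zero_lt_one
    · exact normalRel_mono ht le_rfl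
    · exact normalRel_mono ht bot_le
    · exact normalRel_mono ht le_rfl

theorem succ_le_of_lt {q : ℕ} (h : (q : ℕ∞) < r) : ((q + 1 : ℕ) : ℕ∞) ≤ r := by
  push_cast
  exact Order.add_one_le_of_lt h

theorem lt_of_succ_le {q : ℕ} (h : ((q + 1 : ℕ) : ℕ∞) ≤ r) : (q : ℕ∞) < r :=
  lt_of_lt_of_le (by exact_mod_cast Nat.lt_succ_self q) h

theorem le_true (t : Bool × Bool) : t ≤ (true, true) := ⟨Bool.le_true _, Bool.le_true _⟩

theorem figRel_le_iff (h2 : 2 ≤ r) (F : ∀ k : ℕ, (k : ℕ∞) ≤ r → Frame C k) (x y : Fig r) :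
    figRel (C := C) x ≤ figRel y ↔ x ≤ y := by
  have hq2 : ∀ {q : ℕ}, q ≤ 1 → ((q + 1 : ℕ) : ℕ∞) ≤ r := fun h =>
    natCast_le_of_le_two h2 (by omega)
  rcases x.cases with rfl | ⟨i, t, rfl⟩ | ⟨q, hq, N, rfl⟩ <;>
    rcases y.cases with rfl | ⟨i', t', rfl⟩ | ⟨q', hq', N', rfl⟩
  · exact iff_of_true le_rfl le_rfl
  · refine iff_of_false (fun h => ?_) (WithTop.not_top_le_coe _)
    have h : univ (I C r) ≤ lowRel r i' t' := h
    obtain ⟨q, N, hq, -, hN⟩ := lowRel_eq (C := C) (r := r) i'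
    rw [hN] at h
    exact not_univ_le_normalRel (F _ (hq2 hq)) (hq2 hq) h
  · exact iff_of_false (not_univ_le_normalRel (F _ (succ_le_of_lt hq'.2)) (succ_le_of_lt hq'.2))
      (WithTop.not_top_le_coe _)
  · refine iff_of_true ?_ le_top
    change lowRel r i t ≤ univ (I C r)
    obtain ⟨q, N, hq, -, hN⟩ := lowRel_eq (C := C) (r := r) i
    rw [hN]
    exact normalRel_le_univ (hq2 hq)
  · exact (lowRel_le_iff h2 F i i' t t').trans Fig.low_le_low.symm
  · refine iff_of_true ?_ Fig.low_le_up
    change lowRel r i t ≤ normalRel r N'.1 (true, true)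
    obtain ⟨q, N, hq, -, hN⟩ := lowRel_eq (C := C) (r := r) i
    rw [hN]
    exact normalRel_le_of_lt (le_true t) (by omega)
  · exact iff_of_true (normalRel_le_univ (succ_le_of_lt hq.2)) le_top
  · refine iff_of_false (fun h => ?_) Fig.not_up_le_low
    have h : normalRel r N.1 (true, true) ≤ lowRel r i' t' := h
    obtain ⟨q', N', hq', -, hN'⟩ := lowRel_eq (C := C) (r := r) i'
    rw [hN'] at h
    have := le_of_normalRel_le (F q hq.2.le) h
    omega
  · rw [Fig.up_le_up]
    change normalRel r N.1 (true, true) ≤ normalRel r N'.1 (true, true) ↔ _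
    constructor
    · intro h
      rcases (le_of_normalRel_le (F q hq.2.le) h).lt_or_eq with hlt | rfl
      · exact Or.inl hlt
      · exact Or.inr ⟨rfl, subgroup_le_of_normalRel_le (F _ (succ_le_of_lt hq.2)) N'.2 h⟩
    · rintro (hlt | ⟨rfl, h⟩)
      · exact normalRel_le_of_lt le_rfl hlt
      · exact normalRel_mono le_rfl h

theorem figRel_mem (h2 : 2 ≤ r) (x : Fig r) : figRel (C := C) x ∈ Cong (I C r) := by
  rcases x.cases with rfl | ⟨i, t, rfl⟩ | ⟨q, hq, N, rfl⟩
  · exact isCongruence_univ r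
  · change IsCongruence _ (lowRel r i t)
    obtain ⟨q, N, hq, hN, he⟩ := lowRel_eq (C := C) (r := r) i
    rw [he]
    exact isCongruence_normalRel (natCast_le_of_le_two h2 (by omega)) hN (Or.inl hq)
  · exact isCongruence_normalRel (succ_le_of_lt hq.2) N.2 (Or.inr rfl)

theorem subgroup_perm_two (N : Subgroup (Equiv.Perm (Fin 2))) : N = ⊥ ∨ N = ⊤ := by
  have hc : Nat.card (Equiv.Perm (Fin 2)) = 2 := by
    rw [Nat.card_eq_fintype_card, Fintype.card_perm]
    rfl
  have : Fact (Nat.card (Equiv.Perm (Fin 2))).Prime := ⟨by rw [hc]; exact Nat.prime_two⟩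
  exact N.eq_bot_or_eq_top_of_prime_card

theorem exists_figRel_eq (h2 : 2 ≤ r) (F : ∀ k : ℕ, (k : ℕ∞) ≤ r → Frame C k)
    {σ : HomRel (PartCat C)} (hσ : IsCongruence (I C r) σ) : ∃ x : Fig r, figRel x = σ := by
  rcases eq_univ_or_eq_normalRel h2 F hσ with rfl | ⟨q, hq, N, t, hN, ht, rfl⟩
  · exact ⟨⊤, rfl⟩
  · rcases lt_or_ge q 2 with hlt | hge
    · obtain rfl | rfl : q = 0 ∨ q = 1 := by omega
      · refine ⟨Fig.low 0 t, ?_⟩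
        have hN' : N = ⊤ := Subgroup.ext fun π => by
          have hπ : π = 1 := Subsingleton.elim (α := Equiv.Perm (Fin 1)) π 1
          rw [hπ]
          exact iff_of_true N.one_mem trivial
        rw [hN']
        rfl
      · rcases subgroup_perm_two N with rfl | rfl
        · exact ⟨Fig.low 1 t, rfl⟩
        · exact ⟨Fig.low 2 t, rfl⟩
    · rw [ht hge]
      exact ⟨Fig.up q ⟨hge, lt_of_succ_le hq⟩ ⟨N, hN⟩, rfl⟩

/-- The isomorphism of the lattice `Fig r` with the lattice of congruences on `I_r`. -/
noncomputable def figIso (h2 : 2 ≤ r) (F : ∀ k : ℕ, (k : ℕ∞) ≤ r → Frame C k) :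
    Fig r ≃o Cong (I C r) :=
  RelIso.ofSurjective
    (OrderEmbedding.ofMapLEIff (fun x => (⟨figRel x, figRel_mem h2 x⟩ : Cong (I C r)))
      (figRel_le_iff h2 F))
    fun ⟨_, hσ⟩ => (exists_figRel_eq h2 F hσ).imp fun _ h => Subtype.ext h

theorem IsIndex.lt_xi (hr : IsIndex C r) {k : ℕ} (hk : (k : ℕ∞) ≤ r) : (k : ℕ∞) < xi C := by
  rcases hr with h | ⟨_, h⟩
  · exact hk.trans_lt h
  · rw [h]
    exact ENat.natCast_lt_top k

theorem cong_I (h2 : 2 ≤ r) (F : ∀ k : ℕ, (k : ℕ∞) ≤ r → Frame C k) :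
    Cong (I C r) =
      {σ | ∃ (q : ℕ) (hq : (q : ℕ∞) < r) (N : Subgroup (Equiv.Perm (Fin (q + 1)))),
        q ≤ 1 ∧ N.Normal ∧
        (σ = muP r (F (q + 1) (succ_le_of_lt hq)) N ∨ σ = lamP r (F (q + 1) (succ_le_of_lt hq)) N ∨
          σ = rhoP r (F (q + 1) (succ_le_of_lt hq)) N ∨
          σ = reesP r (F (q + 1) (succ_le_of_lt hq)) N)} ∪
      {σ | ∃ (q : ℕ) (hq : (q : ℕ∞) < r) (N : Subgroup (Equiv.Perm (Fin (q + 1)))),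
        2 ≤ q ∧ N.Normal ∧ σ = reesP r (F (q + 1) (succ_le_of_lt hq)) N} ∪
      {univ (I C r)} := by
  ext σ
  constructor
  · intro hσ
    rcases eq_univ_or_eq_normalRel h2 F hσ with rfl | ⟨q, hq, N, t, hN, ht, rfl⟩
    · exact Or.inr rfl
    · left
      rw [← diamond_eq hq (F (q + 1) hq)]
      rcases lt_or_ge q 2 with hlt | hge
      · refine Or.inl ⟨q, lt_of_succ_le hq, N, by omega, hN, ?_⟩
        rcases t with ⟨_ | _, _ | _⟩
        · exact Or.inl rfl
        · exact Or.inr (Or.inr (Or.inl rfl))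
        · exact Or.inr (Or.inl rfl)
        · exact Or.inr (Or.inr (Or.inr rfl))
      · refine Or.inr ⟨q, lt_of_succ_le hq, N, hge, hN, ?_⟩
        rw [ht hge]
        rfl
  · have key : ∀ (q : ℕ) (hq : (q : ℕ∞) < r) (N : Subgroup (Equiv.Perm (Fin (q + 1))))
        (t : Bool × Bool), N.Normal → q ≤ 1 ∨ t = (true, true) →
        diamond r (F (q + 1) (succ_le_of_lt hq)) N t ∈ Cong (I C r) := by
      intro q hq N t hN ht
      rw [diamond_eq (succ_le_of_lt hq)]
      exact isCongruence_normalRel (succ_le_of_lt hq) hN ht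
    rintro ((⟨q, hq, N, hq1, hN, rfl | rfl | rfl | rfl⟩ | ⟨q, hq, N, -, hN, rfl⟩) | rfl)
    · exact key q hq N (false, false) hN (Or.inl hq1)
    · exact key q hq N (true, false) hN (Or.inl hq1)
    · exact key q hq N (false, true) hN (Or.inl hq1)
    · exact key q hq N (true, true) hN (Or.inl hq1)
    · exact key q hq N (true, true) hN (Or.inr rfl)
    · exact isCongruence_univ r

end PartCat

theorem theorem6 {X : Type u} (C : Set (Finset X)) (hC : C.Nonempty)
    (F : ∀ q : ℕ, (q : ℕ∞) < PartCat.xi C → PartCat.Frame C q) :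
    -- (i) the minimal ideal `I_0`
    ((PSem.IsIdeal ⊤ (PartCat.I C 0) ∧
        (∀ J : MorphismProperty (PartCat C), PSem.IsIdeal ⊤ J → PartCat.I C 0 ≤ J) ∧
        PSem.IsRectBand (PartCat.I C 0) PartCat.ker PartCat.coker) ∧
      PSem.Cong (PartCat.I C 0) =
        Set.range (PSem.rectRel (PartCat.I C 0) PartCat.ker PartCat.coker) ∧
      ∃ e : ((∀ A : PartCat C, Setoid (Setoid A.Pt)) × (∀ A : PartCat C, Setoid (Setoid A.Pt))) ≃o
          PSem.Cong (PartCat.I C 0),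
        ∀ E, (e E : HomRel (PartCat C)) =
          PSem.rectRel (PartCat.I C 0) PartCat.ker PartCat.coker E) ∧
    -- (ii) the ideal `I_1`
    (1 < PartCat.xi C →
      (PSem.IsIdeal ⊤ (PartCat.I C 1) ∧
        PSem.IsRetraction (PartCat.I C 1) (PartCat.I C 0) PartCat.hat) ∧
      (∀ τ ∈ PSem.Cong (PartCat.I C 0),
        τ ⊔ PSem.diag (PartCat.I C 1) ∈ PSem.Cong (PartCat.I C 1)) ∧
      PSem.Cong (PartCat.I C 1) =
        {σ | ∃ τ ∈ PSem.Cong (PartCat.I C 0), σ = τ ⊔ PSem.diag (PartCat.D C 1)} ∪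
        {σ | ∃ τ ∈ PSem.Cong (PartCat.I C 0),
          σ = PSem.theta (PartCat.I C 1) (PartCat.I C 1) PartCat.hat τ} ∧
      Nonempty (PSem.Cong (PartCat.I C 1) ≃o PSem.Cong (PartCat.I C 0) × Fin 2)) ∧
    -- (iii) the ideals `I_r` with `r ≥ 2`
    (∀ (r : ℕ∞) (h2 : 2 ≤ r) (hr : PartCat.IsIndex C r),
      PSem.Cong (PartCat.I C r) =
        {σ | ∃ (q : ℕ) (hq : (q : ℕ∞) < r) (N : Subgroup (Equiv.Perm (Fin (q + 1)))),
          q ≤ 1 ∧ N.Normal ∧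
          (σ = PartCat.muP r (F (q + 1) (hr.succ_lt hq)) N ∨
            σ = PartCat.lamP r (F (q + 1) (hr.succ_lt hq)) N ∨
            σ = PartCat.rhoP r (F (q + 1) (hr.succ_lt hq)) N ∨
            σ = PartCat.reesP r (F (q + 1) (hr.succ_lt hq)) N)} ∪
        {σ | ∃ (q : ℕ) (hq : (q : ℕ∞) < r) (N : Subgroup (Equiv.Perm (Fin (q + 1)))),
          2 ≤ q ∧ N.Normal ∧ σ = PartCat.reesP r (F (q + 1) (hr.succ_lt hq)) N} ∪
        {PSem.univ (PartCat.I C r)} ∧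
      ∃ e : PartCat.Fig r ≃o PSem.Cong (PartCat.I C r),
        (∀ (h0 : ((0 : ℕ) : ℕ∞) < r) (t : Bool × Bool),
          (e (PartCat.Fig.low 0 t) : HomRel (PartCat C)) =
            PartCat.diamond r (F (0 + 1) (hr.succ_lt h0)) ⊤ t) ∧
        (∀ (h1 : ((1 : ℕ) : ℕ∞) < r) (t : Bool × Bool),
          (e (PartCat.Fig.low 1 t) : HomRel (PartCat C)) =
              PartCat.diamond r (F (1 + 1) (hr.succ_lt h1)) ⊥ t ∧
          (e (PartCat.Fig.low 2 t) : HomRel (PartCat C)) =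
              PartCat.diamond r (F (1 + 1) (hr.succ_lt h1)) ⊤ t) ∧
        (∀ (q : ℕ) (h : 2 ≤ q ∧ (q : ℕ∞) < r) (N : PartCat.NormalSub (q + 1)),
          (e (PartCat.Fig.up q h N) : HomRel (PartCat C)) =
            PartCat.reesP r (F (q + 1) (hr.succ_lt h.2)) N.1) ∧
        (e ⊤ : HomRel (PartCat C)) = PSem.univ (PartCat.I C r)) := by
  refine ⟨⟨⟨PartCat.isIdeal_I hC 0, fun J hJ => PartCat.I_zero_le hJ, PartCat.isRectBand_I_zero⟩,
    PartCat.cong_I_zero, PartCat.bandIso, fun E => rfl⟩, fun hxi => ?_, fun r h2 hr => ?_⟩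
  · refine ⟨⟨PartCat.isIdeal_I hC 1, PartCat.isRetraction_hat⟩,
      fun τ hτ => PartCat.isCongruence_sup_diag hτ, PartCat.cong_I_one, ?_⟩
    exact ⟨(PartCat.rankOneIso (F 1 (by exact_mod_cast hxi))).symm⟩
  · have F' : ∀ k : ℕ, (k : ℕ∞) ≤ r → PartCat.Frame C k := fun k hk => F k (hr.lt_xi hk)
    refine ⟨PartCat.cong_I h2 fun k hk => F k (hr.lt_xi hk), PartCat.figIso h2 F', ?_, ?_, ?_, rfl⟩
    · intro h0 t
      rw [PartCat.diamond_eq (PartCat.succ_le_of_lt h0)]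
      rfl
    · intro h1 t
      rw [PartCat.diamond_eq (PartCat.succ_le_of_lt h1), PartCat.diamond_eq
        (PartCat.succ_le_of_lt h1)]
      exact ⟨rfl, rfl⟩
    · intro q h N
      have := PartCat.diamond_eq (PartCat.succ_le_of_lt h.2)
        (F (q + 1) (hr.succ_lt h.2)) N.1 (true, true)
      exact this.symm
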